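/- A $\mathsf{ONE\text{-}ONE\text{-}LQ}$ instance is a finite bipartite graph $G=(\mathcal A\cup\mathcal B,E)$ of agents and resources in which every vertex ranks its neighbours in a strict order (its preference list) and every resource $b$ has upper quota $1$ and a lower quota $q^-(b)\in\{0,1\}$; $b$ is an LQ resource if $q^-(b)=1$. Let $n=|\mathcal A\cup\mathcal B|$ and $m=|E|$. Write $b\succ_a b'$ if $a$ prefers $b$ to $b'$ (likewise for resources). For a matching $M$ let $M(v)$ be the partner of $v$, with $M(v)=\bot$, the least preferred choice, if $v$ is unmatched. A matching $M$ is feasible if every LQ resource is matched. It is envy-free if there are no agents $a,a'$ with $M(a')=b$, $(a,b)\in E$, $b\succ_a M(a)$ and $a\succ_b a'$. A blocking pair is an edge $(a,b)\in E\setminus M$ with $b\succ_a M(a)$ and $a\succ_b M(b)$; $M$ is relaxed stable if every agent that forms a blocking pair is matched to an LQ resource. $\mathsf{MAXEFM}$ (respectively $\mathsf{MAXRSM}$) is the problem of computing a maximum size feasible envy-free (respectively feasible relaxed stable) matching, or reporting that there is none. Let $q$ be the number of LQ resources, $\ell_{LQ}$ the length of a longest preference list of an LQ resource ($0$ if there is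 none), and $\overline{\mathcal A}$ the set of agents acceptable to at least one LQ resource. **Theorem.** For $\mathsf{ONE\text{-}ONE\text{-}LQ}$ instances, $\mathsf{MAXEFM}$ and $\mathsf{MAXRSM}$ are fixed-parameter tractable when parameterized by $(q,\ell_{LQ})$, and also when parameterized by $|\overline{\mathcal A}|$. More precisely, each of the two problems is solved by a single word-RAM algorithm (using numbers of magnitude $O(n+m+1)$) whose running time on graphs with at least one edge and without isolated vertices is both $O(m\cdot \ell_{LQ}^{\,q})$ and $O(m\cdot|\overline{\mathcal A}|!)$; on arbitrary instances it is both $O((n+m+1)\cdot\max(1,\ell_{LQ}^{\,q}))$ and $O((n+m+1)\cdot|\overline{\mathcal A}|!)$. -/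

import Mathlib

/-! ### One-to-one instances with lower quotas -/

namespace LQMatching

/-- A `ONE-ONE-LQ` instance.  The agents are `Fin nA`, the resources are `Fin nB`; every vertex has a
strict preference list over its neighbours, acceptability is mutual, every resource has upper quota
one and a lower quota which is zero or one. -/
structure Inst where
  nA : ℕ
  nB : ℕ
  prefA : Fin nA → List (Fin nB)
  prefB : Fin nB → List (Fin nA)
  lower : Fin nB → ℕ
  nodupA : ∀ a, (prefA a).Nodup
  nodupB : ∀ b, (prefB b).Nodup
  mutual_acceptable : ∀ a b, b ∈ prefA a ↔ a ∈ prefB b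
  lower_le_one : ∀ b, lower b ≤ 1

namespace Inst

variable (G : Inst)

/-- The edge set `E` of the underlying bipartite graph. -/
def edges : Finset (Fin G.nA × Fin G.nB) :=
  Finset.univ.filter fun e => e.2 ∈ G.prefA e.1

/-- The number of vertices. -/
def n : ℕ := G.nA + G.nB

/-- The number of edges. -/
def m : ℕ := G.edges.card

/-- `b` is an LQ resource: its lower quota is positive. -/
abbrev IsLQ (b : Fin G.nB) : Prop := 0 < G.lower b

/-- The set of LQ resources. -/
def lqResources : Finset (Fin G.nB) := Finset.univ.filter fun b => G.IsLQ b

/-- The number `q` of LQ resources. -/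
def q : ℕ := G.lqResources.card

/-- The length of a longest preference list of an LQ resource (zero if there is none). -/
def ellLQ : ℕ := G.lqResources.sup fun b => (G.prefB b).length

/-- The set of the agents acceptable to at least one LQ resource. -/
def lqAgents : Finset (Fin G.nA) :=
  Finset.univ.filter fun a => ∃ b, G.IsLQ b ∧ a ∈ G.prefB b

/-- The cardinality of the set of agents acceptable to LQ resources. -/
def abar : ℕ := G.lqAgents.card

/-- No vertex has an empty preference list. -/
def NoIsolated : Prop := (∀ a, G.prefA a ≠ []) ∧ ∀ b, G.prefB b ≠ []

/-- The agent `a` prefers the resource `b` to the resource `b'`, both being in its list. -/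
def AgentPrefers (a : Fin G.nA) (b b' : Fin G.nB) : Prop :=
  b ∈ G.prefA a ∧ b' ∈ G.prefA a ∧ (G.prefA a).idxOf b < (G.prefA a).idxOf b'

/-- The resource `b` prefers the agent `a` to the agent `a'`, both being in its list. -/
def ResourcePrefers (b : Fin G.nB) (a a' : Fin G.nA) : Prop :=
  a ∈ G.prefB b ∧ a' ∈ G.prefB b ∧ (G.prefB b).idxOf a < (G.prefB b).idxOf a'

/-- A matching: a set of edges in which every vertex has at most one partner. -/
def IsMatching (M : Finset (Fin G.nA × Fin G.nB)) : Prop :=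
  M ⊆ G.edges ∧
  (∀ a b b', (a, b) ∈ M → (a, b') ∈ M → b = b') ∧
  (∀ a a' b, (a, b) ∈ M → (a', b) ∈ M → a = a')

/-- No resource is deficient: every LQ resource is matched. -/
def IsFeasible (M : Finset (Fin G.nA × Fin G.nB)) : Prop :=
  ∀ b, G.IsLQ b → ∃ a, (a, b) ∈ M

/-- For a neighbour `b` of `a`: `a` prefers `b` to its partner in `M`, if it has one; being unmatched
is the least preferred choice. -/
def AgentWants (M : Finset (Fin G.nA × Fin G.nB)) (a : Fin G.nA) (b : Fin G.nB) : Prop :=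
  ∀ b', (a, b') ∈ M → G.AgentPrefers a b b'

/-- For a neighbour `a` of `b`: `b` prefers `a` to its partner in `M`, if it has one. -/
def ResourceWants (M : Finset (Fin G.nA × Fin G.nB)) (b : Fin G.nB) (a : Fin G.nA) : Prop :=
  ∀ a', (a', b) ∈ M → G.ResourcePrefers b a a'

/-- `(a, b)` is a blocking pair with respect to `M`. -/
def IsBlocking (M : Finset (Fin G.nA × Fin G.nB)) (a : Fin G.nA) (b : Fin G.nB) : Prop :=
  (a, b) ∈ G.edges ∧ (a, b) ∉ M ∧ G.AgentWants M a b ∧ G.ResourceWants M b a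

/-- The agent `a` has justified envy towards the matched agent `a'`. -/
def Envies (M : Finset (Fin G.nA × Fin G.nB)) (a a' : Fin G.nA) : Prop :=
  ∃ b, (a', b) ∈ M ∧ (a, b) ∈ G.edges ∧ G.AgentWants M a b ∧ G.ResourcePrefers b a a'

/-- There is no envy pair. -/
def IsEnvyFree (M : Finset (Fin G.nA × Fin G.nB)) : Prop :=
  ∀ a a', ¬ G.Envies M a a'

/-- Every agent that forms a blocking pair is matched to an LQ resource. -/
def IsRelaxedStable (M : Finset (Fin G.nA × Fin G.nB)) : Prop :=
  ∀ a b, G.IsBlocking M a b → ∃ b', (a, b') ∈ M ∧ G.IsLQ b'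

end Inst

/-- A maximization problem over matchings, given by its admissible solutions. -/
abbrev Problem : Type := (G : Inst) → Finset (Fin G.nA × Fin G.nB) → Prop

/-- Compute a maximum size feasible, envy-free matching. -/
def MAXEFM : Problem := fun G M => G.IsMatching M ∧ G.IsFeasible M ∧ G.IsEnvyFree M

/-- Compute a maximum size feasible, relaxed stable matching. -/
def MAXRSM : Problem := fun G M => G.IsMatching M ∧ G.IsFeasible M ∧ G.IsRelaxedStable M

/-- `M` is an admissible solution of the largest size. -/
def IsOptimal (P : Problem) (G : Inst) (M : Finset (Fin G.nA × Fin G.nB)) : Prop :=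
  P G M ∧ ∀ N, P G N → N.card ≤ M.card

/-! ### A word RAM with structured control flow

The machine has registers and arrays of cells, all holding natural numbers.  A program is a finite
piece of code, so it uses boundedly many registers and arrays.  Every operation (literal, register
access, array access by a computed index, addition, truncated subtraction, comparison, Boolean
connective, assignment, branching) costs one step. -/

/-- The contents of the registers and of the arrays. -/
structure State where
  reg : ℕ → ℕ
  arr : ℕ → ℕ → ℕ

/-- Arithmetic expressions. -/
inductive Expr where
  | lit (k : ℕ)
  | reg (r : ℕ)
  | get (k : ℕ) (i : Expr)
  | add (e f : Expr)
  | sub (e f : Expr)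

/-- The value of an expression. -/
def Expr.eval (s : State) : Expr → ℕ
  | .lit k => k
  | .reg r => s.reg r
  | .get k i => s.arr k (i.eval s)
  | .add e f => e.eval s + f.eval s
  | .sub e f => e.eval s - f.eval s

/-- The number of steps for evaluating an expression. -/
def Expr.cost : Expr → ℕ
  | .lit _ => 1
  | .reg _ => 1
  | .get _ i => i.cost + 1
  | .add e f => e.cost + f.cost + 1
  | .sub e f => e.cost + f.cost + 1

/-- Boolean tests. -/
inductive Test where
  | lt (e f : Expr)
  | eq (e f : Expr)
  | not (c : Test)
  | and (c d : Test)
  | or (c d : Test)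

/-- The truth value of a test. -/
def Test.holds (s : State) : Test → Prop
  | .lt e f => e.eval s < f.eval s
  | .eq e f => e.eval s = f.eval s
  | .not c => ¬ c.holds s
  | .and c d => c.holds s ∧ d.holds s
  | .or c d => c.holds s ∨ d.holds s

/-- The number of steps for evaluating a test. -/
def Test.cost : Test → ℕ
  | .lt e f => e.cost + f.cost + 1
  | .eq e f => e.cost + f.cost + 1
  | .not c => c.cost + 1
  | .and c d => c.cost + d.cost + 1
  | .or c d => c.cost + d.cost + 1

/-- Programs: `set r e` stores `e` in register `r`, `put k i e` stores `e` in cell `i` of array `k`. -/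
inductive Prog where
  | skip
  | set (r : ℕ) (e : Expr)
  | put (k : ℕ) (i e : Expr)
  | seq (p p' : Prog)
  | branch (c : Test) (p p' : Prog)
  | loop (c : Test) (p : Prog)

/-- Overwrite register `r`. -/
def State.setReg (s : State) (r v : ℕ) : State :=
  ⟨Function.update s.reg r v, s.arr⟩

/-- Overwrite cell `i` of array `k`. -/
def State.setArr (s : State) (k i v : ℕ) : State :=
  ⟨s.reg, Function.update s.arr k (Function.update (s.arr k) i v)⟩

/-- `Exec W p s t s'`: started in `s`, the program `p` halts in the state `s'` after exactly `t` steps,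
and all values that it stores, and the indices where it stores them, are at most `W`.  (Values inside
an expression then exceed `W` by at most a factor that depends only on the program.) -/
inductive Exec (W : ℕ) : Prog → State → ℕ → State → Prop
  | skip (s : State) : Exec W .skip s 1 s
  | set (s : State) (r : ℕ) (e : Expr) (h : e.eval s ≤ W) :
      Exec W (.set r e) s (e.cost + 1) (s.setReg r (e.eval s))
  | put (s : State) (k : ℕ) (i e : Expr) (hi : i.eval s ≤ W) (he : e.eval s ≤ W) :
      Exec W (.put k i e) s (i.cost + e.cost + 1) (s.setArr k (i.eval s) (e.eval s))
  | seq {p p' : Prog} {s s' s'' : State} {t t' : ℕ}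
      (h : Exec W p s t s') (h' : Exec W p' s' t' s'') :
      Exec W (.seq p p') s (t + t') s''
  | branch_true {c : Test} {p p' : Prog} {s s' : State} {t : ℕ} (hc : c.holds s)
      (h : Exec W p s t s') : Exec W (.branch c p p') s (c.cost + 1 + t) s'
  | branch_false {c : Test} {p p' : Prog} {s s' : State} {t : ℕ} (hc : ¬ c.holds s)
      (h : Exec W p' s t s') : Exec W (.branch c p p') s (c.cost + 1 + t) s'
  | loop_done {c : Test} {p : Prog} {s : State} (hc : ¬ c.holds s) :
      Exec W (.loop c p) s (c.cost + 1) s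
  | loop_step {c : Test} {p : Prog} {s s' s'' : State} {t t' : ℕ} (hc : c.holds s)
      (h : Exec W p s t s') (h' : Exec W (.loop c p) s' t' s'') :
      Exec W (.loop c p) s (c.cost + 1 + t + t') s''

/-! ### Input and output -/

/-- The starting positions of the members of a list of lists in their concatenation, followed by the
total length. -/
def offsets {α : Type} (L : List (List α)) : List ℕ :=
  (List.range (L.length + 1)).map fun i => ((L.take i).map List.length).sum

/-- The input of a program: registers 0 and 1 hold the numbers of agents and resources, arrays 0 and 1
the offsets of the agents' preference lists and their concatenation, arrays 2 and 3 the same for the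
resources, array 4 the lower quotas; everything else is zero. -/
def Inst.encode (G : Inst) : State where
  reg r := [G.nA, G.nB].getD r 0
  arr k i :=
    ([offsets (List.ofFn G.prefA),
      (List.ofFn G.prefA).flatten.map Fin.val,
      offsets (List.ofFn G.prefB),
      (List.ofFn G.prefB).flatten.map Fin.val,
      List.ofFn G.lower].getD k []).getD i 0

/-- Array 5 of the final state holds the matching `M`: cell `a` is `0` if the agent `a` is unmatched,
and `b + 1` if `a` is matched to `b`. -/
def Outputs (G : Inst) (s : State) (M : Finset (Fin G.nA × Fin G.nB)) : Prop :=
  ∀ a : Fin G.nA,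
    (∃ b : Fin G.nB, (a, b) ∈ M ∧ s.arr 5 a = b + 1) ∨ ((∀ b, (a, b) ∉ M) ∧ s.arr 5 a = 0)

/-- The final state is a correct answer: either register 2 holds `1` and array 5 an optimal solution,
or register 2 holds `0` and there is no admissible solution. -/
def IsAnswer (P : Problem) (G : Inst) (s : State) : Prop :=
  (s.reg 2 = 1 ∧ ∃ M, IsOptimal P G M ∧ Outputs G s M) ∨ (s.reg 2 = 0 ∧ ∀ M, ¬ P G M)

/-- `p` solves the instance `G` of `P` within `t` steps, using only numbers up to `W`. -/
def SolvesWithin (P : Problem) (p : Prog) (G : Inst) (W t : ℕ) : Prop :=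
  ∃ t' s, Exec W p G.encode t' s ∧ t' ≤ t ∧ IsAnswer P G s

/-- The size of an instance. -/
def Inst.size (G : Inst) : ℕ := G.n + G.m + 1

/-- `P` is fixed-parameter tractable with respect to the parameter `κ`: some program solves all
instances in time `f(κ) * size ^ c` for a computable function `f` and a constant `c`
(with numbers of that magnitude). -/
def IsFPT {K : Type} [Primcodable K] (P : Problem) (κ : Inst → K) : Prop :=
  ∃ (p : Prog) (f : K → ℕ) (c : ℕ), Computable f ∧
    ∀ G : Inst, SolvesWithin P p G (f (κ G) * G.size ^ c) (f (κ G) * G.size ^ c)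

/-- One program solves all instances of `P`, with numbers of magnitude linear in the size and
within `O(m * ℓ_LQ ^ q)` and also within `O(m * |Ā|!)` steps.  The bounds with `m` are for nonempty
graphs without isolated vertices (where `ℓ_LQ ^ q` is positive and the size is `O(m)`); on an arbitrary
instance `m` is replaced by the size of the instance, and `ℓ_LQ ^ q` by one if it is zero. -/
def HasClaimedRunningTimes (P : Problem) : Prop :=
  ∃ (p : Prog) (C : ℕ), ∀ G : Inst,
    SolvesWithin P p G (C * G.size) (C * G.size * max 1 (G.ellLQ ^ G.q)) ∧
    SolvesWithin P p G (C * G.size) (C * G.size * Nat.factorial G.abar) ∧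
    (G.NoIsolated → 0 < G.m →
      SolvesWithin P p G (C * G.size) (C * (G.m * G.ellLQ ^ G.q)) ∧
      SolvesWithin P p G (C * G.size) (C * (G.m * Nat.factorial G.abar)))

end LQMatching

namespace LQMatching

/-! ### Reasoning about programs -/

/-! Fix, for every LQ resource, the agent that it receives. If some admissible matching extends this
choice (`Layout.Ext`), then there is one that is best for all agents simultaneously, and deferred
acceptance finds it. Each agent stands at a position of its list and moves on only when no extension
can match it there, so its position is always a lower bound for its position in every extension (the
clause `bound` of `Layout.DAInv`).

The two problems differ only in whose objections count. For envy-freeness, an assigned agent on the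
way to its LQ resource forbids each other resource that it passes to take an agent ranked below it;
this is recorded as a cut in the list of that resource. For relaxed stability, the assigned agents
are excused and their walk cuts nothing. Afterwards the free agents propose as usual. If an agent
whose objection counts reaches an LQ resource that ranks it above the assigned agent, there is no
extension at all (`DAInv.refute`). Otherwise the final positions form an extension (`DAInv.ext`). As
nobody is better off in any other extension, every agent matched in some extension is matched here,
so the result is a largest one (`count_le_of_le`).

Every feasible matching induces an assignment of distinct agents to the LQ resources, so it suffices
to search all of these by backtracking. The search runs in lexicographic order; `Layout.Ahead`
describes the matchings still to come, and the invariant is that the recorded matching is best among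
all others. When nothing is ahead any more, the record is optimal.

A leaf of the search tree costs linear time, because every proposal moves an agent down its list and
preferences of resources are compared through precomputed ranks (a bucket sort, `BucketInv` and
`RankInv`). A node at depth `k` has at most `ellLQ` children, and also at most `abar - k`, since `k`
agents acceptable to LQ resources are already taken (`Search.free_add_le`). Both running times are
solutions of the one recurrence in `exists_iterates`: the first bound on the children leads to a
geometric sum, the second to a factorial. -/

theorem Exec.mono {W W' : ℕ} (h : W ≤ W') {p : Prog} {s s' : State} {t : ℕ}
    (he : Exec W p s t s') : Exec W' p s t s' := by
  induction he with
  | skip s => exact .skip s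
  | set s r e h' => exact .set s r e (h'.trans h)
  | put s k i e hi he => exact .put s k i e (hi.trans h) (he.trans h)
  | seq _ _ ih ih' => exact .seq ih ih'
  | branch_true hc _ ih => exact .branch_true hc ih
  | branch_false hc _ ih => exact .branch_false hc ih
  | loop_done hc => exact .loop_done hc
  | loop_step hc _ _ ih ih' => exact .loop_step hc ih ih'

@[simp] theorem State.setReg_reg (s : State) (r v r' : ℕ) :
    (s.setReg r v).reg r' = if r' = r then v else s.reg r' := by
  simp [State.setReg, Function.update_apply]

@[simp] theorem State.setReg_arr (s : State) (r v : ℕ) : (s.setReg r v).arr = s.arr := rfl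

@[simp] theorem State.setArr_reg (s : State) (k i v : ℕ) : (s.setArr k i v).reg = s.reg := rfl

@[simp] theorem State.setArr_arr (s : State) (k i v k' : ℕ) :
    (s.setArr k i v).arr k' = if k' = k then Function.update (s.arr k) i v else s.arr k' := by
  by_cases h : k' = k
  · subst h; simp [State.setArr]
  · simp [State.setArr, h]

/-- The program `p`, started in `s`, halts within `T` steps in a state with the property `Q`. -/
def Runs (W : ℕ) (p : Prog) (s : State) (T : ℕ) (Q : State → Prop) : Prop :=
  ∃ t s', Exec W p s t s' ∧ t ≤ T ∧ Q s'

theorem Runs.imp {W : ℕ} {p : Prog} {s : State} {T T' : ℕ} {Q Q' : State → Prop}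
    (h : Runs W p s T Q) (hT : T ≤ T') (hQ : ∀ s', Q s' → Q' s') : Runs W p s T' Q' := by
  obtain ⟨t, s', he, ht, hq⟩ := h
  exact ⟨t, s', he, ht.trans hT, hQ _ hq⟩

theorem Runs.seq {W : ℕ} {p p' : Prog} {s : State} {T T' : ℕ} {Q : State → Prop}
    (h : Runs W p s T fun s' => Runs W p' s' T' Q) : Runs W (.seq p p') s (T + T') Q := by
  obtain ⟨t, s', he, ht, t', s'', he', ht', hq⟩ := h
  exact ⟨t + t', s'', .seq he he', by omega, hq⟩

theorem Runs.branch {W : ℕ} {c : Test} {p p' : Prog} {s : State} {T T' : ℕ} {Q : State → Prop}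
    (h : c.holds s → Runs W p s T Q) (h' : ¬ c.holds s → Runs W p' s T' Q) :
    Runs W (.branch c p p') s (c.cost + 1 + T + T') Q := by
  by_cases hc : c.holds s
  · obtain ⟨t, s', he, ht, hq⟩ := h hc
    exact ⟨_, s', .branch_true hc he, by omega, hq⟩
  · obtain ⟨t, s', he, ht, hq⟩ := h' hc
    exact ⟨_, s', .branch_false hc he, by omega, hq⟩

/-! ### Weakest preconditions of loop-free code -/

/-- An upper bound for the running time of a program without loops. -/
def Prog.bound : Prog → ℕ
  | .skip => 1
  | .set _ e => e.cost + 1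
  | .put _ i e => i.cost + e.cost + 1
  | .seq p p' => p.bound + p'.bound
  | .branch c p p' => c.cost + 1 + p.bound + p'.bound
  | .loop _ _ => 0

/-- The weakest precondition of a program without loops. -/
def Prog.wp (W : ℕ) : Prog → State → (State → Prop) → Prop
  | .skip, s, Q => Q s
  | .set r e, s, Q => e.eval s ≤ W ∧ Q (s.setReg r (e.eval s))
  | .put k i e, s, Q => i.eval s ≤ W ∧ e.eval s ≤ W ∧ Q (s.setArr k (i.eval s) (e.eval s))
  | .seq p p', s, Q => p.wp W s fun s' => p'.wp W s' Q
  | .branch c p p', s, Q => (c.holds s → p.wp W s Q) ∧ (¬ c.holds s → p'.wp W s Q)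
  | .loop _ _, _, _ => False

/-- The bound adds the costs of both branches, so it depends on the program text only and not on the
state. Loops have precondition `False` and are left to `Runs.loop` or `Iterates`. -/
theorem Prog.wp_sound {W : ℕ} {p : Prog} {s : State} {Q : State → Prop} (h : p.wp W s Q) :
    Runs W p s p.bound Q := by
  induction p generalizing s Q with
  | skip => exact ⟨1, s, .skip s, le_rfl, h⟩
  | set r e => exact ⟨_, _, .set s r e h.1, le_rfl, h.2⟩
  | put k i e => exact ⟨_, _, .put s k i e h.1 h.2.1, le_rfl, h.2.2⟩
  | seq p p' ih ih' => exact .seq ((ih h).imp le_rfl fun s' hs' => ih' hs')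
  | branch c p p' ih ih' => exact .branch (fun hc => ih (h.1 hc)) fun hc => ih' (h.2 hc)
  | loop c p => exact h.elim

theorem Prog.wp_imp {W : ℕ} {p : Prog} {s : State} {Q Q' : State → Prop} (h : p.wp W s Q)
    (hQ : ∀ s', Q s' → Q' s') : p.wp W s Q' := by
  induction p generalizing s Q Q' with
  | skip => exact hQ _ h
  | set r e => exact ⟨h.1, hQ _ h.2⟩
  | put k i e => exact ⟨h.1, h.2.1, hQ _ h.2.2⟩
  | seq p p' ih ih' => exact ih h fun s' hs' => ih' hs' hQ
  | branch c p p' ih ih' => exact ⟨fun hc => ih (h.1 hc) hQ, fun hc => ih' (h.2 hc) hQ⟩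
  | loop c p => exact h.elim

/-! ### Frames: what a program leaves unchanged -/

/-- The program may write the register `r`. -/
def Prog.writesReg : Prog → ℕ → Bool
  | .skip, _ => false
  | .set r' _, r => r == r'
  | .put _ _ _, _ => false
  | .seq p p', r => p.writesReg r || p'.writesReg r
  | .branch _ p p', r => p.writesReg r || p'.writesReg r
  | .loop _ p, r => p.writesReg r

/-- The program may write to the array `k`. -/
def Prog.writesArr : Prog → ℕ → Bool
  | .skip, _ => false
  | .set _ _, _ => false
  | .put k' _ _, k => k == k'
  | .seq p p', k => p.writesArr k || p'.writesArr k
  | .branch _ p p', k => p.writesArr k || p'.writesArr k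
  | .loop _ p, k => p.writesArr k

/-- The registers and arrays that `p` does not write agree in the two states. -/
structure Frame (p : Prog) (s s' : State) : Prop where
  reg : ∀ r, p.writesReg r = false → s'.reg r = s.reg r
  arr : ∀ k, p.writesArr k = false → s'.arr k = s.arr k

theorem Frame.refl (p : Prog) (s : State) : Frame p s s := ⟨fun _ _ => rfl, fun _ _ => rfl⟩

theorem Frame.trans {p : Prog} {s s' s'' : State} (h : Frame p s s') (h' : Frame p s' s'') :
    Frame p s s'' :=
  ⟨fun r hr => (h'.reg r hr).trans (h.reg r hr), fun k hk => (h'.arr k hk).trans (h.arr k hk)⟩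

/-- Purely syntactic preservation. It allows the specification of each phase to mention only the
cells that the phase is about. -/
theorem Exec.frame {W : ℕ} {p : Prog} {s s' : State} {t : ℕ} (h : Exec W p s t s') :
    Frame p s s' := by
  induction h with
  | skip s => exact Frame.refl _ _
  | set s r e h =>
    refine ⟨fun r' hr' => ?_, fun k _ => rfl⟩
    simp only [Prog.writesReg, beq_eq_false_iff_ne] at hr'
    simp [hr']
  | put s k i e hi he =>
    refine ⟨fun r _ => rfl, fun k' hk' => ?_⟩
    simp only [Prog.writesArr, beq_eq_false_iff_ne] at hk'
    simp [hk']
  | seq _ _ ih ih' =>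
    refine ⟨fun r hr => ?_, fun k hk => ?_⟩
    · simp only [Prog.writesReg, Bool.or_eq_false_iff] at hr
      rw [ih'.reg r hr.2, ih.reg r hr.1]
    · simp only [Prog.writesArr, Bool.or_eq_false_iff] at hk
      rw [ih'.arr k hk.2, ih.arr k hk.1]
  | branch_true hc _ ih =>
    refine ⟨fun r hr => ?_, fun k hk => ?_⟩
    · simp only [Prog.writesReg, Bool.or_eq_false_iff] at hr
      exact ih.reg r hr.1
    · simp only [Prog.writesArr, Bool.or_eq_false_iff] at hk
      exact ih.arr k hk.1
  | branch_false hc _ ih =>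
    refine ⟨fun r hr => ?_, fun k hk => ?_⟩
    · simp only [Prog.writesReg, Bool.or_eq_false_iff] at hr
      exact ih.reg r hr.2
    · simp only [Prog.writesArr, Bool.or_eq_false_iff] at hk
      exact ih.arr k hk.2
  | loop_done hc => exact Frame.refl _ _
  | loop_step hc _ _ ih ih' =>
    exact ⟨fun r hr => (ih'.reg r hr).trans (ih.reg r hr),
      fun k hk => (ih'.arr k hk).trans (ih.arr k hk)⟩

theorem Runs.frame {W : ℕ} {p : Prog} {s : State} {T : ℕ} {Q : State → Prop}
    (h : Runs W p s T Q) : Runs W p s T fun s' => Frame p s s' ∧ Q s' := by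
  obtain ⟨t, s', he, ht, hq⟩ := h
  exact ⟨t, s', he, ht, he.frame, hq⟩

/-! ### Loops -/

/-- A loop with an invariant and a strictly decreasing measure, whose body has constant cost. -/
theorem Runs.loop {W : ℕ} {c : Test} {p : Prog} {s₀ : State} (I : State → Prop) (μ : State → ℕ)
    (hI : I s₀)
    (hstep : ∀ s, Frame p s₀ s → I s → c.holds s → p.wp W s fun s' => I s' ∧ μ s' < μ s)
    {N : ℕ} (hN : μ s₀ ≤ N) :
    Runs W (.loop c p) s₀ ((p.bound + c.cost + 1) * (N + 1)) fun s' =>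
      Frame p s₀ s' ∧ I s' ∧ ¬ c.holds s' := by
  have key : ∀ N s, μ s ≤ N → Frame p s₀ s → I s →
      Runs W (.loop c p) s ((p.bound + c.cost + 1) * (N + 1)) fun s' =>
        Frame p s₀ s' ∧ I s' ∧ ¬ c.holds s' := by
    intro N
    induction N with
    | zero =>
      intro s hs hf hi
      by_cases hc : c.holds s
      · obtain ⟨t, s', _, _, _, hlt⟩ := Prog.wp_sound (hstep s hf hi hc)
        omega
      · exact ⟨_, s, .loop_done hc, by omega, hf, hi, hc⟩
    | succ N ih =>
      intro s hs hf hi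
      by_cases hc : c.holds s
      · obtain ⟨t, s', he, ht, hi', hlt⟩ := Prog.wp_sound (hstep s hf hi hc)
        obtain ⟨t', s'', he', ht', hq⟩ := ih s' (by omega) (hf.trans he.frame) hi'
        refine ⟨_, s'', .loop_step hc he he', ?_, hq⟩
        rw [Nat.mul_succ]
        omega
      · refine ⟨_, s, .loop_done hc, ?_, hf, hi, hc⟩
        rw [Nat.mul_succ]
        omega
  exact key N s₀ hN (Frame.refl _ _) hI

/-- Finitely many iterations of a loop that take `t` steps together. -/
inductive Iterates (W : ℕ) (c : Test) (p : Prog) : State → ℕ → State → Prop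
  | refl (s : State) : Iterates W c p s 0 s
  | step {s s' s'' : State} {t t' : ℕ} (hc : c.holds s) (h : Exec W p s t s')
      (h' : Iterates W c p s' t' s'') : Iterates W c p s (c.cost + 1 + t + t') s''

/-- The backtracking search is a single loop, but its analysis is recursive over the search tree.
Traversals of subtrees are blocks of iterations, which this glues together. -/
theorem Iterates.trans {W : ℕ} {c : Test} {p : Prog} {s s' s'' : State} {t t' : ℕ}
    (h : Iterates W c p s t s') (h' : Iterates W c p s' t' s'') :
    Iterates W c p s (t + t') s'' := by
  induction h with
  | refl s => simpa using h'
  | step hc he _ ih =>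
    have := Iterates.step hc he (ih h')
    rwa [← add_assoc] at this

theorem Iterates.exec {W : ℕ} {c : Test} {p : Prog} {s s' : State} {t : ℕ}
    (h : Iterates W c p s t s') (hc : ¬ c.holds s') :
    Exec W (.loop c p) s (t + (c.cost + 1)) s' := by
  induction h with
  | refl s => simpa using Exec.loop_done hc
  | step hc' he _ ih =>
    have := Exec.loop_step hc' he (ih hc)
    rwa [← add_assoc] at this

end LQMatching

namespace LQMatching

/-! ### Instances as arrays -/

/-- An instance in which the preference lists are intervals of two arrays. -/
structure Layout where
  nA : ℕ
  nB : ℕ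
  m : ℕ
  offA : ℕ → ℕ
  tgtA : ℕ → ℕ
  offB : ℕ → ℕ
  tgtB : ℕ → ℕ
  low : ℕ → ℕ
  offA_zero : offA 0 = 0
  offA_last : offA nA = m
  offA_le : ∀ a < nA, offA a ≤ offA (a + 1)
  offB_zero : offB 0 = 0
  offB_last : offB nB = m
  offB_le : ∀ b < nB, offB b ≤ offB (b + 1)
  tgtA_lt : ∀ a < nA, ∀ p, offA a ≤ p → p < offA (a + 1) → tgtA p < nB
  tgtB_lt : ∀ b < nB, ∀ r, offB b ≤ r → r < offB (b + 1) → tgtB r < nA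
  tgtA_inj : ∀ a < nA, ∀ p p', offA a ≤ p → p < offA (a + 1) → offA a ≤ p' → p' < offA (a + 1) →
    tgtA p = tgtA p' → p = p'
  tgtB_inj : ∀ b < nB, ∀ r r', offB b ≤ r → r < offB (b + 1) → offB b ≤ r' → r' < offB (b + 1) →
    tgtB r = tgtB r' → r = r'
  mutualA : ∀ a < nA, ∀ p, offA a ≤ p → p < offA (a + 1) →
    ∃ r, offB (tgtA p) ≤ r ∧ r < offB (tgtA p + 1) ∧ tgtB r = a
  mutualB : ∀ b < nB, ∀ r, offB b ≤ r → r < offB (b + 1) →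
    ∃ p, offA (tgtB r) ≤ p ∧ p < offA (tgtB r + 1) ∧ tgtA p = b

namespace Layout

variable (D : Layout)

theorem offA_mono {i j : ℕ} (h : i ≤ j) (hj : j ≤ D.nA) : D.offA i ≤ D.offA j := by
  induction h with
  | refl => exact le_rfl
  | step h ih => exact (ih (by omega)).trans (D.offA_le _ (by omega))

theorem offB_mono {i j : ℕ} (h : i ≤ j) (hj : j ≤ D.nB) : D.offB i ≤ D.offB j := by
  induction h with
  | refl => exact le_rfl
  | step h ih => exact (ih (by omega)).trans (D.offB_le _ (by omega))

theorem offA_le_m {i : ℕ} (h : i ≤ D.nA) : D.offA i ≤ D.m :=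
  (D.offA_mono h le_rfl).trans D.offA_last.le

theorem offB_le_m {i : ℕ} (h : i ≤ D.nB) : D.offB i ≤ D.m :=
  (D.offB_mono h le_rfl).trans D.offB_last.le

/-- `rk p` is the position of the edge with position `p` in the list of its resource. -/
def IsRank (rk : ℕ → ℕ) : Prop :=
  ∀ a < D.nA, ∀ p, D.offA a ≤ p → p < D.offA (a + 1) →
    D.offB (D.tgtA p) ≤ rk p ∧ rk p < D.offB (D.tgtA p + 1) ∧ D.tgtB (rk p) = a

variable {D}

/-- Mutual acceptability provides an edge from the agent back to `b`. Its rank is a position of the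
same agent in the list of `b`, and an agent occurs there only once. -/
theorem IsRank.surj {rk : ℕ → ℕ} (hr : D.IsRank rk) {b r : ℕ} (hb : b < D.nB)
    (h : D.offB b ≤ r) (h' : r < D.offB (b + 1)) :
    ∃ p, D.offA (D.tgtB r) ≤ p ∧ p < D.offA (D.tgtB r + 1) ∧ D.tgtA p = b ∧ rk p = r := by
  obtain ⟨p, h1, h2, h3⟩ := D.mutualB b hb r h h'
  obtain ⟨h4, h5, h6⟩ := hr _ (D.tgtB_lt b hb r h h') p h1 h2
  rw [h3] at h4 h5
  exact ⟨p, h1, h2, h3, D.tgtB_inj b hb _ _ h4 h5 h h' h6⟩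

variable (D)

/-! ### Matchings as positions

A matching is described by the positions `ν a` of the partners of the agents `a` in the array `tgtA`;
`ν a` is the end of the list of `a` if `a` is unmatched. -/

/-- The agent `a` is matched to the resource `b`. -/
def Mat (ν : ℕ → ℕ) (a b : ℕ) : Prop := a < D.nA ∧ ν a < D.offA (a + 1) ∧ D.tgtA (ν a) = b

/-- The number of matched agents. -/
def count (ν : ℕ → ℕ) : ℕ := ((Finset.range D.nA).filter fun a => ν a < D.offA (a + 1)).card

/-- Feasible matchings which are envy-free (for `e = 1`) or relaxed stable (for `e ≠ 1`). -/
structure Adm (rk : ℕ → ℕ) (e : ℕ) (ν : ℕ → ℕ) : Prop where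
  ge : ∀ a < D.nA, D.offA a ≤ ν a
  le : ∀ a < D.nA, ν a ≤ D.offA (a + 1)
  inj : ∀ a a' b, D.Mat ν a b → D.Mat ν a' b → a = a'
  feas : ∀ b < D.nB, 0 < D.low b → ∃ a, D.Mat ν a b
  envyFree : e = 1 → ∀ a < D.nA, ∀ p, D.offA a ≤ p → p < ν a → ∀ a', D.Mat ν a' (D.tgtA p) →
    rk (ν a') ≤ rk p
  stable : e ≠ 1 → ∀ a < D.nA, ∀ p, D.offA a ≤ p → p < ν a →
    (∀ a', D.Mat ν a' (D.tgtA p) → rk p < rk (ν a')) →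
    ν a < D.offA (a + 1) ∧ 0 < D.low (D.tgtA (ν a))

/-- A complete assignment of agents to the LQ resources: `b` is assigned the agent at position `σ b`,
and `used a` is `0` or the successor of the resource to which `a` is assigned. -/
structure Assigned (σ used : ℕ → ℕ) : Prop where
  lq : ∀ b < D.nB, 0 < D.low b →
    D.offB b ≤ σ b ∧ σ b < D.offB (b + 1) ∧ used (D.tgtB (σ b)) = b + 1
  used : ∀ a < D.nA, used a ≠ 0 → ∃ b < D.nB, used a = b + 1 ∧ 0 < D.low b ∧ D.tgtB (σ b) = a

/-- The admissible matchings that extend a given assignment. -/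
structure Ext (rk : ℕ → ℕ) (e : ℕ) (σ ν : ℕ → ℕ) : Prop extends D.Adm rk e ν where
  agree : ∀ a b, D.Mat ν a b → 0 < D.low b → rk (ν a) = σ b

variable {D}
variable {rk : ℕ → ℕ} {e : ℕ} {σ used ν : ℕ → ℕ}

theorem Mat.lt_nB (h : ∀ a < D.nA, D.offA a ≤ ν a) {a b : ℕ} (hm : D.Mat ν a b) : b < D.nB := by
  obtain ⟨h1, h2, rfl⟩ := hm
  exact D.tgtA_lt a h1 _ (h a h1) h2

theorem IsRank.mat (hr : D.IsRank rk) (h : ∀ a < D.nA, D.offA a ≤ ν a) {a b : ℕ}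
    (hm : D.Mat ν a b) : D.offB b ≤ rk (ν a) ∧ rk (ν a) < D.offB (b + 1) ∧ D.tgtB (rk (ν a)) = a := by
  obtain ⟨h1, h2, rfl⟩ := hm
  exact hr a h1 _ (h a h1) h2

/-- The agent assigned to an LQ resource is its partner. -/
theorem Ext.mat_of_used (hr : D.IsRank rk) (hσ : D.Assigned σ used) (h : D.Ext rk e σ ν) {a b : ℕ}
    (ha : a < D.nA) (hu : used a = b + 1) : D.Mat ν a b ∧ 0 < D.low b := by
  obtain ⟨b', hb', h1, h2, h3⟩ := hσ.used a ha (by omega)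
  obtain rfl : b' = b := by omega
  obtain ⟨a', ha'⟩ := h.feas b' hb' h2
  have h4 := h.agree a' b' ha' h2
  have h5 := (hr.mat h.ge ha').2.2
  rw [h4, h3] at h5
  exact ⟨h5 ▸ ha', h2⟩

/-- The rank of the edge is the assigned position `σ b`, and that position determines the agent. -/
theorem Ext.used_of_mat (hr : D.IsRank rk) (hσ : D.Assigned σ used) (h : D.Ext rk e σ ν) {a b : ℕ}
    (hm : D.Mat ν a b) (hb : 0 < D.low b) : used a = b + 1 := by
  have h1 := h.agree a b hm hb
  have h2 := (hr.mat h.ge hm).2.2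
  rw [h1] at h2
  rw [← h2]
  exact (hσ.lq b (hm.lt_nB h.ge) hb).2.2

/-- If `a` prefers the resource at position `p` to its partner and is not excused, then this resource
does not prefer `a` to its partner. -/
theorem Ext.rank_le (hr : D.IsRank rk) (hσ : D.Assigned σ used) (h : D.Ext rk e σ ν) {a a' p : ℕ}
    (ha : a < D.nA) (hp : D.offA a ≤ p) (hp' : p < ν a) (hu : used a = 0 ∨ e = 1)
    (hm : D.Mat ν a' (D.tgtA p)) : rk (ν a') ≤ rk p := by
  by_cases he : e = 1
  · exact h.envyFree he a ha p hp hp' a' hm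
  · by_contra hlt
    obtain ⟨h1, h2⟩ := h.stable he a ha p hp hp' fun a'' hm'' => by
      rw [h.inj _ _ _ hm'' hm]; omega
    have := h.used_of_mat hr hσ ⟨ha, h1, rfl⟩ h2
    omega

/-! ### Deferred acceptance -/

variable (D)

/-- The invariant of deferred acceptance.  The agents propose along their lists, `nxt a` being the
position of the current proposal of `a`; the resource `b` rejects the agents with positions from
`cut b` on; `held b` tells whether the non-LQ resource `b` has a tentative partner, at position `cut b`;
`fail = 1` if the assignment of the LQ resources has no admissible extension. -/
structure DAInv (rk : ℕ → ℕ) (e : ℕ) (σ used : ℕ → ℕ) (settled : ℕ → Prop) (nxt cut held : ℕ → ℕ)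
    (fail : ℕ) : Prop where
  ge : ∀ a < D.nA, D.offA a ≤ nxt a
  le : ∀ a < D.nA, nxt a ≤ D.offA (a + 1)
  cut_lq : ∀ b < D.nB, 0 < D.low b → cut b = σ b
  assigned : ∀ a < D.nA, used a ≠ 0 →
    (∃ p, nxt a ≤ p ∧ p < D.offA (a + 1) ∧ D.tgtA p + 1 = used a) ∧
    (settled a → D.tgtA (nxt a) + 1 = used a)
  partner : ∀ a < D.nA, settled a → used a = 0 → nxt a < D.offA (a + 1) →
    D.low (D.tgtA (nxt a)) = 0 ∧ held (D.tgtA (nxt a)) ≠ 0 ∧ cut (D.tgtA (nxt a)) = rk (nxt a)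
  holder : ∀ b < D.nB, held b ≠ 0 → D.low b = 0 ∧
    ∃ a, D.Mat nxt a b ∧ settled a ∧ used a = 0 ∧ rk (nxt a) = cut b
  vacant : ∀ b < D.nB, D.low b = 0 → held b = 0 → cut b = D.offB (b + 1) ∨
    (e = 1 ∧ ∃ a < D.nA, used a ≠ 0 ∧ ∃ p, D.offA a ≤ p ∧ p ≤ nxt a ∧ p < D.offA (a + 1) ∧
      D.tgtA p = b ∧ b + 1 ≠ used a ∧ rk p = cut b)
  rejected : fail = 0 → ∀ a < D.nA, used a = 0 ∨ e = 1 → ∀ p, D.offA a ≤ p → p < nxt a →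
    cut (D.tgtA p) ≤ rk p
  bound : ∀ ν, D.Ext rk e σ ν → fail = 0 ∧ ∀ a < D.nA, nxt a ≤ ν a

variable {D}
variable {settled : ℕ → Prop} {nxt cut held : ℕ → ℕ} {fail : ℕ}

/-- Nobody is settled and nothing is held, so the clauses about partners are vacuous. The lower
bound holds because all agents stand at the start of their lists. -/
theorem DAInv.init (hr : D.IsRank rk) (hσ : D.Assigned σ used)
    (hn : ∀ a < D.nA, nxt a = D.offA a)
    (hc : ∀ b < D.nB, 0 < D.low b → cut b = σ b)
    (hc' : ∀ b < D.nB, D.low b = 0 → cut b = D.offB (b + 1))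
    (hh : ∀ b < D.nB, held b = 0) :
    D.DAInv rk e σ used (fun _ => False) nxt cut held 0 where
  ge a ha := (hn a ha).ge
  le a ha := (hn a ha).trans_le (D.offA_le a ha)
  cut_lq := hc
  assigned a ha hu := by
    obtain ⟨b, hb, h1, h2, rfl⟩ := hσ.used a ha hu
    obtain ⟨h3, h4, _⟩ := hσ.lq b hb h2
    obtain ⟨p, h5, h6, h7, _⟩ := hr.surj hb h3 h4
    exact ⟨⟨p, (hn _ ha).trans_le h5, h6, by omega⟩, False.elim⟩
  partner a ha h := h.elim
  holder b hb h := absurd (hh b hb) h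
  vacant b hb h _ := .inl (hc' b hb h)
  rejected _ a ha _ p hp hp' := by rw [hn a ha] at hp'; omega
  bound ν hν := ⟨rfl, fun a ha => (hn a ha).trans_le (hν.ge a ha)⟩

/-- Advancing an agent that is not settled. -/
theorem DAInv.advance (h : D.DAInv rk e σ used settled nxt cut held fail) {a fail' : ℕ}
    (ha : a < D.nA) (hs : ¬ settled a) (hlt : nxt a < D.offA (a + 1))
    (hu : used a ≠ 0 → D.tgtA (nxt a) + 1 ≠ used a)
    (hrej : fail' = 0 → fail = 0 ∧ (used a = 0 ∨ e = 1 → cut (D.tgtA (nxt a)) ≤ rk (nxt a)))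
    (hb : ∀ ν, D.Ext rk e σ ν → fail' = 0 ∧ ν a ≠ nxt a) :
    D.DAInv rk e σ used settled (Function.update nxt a (nxt a + 1)) cut held fail' := by
  have hne : ∀ x, x ≠ a → Function.update nxt a (nxt a + 1) x = nxt x := fun x hx => by simp [hx]
  have hself : Function.update nxt a (nxt a + 1) a = nxt a + 1 := by simp
  have hmono : ∀ x, nxt x ≤ Function.update nxt a (nxt a + 1) x := fun x => by
    by_cases hx : x = a
    · subst hx; omega
    · rw [hne x hx]
  refine ⟨fun x hx => (h.ge x hx).trans (hmono x), fun x hx => ?_, h.cut_lq, fun x hx hux => ?_,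
    fun x hx hsx hux hlx => ?_, fun b hb' hh => ?_, fun b hb' hl hh => ?_,
    fun hf x hx hux p hp hp' => ?_, fun ν hν => ⟨(hb ν hν).1, fun x hx => ?_⟩⟩
  · by_cases hxa : x = a
    · subst hxa; omega
    · rw [hne x hxa]; exact h.le x hx
  · by_cases hxa : x = a
    · subst hxa
      obtain ⟨⟨p, h1, h2, h3⟩, _⟩ := h.assigned x hx hux
      refine ⟨⟨p, ?_, h2, h3⟩, fun hs' => absurd hs' hs⟩
      rw [hself]
      -- The assigned resource itself is never passed, so it still lies ahead.
      have : nxt x ≠ p := fun hp => hu hux (hp ▸ h3)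
      omega
    · rw [hne x hxa]; exact h.assigned x hx hux
  · have hxa : x ≠ a := fun hxa => hs (hxa ▸ hsx)
    rw [hne x hxa] at hlx ⊢
    exact h.partner x hx hsx hux hlx
  · obtain ⟨h1, x, ⟨h2, h3, h4⟩, h5, h6, h7⟩ := h.holder b hb' hh
    have hxa : x ≠ a := fun hxa => hs (hxa ▸ h5)
    refine ⟨h1, x, ⟨h2, ?_, ?_⟩, h5, h6, ?_⟩ <;> rw [hne x hxa] <;> assumption
  · rcases h.vacant b hb' hl hh with h1 | ⟨h1, x, hx, h2, p, h3, h4, h5⟩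
    · exact .inl h1
    · exact .inr ⟨h1, x, hx, h2, p, h3, h4.trans (hmono x), h5⟩
  · obtain ⟨hf', hrej'⟩ := hrej hf
    by_cases hxa : x = a
    · subst hxa
      rw [hself] at hp'
      by_cases hpn : p = nxt x
      · subst hpn; exact hrej' hux
      · exact h.rejected hf' x hx hux p hp (by omega)
    · rw [hne x hxa] at hp'
      exact h.rejected hf' x hx hux p hp hp'
  · have h1 := (h.bound ν hν).2 x hx
    by_cases hxa : x = a
    · subst hxa
      have := (hb ν hν).2
      omega
    · rwa [hne x hxa]

/-- In an extension the pairs with LQ resources are exactly the assigned ones. Hence an assigned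
agent has no other partner, and a free agent has no LQ partner. -/
theorem Ext.ne_position (hr : D.IsRank rk) (hσ : D.Assigned σ used) {a : ℕ}
    (hu : used a ≠ 0 → D.tgtA (nxt a) + 1 ≠ used a) (ha : a < D.nA) (hlt : nxt a < D.offA (a + 1))
    (hν : D.Ext rk e σ ν) (hlow : used a ≠ 0 ∨ 0 < D.low (D.tgtA (nxt a))) : ν a ≠ nxt a := by
  intro heq
  have hm : D.Mat ν a (D.tgtA (nxt a)) := ⟨ha, heq ▸ hlt, by rw [heq]⟩
  by_cases h0 : used a = 0
  · have := hν.used_of_mat hr hσ hm (hlow.resolve_left (by omega))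
    omega
  · obtain ⟨b, _, h1, h2, _⟩ := hσ.used a ha h0
    have h3 := (hν.mat_of_used hr hσ ha h1).1
    exact hu h0 (by rw [h1, ← heq]; exact congrArg (· + 1) h3.2.2)

/-- An assigned agent passes a resource that is not going to prefer it. -/
theorem DAInv.walk_pass (hr : D.IsRank rk) (hσ : D.Assigned σ used)
    (h : D.DAInv rk e σ used settled nxt cut held fail) {a : ℕ} (ha : a < D.nA)
    (hs : ¬ settled a) (hu : used a ≠ 0) (hne : D.tgtA (nxt a) + 1 ≠ used a)
    (hcut : e = 1 → cut (D.tgtA (nxt a)) ≤ rk (nxt a)) :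
    D.DAInv rk e σ used settled (Function.update nxt a (nxt a + 1)) cut held fail := by
  obtain ⟨⟨p, h1, h2, h3⟩, _⟩ := h.assigned a ha hu
  have hlt : nxt a < D.offA (a + 1) := h1.trans_lt h2
  exact h.advance ha hs hlt (fun _ => hne) (fun hf => ⟨hf, fun h' => hcut (h'.resolve_left hu)⟩)
    fun ν hν => ⟨(h.bound ν hν).1, Ext.ne_position hr hσ (fun _ => hne) ha hlt hν (.inl hu)⟩

/-- An agent that is preferred by an LQ resource to the agent assigned to it. -/
theorem DAInv.refute (hr : D.IsRank rk) (hσ : D.Assigned σ used)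
    (h : D.DAInv rk e σ used settled nxt cut held fail) {a : ℕ} (ha : a < D.nA)
    (hs : ¬ settled a) (hlt : nxt a < D.offA (a + 1))
    (hu : used a ≠ 0 → D.tgtA (nxt a) + 1 ≠ used a) (hue : used a = 0 ∨ e = 1)
    (hl : 0 < D.low (D.tgtA (nxt a))) (hcut : rk (nxt a) < cut (D.tgtA (nxt a))) :
    D.DAInv rk e σ used settled (Function.update nxt a (nxt a + 1)) cut held 1 := by
  -- With the failure flag set, the clause on rejections is void, and the lower bound has to hold
  -- for no extension at all: it remains to refute each `ν`.
  refine h.advance ha hs hlt hu (by omega) fun ν hν => absurd hν fun hν => ?_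
  have h1 := (h.bound ν hν).2 a ha
  have h2 := Ext.ne_position hr hσ hu ha hlt hν (.inr hl)
  have hb := D.tgtA_lt a ha _ (h.ge a ha) hlt
  obtain ⟨a', hm⟩ := hν.feas _ hb hl
  have h3 := hν.rank_le hr hσ ha (h.ge a ha) (by omega) hue hm
  rw [hν.agree a' _ hm hl, ← h.cut_lq _ hb hl] at h3
  omega

/-- An assigned agent closes the lower part of the list of a resource. -/
theorem DAInv.close (h : D.DAInv rk e σ used settled nxt cut held fail) {a : ℕ} (ha : a < D.nA)
    (hu : used a ≠ 0) (hlt : nxt a < D.offA (a + 1)) (hne : D.tgtA (nxt a) + 1 ≠ used a) (he : e = 1)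
    (hl : D.low (D.tgtA (nxt a)) = 0) (hh : held (D.tgtA (nxt a)) = 0)
    (hcut : rk (nxt a) < cut (D.tgtA (nxt a))) :
    D.DAInv rk e σ used settled nxt (Function.update cut (D.tgtA (nxt a)) (rk (nxt a))) held fail := by
  set β := D.tgtA (nxt a) with hβ
  have hc : ∀ x, x ≠ β → Function.update cut β (rk (nxt a)) x = cut x := fun x hx => by simp [hx]
  have hcβ : Function.update cut β (rk (nxt a)) β = rk (nxt a) := by simp
  have hmono : ∀ x, Function.update cut β (rk (nxt a)) x ≤ cut x := fun x => by
    by_cases hx : x = β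
    · subst hx; omega
    · rw [hc x hx]
  refine ⟨h.ge, h.le, fun b hb hlb => ?_, h.assigned, fun x hx hsx hux hlx => ?_,
    fun b hb' hhb => ?_, fun b hb' hlb hhb => ?_, fun hf x hx hux p hp hp' => ?_, h.bound⟩
  · rw [hc b (by rintro rfl; omega)]; exact h.cut_lq b hb hlb
  · obtain ⟨h4, h5, h6⟩ := h.partner x hx hsx hux hlx
    exact ⟨h4, h5, by rw [hc _ fun hb => h5 (by rw [hb]; exact hh)]; exact h6⟩
  · obtain ⟨h1, x, h2, h3, h4, h5⟩ := h.holder b hb' hhb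
    exact ⟨h1, x, h2, h3, h4, by rw [hc b fun hb => hhb (by rw [hb]; exact hh)]; exact h5⟩
  · by_cases hbβ : b = β
    · subst hbβ
      -- The walker `a` itself witnesses the reason for the new cut.
      exact .inr ⟨he, a, ha, hu, nxt a, h.ge a ha, le_rfl, hlt, rfl, hne, hcβ.symm⟩
    · rw [hc b hbβ]; exact h.vacant b hb' hlb hhb
  · exact (hmono _).trans (h.rejected hf x hx hux p hp hp')

/-- A free agent is rejected. -/
theorem DAInv.reject (hr : D.IsRank rk) (hσ : D.Assigned σ used)
    (h : D.DAInv rk e σ used settled nxt cut held fail) {a : ℕ} (ha : a < D.nA)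
    (hs : ¬ settled a) (hu : used a = 0) (hlt : nxt a < D.offA (a + 1))
    (hcut : cut (D.tgtA (nxt a)) ≤ rk (nxt a)) :
    D.DAInv rk e σ used settled (Function.update nxt a (nxt a + 1)) cut held fail := by
  refine h.advance ha hs hlt (fun h0 => absurd hu h0) (fun hf => ⟨hf, fun _ => hcut⟩) fun ν hν =>
    ⟨(h.bound ν hν).1, fun heq => ?_⟩
  have hm : D.Mat ν a (D.tgtA (nxt a)) := ⟨ha, heq ▸ hlt, by rw [heq]⟩
  have hb := hm.lt_nB hν.ge
  have hl : D.low (D.tgtA (nxt a)) = 0 := by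
    by_contra h0
    have := hν.used_of_mat hr hσ hm (by omega)
    omega
  obtain ⟨hk1, hk2, hk3⟩ := hr a ha _ (h.ge a ha) hlt
  -- A cut above the end of the list comes from an agent `a'` ranked exactly there: an assigned
  -- agent that passed the resource, or its tentative partner. In both cases `a'` is strictly worse
  -- off than this resource in every extension. If `ν` gave the resource to `a`, the objection of
  -- `a'` would force the two ranks to coincide, hence `a' = a`, which is impossible.
  by_cases hh : held (D.tgtA (nxt a)) = 0
  · rcases h.vacant _ hb hl hh with h1 | ⟨he, a', ha', hu', p, h1, h2, h3, h4, h5, h6⟩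
    · omega
    · have hp : p < ν a' := by
        refine lt_of_le_of_ne (h2.trans ((h.bound ν hν).2 a' ha')) fun hp => ?_
        obtain ⟨b, _, h7, _⟩ := hσ.used a' ha' hu'
        have h8 := (hν.mat_of_used hr hσ ha' h7).1.2.2
        rw [← hp, h4] at h8
        omega
      have h7 := hν.rank_le hr hσ ha' h1 hp (.inr he) (h4.symm ▸ hm)
      rw [heq] at h7
      have h8 : rk p = rk (nxt a) := by omega
      have h9 := (hr a' ha' p h1 h3).2.2
      rw [h8, hk3] at h9
      subst h9
      exact hu' hu
  · obtain ⟨_, a', ⟨ha', h2, h3⟩, h4, h5, h6⟩ := h.holder _ hb hh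
    have hne : a' ≠ a := fun h7 => hs (h7 ▸ h4)
    have hp : nxt a' < ν a' := by
      refine lt_of_le_of_ne ((h.bound ν hν).2 a' ha') fun hp => hne ?_
      exact hν.inj a' a _ ⟨ha', hp ▸ h2, by rw [← hp]; exact h3⟩ hm
    have h7 := hν.rank_le hr hσ ha' (h.ge a' ha') hp (.inl h5) (h3.symm ▸ hm)
    rw [heq] at h7
    have h8 : rk (nxt a') = rk (nxt a) := by omega
    have h9 := (hr a' ha' _ (h.ge a' ha') h2).2.2
    rw [h8, hk3] at h9
    exact hne h9.symm

/-- A free agent is accepted, and the former tentative partner becomes unsettled. -/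
theorem DAInv.accept (hr : D.IsRank rk)
    (h : D.DAInv rk e σ used settled nxt cut held fail) {a : ℕ} (ha : a < D.nA)
    (hs : ¬ settled a) (hu : used a = 0) (hlt : nxt a < D.offA (a + 1))
    (hl : D.low (D.tgtA (nxt a)) = 0) (hcut : rk (nxt a) < cut (D.tgtA (nxt a)))
    {settled' : ℕ → Prop}
    (hset : ∀ x, settled' x ↔ x = a ∨ settled x ∧
      ¬ (held (D.tgtA (nxt a)) ≠ 0 ∧ x = D.tgtB (cut (D.tgtA (nxt a))))) :
    D.DAInv rk e σ used settled' nxt (Function.update cut (D.tgtA (nxt a)) (rk (nxt a)))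
      (Function.update held (D.tgtA (nxt a)) 1) fail := by
  set β := D.tgtA (nxt a) with hβ
  have hβlt := D.tgtA_lt a ha _ (h.ge a ha) hlt
  have hc : ∀ x, x ≠ β → Function.update cut β (rk (nxt a)) x = cut x := fun x hx => by simp [hx]
  have hcβ : Function.update cut β (rk (nxt a)) β = rk (nxt a) := by simp
  have hd : ∀ x, x ≠ β → Function.update held β 1 x = held x := fun x hx => by simp [hx]
  have hdβ : Function.update held β 1 β = 1 := by simp
  have hmono : ∀ x, Function.update cut β (rk (nxt a)) x ≤ cut x := fun x => by
    by_cases hx : x = β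
    · subst hx; omega
    · rw [hc x hx]
  -- The cut of a resource with a tentative partner identifies that partner, so the displaced agent
  -- can be read off from the list of the resource.
  have hown : ∀ x < D.nA, nxt x < D.offA (x + 1) → cut (D.tgtA (nxt x)) = rk (nxt x) →
      D.tgtB (cut (D.tgtA (nxt x))) = x := fun x hx hx1 hx2 => by
    rw [hx2]; exact (hr x hx _ (h.ge x hx) hx1).2.2
  refine ⟨h.ge, h.le, fun b hb hlb => ?_, fun x hx hux => ⟨(h.assigned x hx hux).1, fun hsx => ?_⟩,
    fun x hx hsx hux hlx => ?_, fun b hb' hhb => ?_, fun b hb' hlb hhb => ?_,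
    fun hf x hx hux p hp hp' => ?_, h.bound⟩
  · rw [hc b (by rintro rfl; omega)]; exact h.cut_lq b hb hlb
  · rcases (hset x).1 hsx with rfl | ⟨h1, _⟩
    · exact absurd hu hux
    · exact (h.assigned x hx hux).2 h1
  · rcases (hset x).1 hsx with rfl | ⟨h1, h2⟩
    · rw [← hβ, hdβ, hcβ]; exact ⟨hl, one_ne_zero, rfl⟩
    · obtain ⟨h4, h5, h6⟩ := h.partner x hx h1 hux hlx
      -- Only the displaced agent could have been waiting at `β`.
      have hne : D.tgtA (nxt x) ≠ β := fun heq => h2 ⟨heq ▸ h5, by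
        rw [← heq]; exact (hown x hx hlx h6).symm⟩
      rw [hd _ hne, hc _ hne]
      exact ⟨h4, h5, h6⟩
  · by_cases hbβ : b = β
    · subst hbβ
      exact ⟨hl, a, ⟨ha, hlt, rfl⟩, (hset a).2 (.inl rfl), hu, hcβ.symm⟩
    · rw [hd b hbβ] at hhb
      obtain ⟨h1, x, h2, h3, h4, h5⟩ := h.holder b hb' hhb
      refine ⟨h1, x, h2, (hset x).2 (.inr ⟨h3, fun ⟨h6, h7⟩ => hbβ ?_⟩), h4, by rw [hc b hbβ]; exact h5⟩
      obtain ⟨_, y, ⟨hy1, hy2, hy3⟩, _, _, hy4⟩ := h.holder β hβlt h6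
      have h8 := hown y hy1 hy2 (by rw [hy3]; exact hy4.symm)
      rw [hy3, ← h7] at h8
      subst h8
      rw [← hy3]
      exact h2.2.2.symm
  · have hbβ : b ≠ β := fun hb => by rw [hb, hdβ] at hhb; omega
    rw [hd b hbβ] at hhb
    rw [hc b hbβ]
    exact h.vacant b hb' hlb hhb
  · exact (hmono _).trans (h.rejected hf x hx hux p hp hp')

/-- An agent that has reached its assigned resource, or the end of its list, is settled. -/
theorem DAInv.settle (h : D.DAInv rk e σ used settled nxt cut held fail) {a : ℕ}
    (h1 : used a ≠ 0 → D.tgtA (nxt a) + 1 = used a) (h2 : used a = 0 → nxt a = D.offA (a + 1))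
    {settled' : ℕ → Prop} (hset : ∀ x, settled' x ↔ x = a ∨ settled x) :
    D.DAInv rk e σ used settled' nxt cut held fail := by
  refine ⟨h.ge, h.le, h.cut_lq, fun x hx hux => ⟨(h.assigned x hx hux).1, fun hsx => ?_⟩,
    fun x hx hsx hux hlx => ?_, fun b hb' hhb => ?_, h.vacant, h.rejected, h.bound⟩
  · rcases (hset x).1 hsx with rfl | h3
    · exact h1 hux
    · exact (h.assigned x hx hux).2 h3
  · rcases (hset x).1 hsx with rfl | h3
    · have := h2 hux
      omega
    · exact h.partner x hx h3 hux hlx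
  · obtain ⟨h3, x, h4, h5, h6⟩ := h.holder b hb' hhb
    exact ⟨h3, x, h4, (hset x).2 (.inr h5), h6⟩

theorem DAInv.congr_settled (h : D.DAInv rk e σ used settled nxt cut held fail)
    {settled' : ℕ → Prop} (hset : ∀ x, settled' x ↔ settled x) :
    D.DAInv rk e σ used settled' nxt cut held fail := by
  rwa [show settled' = settled from funext fun x => propext (hset x)]

/-- When all agents are settled and there was no failure, the result extends the assignment. -/
theorem DAInv.ext (hr : D.IsRank rk) (hσ : D.Assigned σ used)
    (h : D.DAInv rk e σ used settled nxt cut held 0) (hall : ∀ a < D.nA, settled a) :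
    D.Ext rk e σ nxt := by
  have hlq : ∀ a b, a < D.nA → used a = b + 1 → D.Mat nxt a b ∧ 0 < D.low b ∧ rk (nxt a) = cut b := by
    intro a b ha hu
    obtain ⟨b', hb', h1, h2, h3⟩ := hσ.used a ha (by omega)
    obtain rfl : b' = b := by omega
    obtain ⟨⟨p, h4, h5, h6⟩, h7⟩ := h.assigned a ha (by omega)
    have hlt : nxt a < D.offA (a + 1) := by omega
    have h8 : D.tgtA (nxt a) = b' := by have := h7 (hall a ha); omega
    refine ⟨⟨ha, hlt, h8⟩, h2, ?_⟩
    rw [h.cut_lq b' hb' h2]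
    obtain ⟨h9, h10, h11⟩ := hr a ha _ (h.ge a ha) hlt
    obtain ⟨h12, h13, _⟩ := hσ.lq b' hb' h2
    rw [h8] at h9 h10
    exact D.tgtB_inj b' hb' _ _ h9 h10 h12 h13 (h11.trans h3.symm)
  -- Every partner sits exactly at the cut of its resource. A position in the list of a resource
  -- determines the agent, so injectivity follows.
  have hcut : ∀ a b, D.Mat nxt a b → rk (nxt a) = cut b := by
    rintro a b ⟨ha, hlt, rfl⟩
    by_cases hu : used a = 0
    · exact (h.partner a ha (hall a ha) hu hlt).2.2.symm
    · obtain ⟨b, _, hb, _⟩ := hσ.used a ha hu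
      obtain ⟨h1, _, h2⟩ := hlq a b ha hb
      rw [h1.2.2]; exact h2
  have hinj : ∀ a a' b, D.Mat nxt a b → D.Mat nxt a' b → a = a' := fun a a' b hm hm' => by
    rw [← (hr.mat h.ge hm).2.2, ← (hr.mat h.ge hm').2.2, hcut a b hm, hcut a' b hm']
  refine ⟨⟨h.ge, h.le, hinj, fun b hb hl => ?_, fun he a ha p hp hp' a' hm => ?_,
    fun he a ha p hp hp' hall' => ?_⟩, fun a b hm hl => ?_⟩
  · obtain ⟨h1, h2, h3⟩ := hσ.lq b hb hl
    exact ⟨_, (hlq _ b (D.tgtB_lt b hb _ h1 h2) h3).1⟩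
  · rw [hcut a' _ hm]
    exact h.rejected rfl a ha (.inr he) p hp hp'
  -- A free agent forms no blocking pair: an LQ resource has its assigned partner at the cut, a
  -- holding resource its tentative one, and without envy cuts any other resource has its cut at the
  -- end of its list, beyond every rank. An assigned agent is excused, being matched to an LQ
  -- resource.
  · by_cases hu : used a = 0
    · exfalso
      have hlt : p < D.offA (a + 1) := hp'.trans_le (h.le a ha)
      have h1 := h.rejected rfl a ha (.inl hu) p hp hp'
      have hb := D.tgtA_lt a ha p hp hlt
      obtain ⟨a', hm⟩ : ∃ a', D.Mat nxt a' (D.tgtA p) := by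
        by_cases hl : 0 < D.low (D.tgtA p)
        · obtain ⟨h2, h3, h4⟩ := hσ.lq _ hb hl
          exact ⟨_, (hlq _ _ (D.tgtB_lt _ hb _ h2 h3) h4).1⟩
        · by_cases hh : held (D.tgtA p) = 0
          · rcases h.vacant _ hb (by omega) hh with h2 | h2
            · have := (hr a ha p hp hlt).2.1
              omega
            · exact absurd h2.1 he
          · obtain ⟨_, x, hx, _⟩ := h.holder _ hb hh
            exact ⟨x, hx⟩
      have := hall' a' hm
      rw [hcut a' _ hm] at this
      omega
    · obtain ⟨b, _, hb, _⟩ := hσ.used a ha hu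
      obtain ⟨⟨_, h1, h2⟩, h3, _⟩ := hlq a b ha hb
      exact ⟨h1, by rwa [h2]⟩
  · rw [hcut a b hm, h.cut_lq b (hm.lt_nB h.ge) hl]

/-- Being unmatched means standing at the end of the list, so moving agents up never unmatches them.
This turns the pointwise lower bound of deferred acceptance into maximality of size. -/
theorem count_le_of_le {ν ν' : ℕ → ℕ} (h : ∀ a < D.nA, ν a ≤ ν' a) : D.count ν' ≤ D.count ν := by
  refine Finset.card_le_card fun a ha => ?_
  simp only [Finset.mem_filter, Finset.mem_range] at ha ⊢
  exact ⟨ha.1, (h a ha.1).trans_lt ha.2⟩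

/-! ### The potential of deferred acceptance -/

variable (D)

/-- The number of proposals that are still possible. -/
def slack (nxt : ℕ → ℕ) : ℕ := ∑ a ∈ Finset.range D.nA, (D.offA (a + 1) - nxt a)

variable {D}

theorem slack_update {a : ℕ} (ha : a < D.nA) (h : nxt a < D.offA (a + 1)) :
    D.slack (Function.update nxt a (nxt a + 1)) + 1 = D.slack nxt := by
  have ha' : a ∈ Finset.range D.nA := Finset.mem_range.2 ha
  unfold slack
  rw [← Finset.add_sum_erase _ _ ha', ← Finset.add_sum_erase _ _ ha', Function.update_self,
    Finset.sum_congr rfl fun x hx => by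
      rw [Function.update_of_ne (Finset.ne_of_mem_erase hx)]]
  omega

/-- The lists are consecutive intervals, so the sum of their lengths telescopes. Hence all agents
together make at most `m` moves. -/
theorem slack_le (h : ∀ a < D.nA, D.offA a ≤ nxt a) : D.slack nxt ≤ D.m := by
  have : ∀ n ≤ D.nA, ∑ a ∈ Finset.range n, (D.offA (a + 1) - nxt a) ≤ D.offA n := by
    intro n
    induction n with
    | zero => simp
    | succ n ih =>
      intro hn
      rw [Finset.sum_range_succ]
      have := ih (by omega)
      have := h n (by omega)
      have := D.offA_le n (by omega)
      omega
  exact (this _ le_rfl).trans D.offA_last.le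

end Layout
end LQMatching

namespace LQMatching

/-! ### The arrays of an encoded instance -/

section Offsets

variable {α : Type}

theorem offsets_getD (L : List (List α)) {i : ℕ} (h : i ≤ L.length) :
    (offsets L).getD i 0 = ((L.take i).map List.length).sum := by
  have h' : i < (List.range (L.length + 1)).length := by simp; omega
  rw [offsets, List.getD_eq_getElem _ _ (by simpa using h')]
  simp

theorem offsets_getD_zero (L : List (List α)) : (offsets L).getD 0 0 = 0 := by
  rw [offsets_getD L (Nat.zero_le _)]; simp

theorem offsets_getD_succ (L : List (List α)) {i : ℕ} (h : i < L.length) :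
    (offsets L).getD (i + 1) 0 = (offsets L).getD i 0 + L[i].length := by
  rw [offsets_getD L h, offsets_getD L h.le, List.take_succ_eq_append_getElem h]
  simp only [List.map_append, List.sum_append, List.map_cons, List.map_nil, List.sum_singleton]

theorem offsets_getD_length (L : List (List α)) :
    (offsets L).getD L.length 0 = (L.map List.length).sum := by
  rw [offsets_getD L le_rfl, List.take_length]

/-- The offset is the length of the concatenation of the preceding lists; splitting the
concatenation there leaves the `i`-th list in front. -/
theorem getElem_flatten_offset (L : List (List α)) {i j : ℕ} (h : i < L.length)
    (hj : j < L[i].length) : L.flatten[(offsets L).getD i 0 + j]? = some L[i][j] := by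
  have h1 : L.flatten = (L.take i).flatten ++ (L[i] ++ (L.drop (i + 1)).flatten) := by
    rw [← List.flatten_cons, ← List.drop_eq_getElem_cons h, ← List.flatten_append,
      List.take_append_drop]
  rw [offsets_getD L h.le, ← List.length_flatten, h1, List.getElem?_append_right (by omega),
    Nat.add_sub_cancel_left, List.getElem?_append_left hj, List.getElem?_eq_getElem hj]

end Offsets

namespace Inst

variable (G : Inst)

theorem arr_offset_zero {k : ℕ} (hk : k = 0 ∨ k = 2) : G.encode.arr k 0 = 0 := by
  rcases hk with rfl | rfl <;> exact offsets_getD_zero _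

theorem offA_succ (a : Fin G.nA) :
    G.encode.arr 0 (a + 1) = G.encode.arr 0 a + (G.prefA a).length := by
  have := offsets_getD_succ (List.ofFn G.prefA) (i := a) (by simp)
  rwa [List.getElem_ofFn] at this

theorem offB_succ (b : Fin G.nB) :
    G.encode.arr 2 (b + 1) = G.encode.arr 2 b + (G.prefB b).length := by
  have := offsets_getD_succ (List.ofFn G.prefB) (i := b) (by simp)
  rwa [List.getElem_ofFn] at this

theorem tgtA_eq (a : Fin G.nA) {j : ℕ} (hj : j < (G.prefA a).length) :
    G.encode.arr 1 (G.encode.arr 0 a + j) = (G.prefA a)[j] := by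
  have := getElem_flatten_offset (List.ofFn G.prefA) (i := a) (j := j) (by simp) (by simpa using hj)
  simp only [List.getElem_ofFn, Fin.eta] at this
  show ((List.ofFn G.prefA).flatten.map Fin.val).getD _ 0 = _
  rw [List.getD_eq_getElem?_getD, List.getElem?_map]
  erw [this]
  rfl

theorem tgtB_eq (b : Fin G.nB) {j : ℕ} (hj : j < (G.prefB b).length) :
    G.encode.arr 3 (G.encode.arr 2 b + j) = (G.prefB b)[j] := by
  have := getElem_flatten_offset (List.ofFn G.prefB) (i := b) (j := j) (by simp) (by simpa using hj)
  simp only [List.getElem_ofFn, Fin.eta] at this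
  show ((List.ofFn G.prefB).flatten.map Fin.val).getD _ 0 = _
  rw [List.getD_eq_getElem?_getD, List.getElem?_map]
  erw [this]
  rfl

theorem low_eq (b : Fin G.nB) : G.encode.arr 4 b = G.lower b := by
  show (List.ofFn G.lower).getD _ 0 = _
  rw [List.getD_eq_getElem _ _ (by simp)]
  simp

/-- Edges are counted by agents, using that lists have no repetitions. The count by resources below
needs mutual acceptability in addition; together they give both concatenated arrays the same length.
-/
theorem m_eq_sumA : G.m = ∑ a, (G.prefA a).length := by
  rw [m, edges, Finset.card_filter, Fintype.sum_prod_type]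
  refine Finset.sum_congr rfl fun a _ => ?_
  rw [← List.toFinset_card_of_nodup (G.nodupA a), ← Finset.card_filter]
  congr 1
  ext b
  simp

theorem m_eq_sumB : G.m = ∑ b, (G.prefB b).length := by
  rw [m, edges, Finset.card_filter, Fintype.sum_prod_type_right]
  refine Finset.sum_congr rfl fun b _ => ?_
  rw [← List.toFinset_card_of_nodup (G.nodupB b), ← Finset.card_filter]
  congr 1
  ext a
  simp [G.mutual_acceptable]

theorem offA_last : G.encode.arr 0 G.nA = G.m := by
  have := offsets_getD_length (List.ofFn G.prefA)
  rw [List.length_ofFn, List.map_ofFn, List.sum_ofFn] at this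
  rw [m_eq_sumA]
  exact this

theorem offB_last : G.encode.arr 2 G.nB = G.m := by
  have := offsets_getD_length (List.ofFn G.prefB)
  rw [List.length_ofFn, List.map_ofFn, List.sum_ofFn] at this
  rw [m_eq_sumB]
  exact this

theorem exists_tgtA (a : Fin G.nA) {p : ℕ} (h : G.encode.arr 0 a ≤ p)
    (h' : p < G.encode.arr 0 (a + 1)) :
    ∃ j, ∃ hj : j < (G.prefA a).length, p = G.encode.arr 0 a + j ∧
      G.encode.arr 1 p = (G.prefA a)[j] := by
  obtain ⟨j, rfl⟩ := Nat.exists_eq_add_of_le h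
  rw [offA_succ] at h'
  exact ⟨j, by omega, rfl, G.tgtA_eq a (by omega)⟩

theorem exists_tgtB (b : Fin G.nB) {p : ℕ} (h : G.encode.arr 2 b ≤ p)
    (h' : p < G.encode.arr 2 (b + 1)) :
    ∃ j, ∃ hj : j < (G.prefB b).length, p = G.encode.arr 2 b + j ∧
      G.encode.arr 3 p = (G.prefB b)[j] := by
  obtain ⟨j, rfl⟩ := Nat.exists_eq_add_of_le h
  rw [offB_succ] at h'
  exact ⟨j, by omega, rfl, G.tgtB_eq b (by omega)⟩

/-- The position of a resource in the array of the preference lists of the agents. -/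
theorem exists_posA (a : Fin G.nA) (b : Fin G.nB) (h : b ∈ G.prefA a) :
    G.encode.arr 0 a + (G.prefA a).idxOf b < G.encode.arr 0 (a + 1) ∧
      G.encode.arr 1 (G.encode.arr 0 a + (G.prefA a).idxOf b) = b := by
  have hj := List.idxOf_lt_length_of_mem h
  refine ⟨by rw [offA_succ]; omega, ?_⟩
  rw [tgtA_eq G a hj]
  simp

theorem exists_posB (b : Fin G.nB) (a : Fin G.nA) (h : a ∈ G.prefB b) :
    G.encode.arr 2 b + (G.prefB b).idxOf a < G.encode.arr 2 (b + 1) ∧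
      G.encode.arr 3 (G.encode.arr 2 b + (G.prefB b).idxOf a) = a := by
  have hj := List.idxOf_lt_length_of_mem h
  refine ⟨by rw [offB_succ]; omega, ?_⟩
  rw [tgtB_eq G b hj]
  simp

/-- The arrays of the encoding of an instance. -/
def layout : Layout where
  nA := G.nA
  nB := G.nB
  m := G.m
  offA := G.encode.arr 0
  tgtA := G.encode.arr 1
  offB := G.encode.arr 2
  tgtB := G.encode.arr 3
  low := G.encode.arr 4
  offA_zero := G.arr_offset_zero (.inl rfl)
  offA_last := G.offA_last
  offA_le a ha := by rw [G.offA_succ ⟨a, ha⟩]; exact Nat.le_add_right _ _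
  offB_zero := G.arr_offset_zero (.inr rfl)
  offB_last := G.offB_last
  offB_le b hb := by rw [G.offB_succ ⟨b, hb⟩]; exact Nat.le_add_right _ _
  tgtA_lt a ha p h h' := by
    obtain ⟨j, hj, -, h2⟩ := G.exists_tgtA ⟨a, ha⟩ h h'
    rw [h2]; exact Fin.isLt _
  tgtB_lt b hb p h h' := by
    obtain ⟨j, hj, -, h2⟩ := G.exists_tgtB ⟨b, hb⟩ h h'
    rw [h2]; exact Fin.isLt _
  tgtA_inj a ha p p' h1 h2 h3 h4 h := by
    obtain ⟨j, hj, h5, h6⟩ := G.exists_tgtA ⟨a, ha⟩ h1 h2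
    obtain ⟨j', hj', h7, h8⟩ := G.exists_tgtA ⟨a, ha⟩ h3 h4
    rw [h6, h8, Fin.val_inj] at h
    rw [h5, h7, ((G.nodupA _).getElem_inj_iff).1 h]
  tgtB_inj b hb p p' h1 h2 h3 h4 h := by
    obtain ⟨j, hj, h5, h6⟩ := G.exists_tgtB ⟨b, hb⟩ h1 h2
    obtain ⟨j', hj', h7, h8⟩ := G.exists_tgtB ⟨b, hb⟩ h3 h4
    rw [h6, h8, Fin.val_inj] at h
    rw [h5, h7, ((G.nodupB _).getElem_inj_iff).1 h]
  mutualA a ha p h h' := by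
    obtain ⟨j, hj, -, h2⟩ := G.exists_tgtA ⟨a, ha⟩ h h'
    obtain ⟨h3, h4⟩ := G.exists_posB _ ⟨a, ha⟩ ((G.mutual_acceptable _ _).1 (List.getElem_mem hj))
    rw [h2]
    exact ⟨_, Nat.le_add_right _ _, h3, h4⟩
  mutualB b hb p h h' := by
    obtain ⟨j, hj, -, h2⟩ := G.exists_tgtB ⟨b, hb⟩ h h'
    obtain ⟨h3, h4⟩ := G.exists_posA _ ⟨b, hb⟩ ((G.mutual_acceptable _ _).2 (List.getElem_mem hj))
    rw [h2]
    exact ⟨_, Nat.le_add_right _ _, h3, h4⟩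


/-! ### Translation between matchings and positions -/

variable {G}

theorem layout_pos {a : Fin G.nA} {b : Fin G.nB} {p : ℕ} (h : G.layout.offA a ≤ p)
    (h' : p < G.layout.offA (a + 1)) (hb : G.layout.tgtA p = b) :
    b ∈ G.prefA a ∧ p = G.layout.offA a + (G.prefA a).idxOf b := by
  obtain ⟨j, hj, h1, h2⟩ := G.exists_tgtA a h h'
  have h3 : b = (G.prefA a)[j] := Fin.ext (hb.symm.trans h2)
  refine ⟨h3 ▸ List.getElem_mem hj, ?_⟩
  rw [h3, (G.nodupA a).idxOf_getElem]
  exact h1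

theorem layout_exists_pos {a : Fin G.nA} {b : Fin G.nB} (h : b ∈ G.prefA a) :
    ∃ p, G.layout.offA a ≤ p ∧ p < G.layout.offA (a + 1) ∧ G.layout.tgtA p = b :=
  ⟨_, Nat.le_add_right _ _, G.exists_posA a b h⟩

theorem layout_rank {rk : ℕ → ℕ} (hr : G.layout.IsRank rk) {a : Fin G.nA} {b : Fin G.nB} {p : ℕ}
    (h : G.layout.offA a ≤ p) (h' : p < G.layout.offA (a + 1)) (hb : G.layout.tgtA p = b) :
    a ∈ G.prefB b ∧ rk p = G.layout.offB b + (G.prefB b).idxOf a := by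
  obtain ⟨h1, h2, h3⟩ := hr a a.2 p h h'
  rw [hb] at h1 h2
  obtain ⟨j, hj, h4, h5⟩ := G.exists_tgtB b h1 h2
  have h6 : a = (G.prefB b)[j] := Fin.ext (h3.symm.trans h5)
  refine ⟨h6 ▸ List.getElem_mem hj, ?_⟩
  conv_rhs => rw [h6, (G.nodupB b).idxOf_getElem]
  exact h4

theorem resourcePrefers_iff {rk : ℕ → ℕ} (hr : G.layout.IsRank rk) {a a' : Fin G.nA} {b : Fin G.nB}
    {p p' : ℕ} (h : G.layout.offA a ≤ p) (h' : p < G.layout.offA (a + 1)) (hb : G.layout.tgtA p = b)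
    (h1 : G.layout.offA a' ≤ p') (h1' : p' < G.layout.offA (a' + 1)) (hb' : G.layout.tgtA p' = b) :
    G.ResourcePrefers b a a' ↔ rk p < rk p' := by
  obtain ⟨h2, h3⟩ := layout_rank hr h h' hb
  obtain ⟨h4, h5⟩ := layout_rank hr h1 h1' hb'
  rw [h3, h5, ResourcePrefers]
  simp [h2, h4]

/-- `ν` describes the matching `M`. -/
def Describes (G : Inst) (ν : ℕ → ℕ) (M : Finset (Fin G.nA × Fin G.nB)) : Prop :=
  ∀ a b, (a, b) ∈ M ↔ G.layout.Mat ν a b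

/-- For a matched agent both sides compare positions in its list. An unmatched one wants every
neighbour, and its value `ν a` lies at or beyond the end of the list, so the inequality holds as
well. -/
theorem agentWants_iff {ν : ℕ → ℕ} {M : Finset (Fin G.nA × Fin G.nB)} (hM : G.Describes ν M)
    (hge : ∀ a < G.nA, G.layout.offA a ≤ ν a) {a : Fin G.nA} {b : Fin G.nB} {p : ℕ} (h : G.layout.offA a ≤ p)
    (h' : p < G.layout.offA (a + 1)) (hb : G.layout.tgtA p = b) :
    G.AgentWants M a b ↔ p < ν a := by
  obtain ⟨h1, h2⟩ := layout_pos h h' hb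
  constructor
  · intro hw
    by_cases hlt : ν a < G.layout.offA (a + 1)
    · have hb' := G.layout.tgtA_lt a a.2 _ (hge a a.2) hlt
      obtain ⟨h3, h4⟩ := layout_pos (b := ⟨_, hb'⟩) (hge a a.2) hlt rfl
      have := (hw ⟨_, hb'⟩ ((hM _ _).2 ⟨a.2, hlt, rfl⟩)).2.2
      omega
    · omega
  · intro hp b' hb'
    obtain ⟨_, h3, h4⟩ := (hM _ _).1 hb'
    obtain ⟨h5, h6⟩ := layout_pos (hge a a.2) h3 h4
    exact ⟨h1, h5, by omega⟩

end Inst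

/-- The two problems, `MAXEFM` for `e = 1` and `MAXRSM` for `e ≠ 1`. -/
def problem (e : ℕ) : Problem := fun G M =>
  G.IsMatching M ∧ G.IsFeasible M ∧ (e = 1 → G.IsEnvyFree M) ∧ (e ≠ 1 → G.IsRelaxedStable M)

theorem problem_one : problem 1 = MAXEFM := by
  funext G M
  simp [problem, MAXEFM]

theorem problem_zero : problem 0 = MAXRSM := by
  funext G M
  simp [problem, MAXRSM]

namespace Inst

variable {G : Inst}

/-- The dictionary between the graph-theoretic definitions and positions: an edge is a position `p`,
the wish of its agent is `p < ν a`, and the wish of its resource is a comparison of ranks. -/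
theorem problem_iff_adm {rk : ℕ → ℕ} (hr : G.layout.IsRank rk) {e : ℕ} {ν : ℕ → ℕ}
    {M : Finset (Fin G.nA × Fin G.nB)} (hM : G.Describes ν M)
    (hge : ∀ a < G.nA, G.layout.offA a ≤ ν a) (hle : ∀ a < G.nA, ν a ≤ G.layout.offA (a + 1)) :
    problem e G M ↔ G.layout.Adm rk e ν := by
  have hlow : ∀ b : Fin G.nB, G.layout.low b = G.lower b := G.low_eq
  have hedge : ∀ (a : Fin G.nA) (b : Fin G.nB), (a, b) ∈ G.edges ↔ b ∈ G.prefA a := by simp [edges]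
  have hmat : ∀ {a b}, G.layout.Mat ν a b → ∃ (a' : Fin G.nA) (b' : Fin G.nB), a' = a ∧ b' = b ∧
      (a', b') ∈ M := fun {a b} h => ⟨⟨a, h.1⟩, ⟨b, h.lt_nB hge⟩, rfl, rfl, (hM _ _).2 h⟩
  constructor
  · rintro ⟨⟨h1, h2, h3⟩, h4, h5, h6⟩
    refine ⟨hge, hle, fun a a' b h h' => ?_, fun b hb hl => ?_,
      fun he a ha p hp hp' a' hm => ?_, fun he a ha p hp hp' hall => ?_⟩
    · obtain ⟨x, y, rfl, rfl, hx⟩ := hmat h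
      obtain ⟨x', y', rfl, hy, hx'⟩ := hmat h'
      rw [Fin.val_inj] at hy
      subst hy
      rw [h3 _ _ _ hx hx']
    · obtain ⟨a, ha⟩ := h4 ⟨b, hb⟩ (hl.trans_eq (hlow ⟨b, hb⟩))
      exact ⟨a, (hM _ _).1 ha⟩
    · by_contra hlt
      obtain ⟨x', y, rfl, hy, hx⟩ := hmat hm
      have hpe := hp'.trans_le (hle a ha)
      refine h5 he ⟨a, ha⟩ x' ⟨y, hx, ?_, ?_, ?_⟩
      · rw [hedge]; exact (layout_pos (a := ⟨a, ha⟩) hp hpe hy.symm).1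
      · rwa [agentWants_iff hM hge (a := ⟨a, ha⟩) hp hpe hy.symm]
      · rw [resourcePrefers_iff hr (a := ⟨a, ha⟩) hp hpe hy.symm (hge _ x'.2) hm.2.1
          (hm.2.2.trans hy.symm)]
        omega
    · have hpe := hp'.trans_le (hle a ha)
      have hb := G.layout.tgtA_lt a ha p hp hpe
      have hbl : G.IsBlocking M ⟨a, ha⟩ ⟨_, hb⟩ := ?_
      · obtain ⟨b', h7, h8⟩ := h6 he _ _ hbl
        obtain ⟨_, h9, h10⟩ := (hM _ _).1 h7
        refine ⟨h9, ?_⟩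
        rw [h10, hlow]
        exact h8
      refine ⟨?_, ?_, ?_, ?_⟩
      · rw [hedge]; exact (layout_pos (a := ⟨a, ha⟩) (b := ⟨_, hb⟩) hp hpe rfl).1
      · intro h7
        obtain ⟨_, h9, h10⟩ := (hM _ _).1 h7
        have := G.layout.tgtA_inj a ha _ _ (hge a ha) h9 hp hpe h10
        omega
      · rwa [agentWants_iff hM hge (a := ⟨a, ha⟩) (b := ⟨_, hb⟩) hp hpe rfl]
      · intro a' ha'
        have hm := (hM _ _).1 ha'
        rw [resourcePrefers_iff hr (a := ⟨a, ha⟩) (b := ⟨_, hb⟩) hp hpe rfl (hge _ a'.2) hm.2.1 hm.2.2]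
        exact hall a' hm
  · intro h
    refine ⟨⟨fun ⟨a, b⟩ hab => ?_, fun a b b' hab hab' => ?_, fun a a' b hab hab' => ?_⟩,
      fun b hb => ?_, fun he a a' => ?_, fun he a b hbl => ?_⟩
    · obtain ⟨_, h1, h2⟩ := (hM _ _).1 hab
      rw [hedge]
      exact (layout_pos (hge a a.2) h1 h2).1
    · exact Fin.ext (((hM _ _).1 hab).2.2.symm.trans ((hM _ _).1 hab').2.2)
    · exact Fin.ext (h.inj _ _ _ ((hM _ _).1 hab) ((hM _ _).1 hab'))
    · obtain ⟨a, ha⟩ := h.feas b b.2 (by rw [hlow]; exact hb)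
      exact ⟨⟨a, ha.1⟩, (hM _ _).2 ha⟩
    · rintro ⟨b, h1, h2, h3, h4⟩
      rw [hedge] at h2
      obtain ⟨p, h0, h5, h6⟩ := layout_exists_pos h2
      have h7 := (agentWants_iff hM hge h0 h5 h6).1 h3
      have hm := (hM _ _).1 h1
      rw [resourcePrefers_iff hr h0 h5 h6 (hge _ a'.2) hm.2.1 hm.2.2] at h4
      have := h.envyFree he a a.2 _ h0 h7 a' (by
        rw [h6]; exact hm)
      omega
    · obtain ⟨h1, h2, h3, h4⟩ := hbl
      rw [hedge] at h1
      obtain ⟨p, h0, h5, h6⟩ := layout_exists_pos h1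
      have h7 := (agentWants_iff hM hge h0 h5 h6).1 h3
      obtain ⟨h8, h9⟩ := h.stable he a a.2 _ h0 h7 fun a' hm => by
        rw [h6] at hm
        obtain ⟨x', y, rfl, hy, hx⟩ := hmat hm
        rw [Fin.val_inj] at hy
        subst hy
        exact (resourcePrefers_iff hr h0 h5 h6 (hge _ x'.2) hm.2.1 hm.2.2).1
          (h4 x' hx)
      have hm : G.layout.Mat ν a (G.layout.tgtA (ν a)) := ⟨a.2, h8, rfl⟩
      obtain ⟨x', y, hx', hy, hx⟩ := hmat hm
      rw [Fin.val_inj] at hx'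
      subst hx'
      exact ⟨y, hx, by rw [← hy, hlow] at h9; exact h9⟩

/-- A matched agent is placed at the index of its partner in its list, an unmatched one at the end
of its list. -/
theorem exists_describes_of_isMatching {M : Finset (Fin G.nA × Fin G.nB)} (hM : G.IsMatching M) :
    ∃ ν : ℕ → ℕ, G.Describes ν M ∧ (∀ a < G.nA, G.layout.offA a ≤ ν a) ∧
      ∀ a < G.nA, ν a ≤ G.layout.offA (a + 1) := by
  have key : ∀ a : Fin G.nA, ∃ p, G.layout.offA a ≤ p ∧ p ≤ G.layout.offA (a + 1) ∧
      ∀ b : Fin G.nB, (a, b) ∈ M ↔ p < G.layout.offA (a + 1) ∧ G.layout.tgtA p = b := by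
    intro a
    by_cases h : ∃ b, (a, b) ∈ M
    · obtain ⟨b, hb⟩ := h
      obtain ⟨h1, h2⟩ := G.exists_posA a b (by have := hM.1 hb; simpa [edges] using this)
      refine ⟨_, Nat.le_add_right _ _, h1.le, fun b' => ⟨fun hb' => ⟨h1, ?_⟩, fun ⟨_, h3⟩ => ?_⟩⟩
      · rw [← hM.2.1 a b b' hb hb']; exact h2
      · rwa [← Fin.ext (h2.symm.trans h3)]
    · refine ⟨_, G.layout.offA_le a a.2, le_rfl, fun b => ⟨fun hb => absurd ⟨b, hb⟩ h, fun hb => ?_⟩⟩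
      exact absurd hb.1 (lt_irrefl _)
  choose f hf using key
  refine ⟨fun a => if h : a < G.nA then f ⟨a, h⟩ else 0, fun a b => ?_, fun a ha => ?_, fun a ha => ?_⟩
  · have h1 : G.layout.nA = G.nA := rfl
    rw [(hf a).2.2 b, Layout.Mat]
    simp [h1]
  · simpa [ha] using (hf ⟨a, ha⟩).1
  · simpa [ha] using (hf ⟨a, ha⟩).2.1

open Classical in
theorem exists_describes (G : Inst) (ν : ℕ → ℕ) :
    ∃ M : Finset (Fin G.nA × Fin G.nB), G.Describes ν M :=
  ⟨Finset.univ.filter fun x => G.layout.Mat ν x.1 x.2, fun a b => by simp⟩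

/-- Projection to the agents is injective on a matching. -/
theorem Describes.card_eq {ν : ℕ → ℕ} {M : Finset (Fin G.nA × Fin G.nB)} (hM : G.Describes ν M)
    (hge : ∀ a < G.nA, G.layout.offA a ≤ ν a) : M.card = G.layout.count ν := by
  refine Finset.card_bij (fun x _ => x.1.val) (fun ⟨a, b⟩ hx => ?_) (fun ⟨a, b⟩ hx ⟨a', b'⟩ hx' h => ?_)
    fun a ha => ?_
  · obtain ⟨h1, h2, _⟩ := (hM _ _).1 hx
    simpa using ⟨h1, h2⟩
  · have h1 := (hM _ _).1 hx
    have h2 := (hM _ _).1 hx'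
    obtain rfl : a = a' := Fin.ext h
    rw [show b = b' from Fin.ext (h1.2.2.symm.trans h2.2.2)]
  · simp only [Finset.mem_filter, Finset.mem_range] at ha
    have h1 : G.layout.Mat ν a (G.layout.tgtA (ν a)) := ⟨ha.1, ha.2, rfl⟩
    exact ⟨(⟨a, ha.1⟩, ⟨_, h1.lt_nB hge⟩), (hM _ _).2 h1, rfl⟩

/-- A correct answer in terms of positions. -/
theorem isAnswer_of_adm {rk : ℕ → ℕ} (hr : G.layout.IsRank rk) {e : ℕ} {s : State}
    (h : (s.reg 2 = 1 ∧ ∃ ν, G.layout.Adm rk e ν ∧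
        (∀ ν', G.layout.Adm rk e ν' → G.layout.count ν' ≤ G.layout.count ν) ∧
        ∀ a < G.nA, s.arr 5 a =
          if ν a < G.layout.offA (a + 1) then G.layout.tgtA (ν a) + 1 else 0) ∨
      (s.reg 2 = 0 ∧ ∀ ν, ¬ G.layout.Adm rk e ν)) : IsAnswer (problem e) G s := by
  rcases h with ⟨h1, ν, h2, h3, h4⟩ | ⟨h1, h2⟩
  · obtain ⟨M, hM⟩ := exists_describes G ν
    refine .inl ⟨h1, M, ⟨(problem_iff_adm hr hM h2.ge h2.le).2 h2, fun N hN => ?_⟩, fun a => ?_⟩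
    · obtain ⟨ν', hν', h5, h6⟩ := exists_describes_of_isMatching hN.1
      rw [hM.card_eq h2.ge, hν'.card_eq h5]
      exact h3 ν' ((problem_iff_adm hr hν' h5 h6).1 hN)
    · rw [h4 a a.2]
      by_cases hlt : ν a < G.layout.offA (a + 1)
      · have h5 : G.layout.Mat ν a (G.layout.tgtA (ν a)) := ⟨a.2, hlt, rfl⟩
        exact .inl ⟨⟨_, h5.lt_nB h2.ge⟩, (hM _ _).2 h5, by simp [hlt]⟩
      · exact .inr ⟨fun b hb => hlt ((hM _ _).1 hb).2.1, by simp [hlt]⟩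
  · refine .inr ⟨h1, fun N hN => ?_⟩
    obtain ⟨ν', hν', h5, h6⟩ := exists_describes_of_isMatching hN.1
    exact h2 ν' ((problem_iff_adm hr hν' h5 h6).1 hN)

end Inst
end LQMatching

namespace LQMatching

/-! ### Computing the ranks -/

namespace Layout

variable {D : Layout}

theorem exists_owner {r : ℕ} (hr : r < D.m) : ∃ b < D.nB, D.offB b ≤ r ∧ r < D.offB (b + 1) := by
  have : ∀ n ≤ D.nB, r < D.offB n → ∃ b < n, D.offB b ≤ r ∧ r < D.offB (b + 1) := by
    intro n
    induction n with
    | zero => intro _ h; rw [D.offB_zero] at h; omega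
    | succ n ih =>
      intro hn h
      by_cases h' : r < D.offB n
      · obtain ⟨b, hb, h''⟩ := ih (by omega) h'
        exact ⟨b, by omega, h''⟩
      · exact ⟨n, by omega, by omega, h⟩
  exact this _ le_rfl (by rwa [D.offB_last])

variable (D)

/-- The number of occurrences of `a` among the first `p` cells of `tgtB`. -/
def occ (p a : ℕ) : ℕ := ((Finset.range p).filter fun r => D.tgtB r = a).card

variable {D}

theorem occ_succ (p a : ℕ) : D.occ (p + 1) a = D.occ p a + if D.tgtB p = a then 1 else 0 := by
  unfold occ
  rw [Finset.range_add_one, Finset.filter_insert]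
  split_ifs with h
  · rw [Finset.card_insert_of_notMem (by simp)]
  · rfl

/-- The bucket of an agent does not overflow its interval: an occurrence of `a` in the list of `b`
corresponds to an edge of `a` with target `b`, and different occurrences lie in the lists of
different resources. -/
theorem occ_le {p a : ℕ} (hp : p ≤ D.m) (ha : a < D.nA) : D.offA a + D.occ p a ≤ D.offA (a + 1) := by
  have h1 : D.occ p a ≤ (Finset.Ico (D.offA a) (D.offA (a + 1))).card := by
    have key : ∀ r ∈ (Finset.range p).filter fun r => D.tgtB r = a,
        ∃ x ∈ Finset.Ico (D.offA a) (D.offA (a + 1)),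
          D.tgtA x < D.nB ∧ D.offB (D.tgtA x) ≤ r ∧ r < D.offB (D.tgtA x + 1) := by
      intro r hr
      simp only [Finset.mem_filter, Finset.mem_range] at hr
      obtain ⟨b, hb, h1, h2⟩ := D.exists_owner (hr.1.trans_le hp)
      obtain ⟨x, h3, h4, h5⟩ := D.mutualB b hb r h1 h2
      rw [hr.2] at h3 h4
      exact ⟨x, Finset.mem_Ico.2 ⟨h3, h4⟩, by rwa [h5], by rwa [h5], by rwa [h5]⟩
    refine Finset.card_le_card_of_forall_subsingleton
      (fun r x => D.tgtA x < D.nB ∧ D.offB (D.tgtA x) ≤ r ∧ r < D.offB (D.tgtA x + 1)) key ?_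
    rintro x - r ⟨hr, h1, h2, h3⟩ r' ⟨hr', -, h2', h3'⟩
    have e1 := (Finset.mem_filter.1 hr).2
    have e2 := (Finset.mem_filter.1 hr').2
    exact D.tgtB_inj _ h1 _ _ h2 h3 h2' h3' (e1.trans e2.symm)
  rw [Nat.card_Ico] at h1
  have := D.offA_le a ha
  omega

variable (D)

/-- `r` is the position of `a` in the list of `b`. -/
def IsPos (b a r : ℕ) : Prop := D.offB b ≤ r ∧ r < D.offB (b + 1) ∧ D.tgtB r = a

/-- The first `p` cells of `tgtB` are distributed to the agents. -/
structure BucketInv (p : ℕ) (ptr bR bB : ℕ → ℕ) : Prop where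
  ptr_eq : ∀ a < D.nA, ptr a = D.offA a + D.occ p a
  pos : ∀ a < D.nA, ∀ j, D.offA a ≤ j → j < ptr a → bB j < D.nB ∧ D.IsPos (bB j) a (bR j)
  cover : ∀ b < D.nB, ∀ r < p, D.offB b ≤ r → r < D.offB (b + 1) →
    ∃ j, D.offA (D.tgtB r) ≤ j ∧ j < ptr (D.tgtB r) ∧ bB j = b

variable {D}

/-- The buckets occupy the disjoint intervals of the agents, so a write to one of them leaves the
others intact. -/
theorem BucketInv.step {p b : ℕ} {ptr bR bB : ℕ → ℕ} (h : D.BucketInv p ptr bR bB) (hb : b < D.nB)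
    (h1 : D.offB b ≤ p) (h2 : p < D.offB (b + 1)) :
    ptr (D.tgtB p) < D.m ∧
    D.BucketInv (p + 1) (Function.update ptr (D.tgtB p) (ptr (D.tgtB p) + 1))
      (Function.update bR (ptr (D.tgtB p)) p) (Function.update bB (ptr (D.tgtB p)) b) := by
  have ha := D.tgtB_lt b hb p h1 h2
  have hpm : p < D.m := h2.trans_le (D.offB_le_m hb)
  set a := D.tgtB p with ha'
  -- The overflow bound is used at `p + 1`: with the current cell counted in, there is still room
  -- for it.
  have hlt : ptr a < D.offA (a + 1) := by
    have := D.occ_le (p := p + 1) hpm ha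
    rw [occ_succ, if_pos ha'.symm] at this
    rw [h.ptr_eq a ha]
    omega
  have hge : ∀ x < D.nA, D.offA x ≤ ptr x := fun x hx => by rw [h.ptr_eq x hx]; omega
  have hle : ∀ x < D.nA, ptr x ≤ D.offA (x + 1) := fun x hx => by
    rw [h.ptr_eq x hx]; exact D.occ_le hpm.le hx
  refine ⟨hlt.trans_le (D.offA_le_m ha), fun x hx => ?_, fun x hx j hj hj' => ?_,
    fun b' hb' r hr hr1 hr2 => ?_⟩
  · rw [occ_succ]
    by_cases hxa : x = a
    · subst hxa
      rw [Function.update_self, if_pos ha'.symm, h.ptr_eq _ hx]; omega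
    · rw [Function.update_of_ne hxa, if_neg fun h => hxa h.symm, h.ptr_eq _ hx]; omega
  · by_cases hxa : x = a
    · subst hxa
      rw [Function.update_self] at hj'
      by_cases hjp : j = ptr a
      · subst hjp
        simp only [Function.update_self]
        exact ⟨hb, h1, h2, rfl⟩
      · rw [Function.update_of_ne hjp, Function.update_of_ne hjp]
        exact h.pos a hx j hj (by omega)
    · rw [Function.update_of_ne hxa] at hj'
      have hjp : j ≠ ptr a := by
        have h3 := hge a ha
        have h4 := hle x hx
        rcases lt_or_gt_of_ne hxa with h5 | h5
        · have := D.offA_mono (i := x + 1) (j := a) h5 ha.le; omega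
        · have := D.offA_mono (i := a + 1) (j := x) h5 hx.le; omega
      rw [Function.update_of_ne hjp, Function.update_of_ne hjp]
      exact h.pos x hx j hj hj'
  · by_cases hrp : r = p
    · subst hrp
      refine ⟨ptr a, hge a ha, by simp [← ha'], ?_⟩
      rw [Function.update_self]
      by_contra hne
      rcases lt_or_gt_of_ne hne with h5 | h5
      · have := D.offB_mono (i := b + 1) (j := b') h5 hb'.le; omega
      · have := D.offB_mono (i := b' + 1) (j := b) h5 hb.le; omega
    · obtain ⟨j, h3, h4, h5⟩ := h.cover b' hb' r (by omega) hr1 hr2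
      have hx := D.tgtB_lt b' hb' r hr1 hr2
      refine ⟨j, h3, h4.trans_le ?_, ?_⟩
      · by_cases hxa : D.tgtB r = a
        · rw [hxa, Function.update_self]; omega
        · rw [Function.update_of_ne hxa]
      · have hjp : j ≠ ptr a := by
          have h6 := hge a ha
          have h7 := hle _ hx
          rcases lt_trichotomy (D.tgtB r) a with h8 | h8 | h8
          · have := D.offA_mono (i := D.tgtB r + 1) (j := a) h8 ha.le; omega
          · rw [h8] at h4; omega
          · have := D.offA_mono (i := a + 1) (j := D.tgtB r) h8 hx.le; omega
        rw [Function.update_of_ne hjp]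
        exact h5

theorem BucketInv.ptr_le {p : ℕ} {ptr bR bB : ℕ → ℕ} (h : D.BucketInv p ptr bR bB) (hp : p ≤ D.m)
    {a : ℕ} (ha : a < D.nA) : ptr a ≤ D.offA (a + 1) := by
  rw [h.ptr_eq a ha]; exact D.occ_le hp ha

/-- The state of the second pass of the computation of the ranks. -/
structure RankInv (D : Layout) (ptr bB : ℕ → ℕ) (i p p' : ℕ) (T rk : ℕ → ℕ) : Prop where
  le : i ≤ D.nA
  le_p : D.offA i ≤ p
  le_p' : D.offA i ≤ p'
  p_le : i < D.nA → p ≤ ptr i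
  p'_le : i < D.nA → p' ≤ D.offA (i + 1)
  pos : i < D.nA → ∀ j, D.offA i ≤ j → j < p → D.IsPos (bB j) i (T (bB j))
  rank : ∀ a < D.nA, ∀ x, D.offA a ≤ x → x < D.offA (a + 1) → x < p' → D.IsPos (D.tgtA x) a (rk x)

variable {bR bB ptr T rk : ℕ → ℕ} {i p p' : ℕ}

theorem RankInv.init : D.RankInv ptr bB 0 0 0 T rk where
  le := Nat.zero_le _
  le_p := D.offA_zero.le
  le_p' := D.offA_zero.le
  p_le _ := Nat.zero_le _
  p'_le _ := Nat.zero_le _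
  pos _ _ _ hj := absurd hj (Nat.not_lt_zero _)
  rank _ _ _ _ _ hx := absurd hx (Nat.not_lt_zero _)

theorem RankInv.stepT (hb : D.BucketInv D.m ptr bR bB) (h : D.RankInv ptr bB i p p' T rk)
    (hi : i < D.nA) (hp : p < ptr i) :
    bB p < D.nB ∧ bR p < D.m ∧ p < D.m ∧
    D.RankInv ptr bB i (p + 1) p' (Function.update T (bB p) (bR p)) rk := by
  have h1 := hb.pos i hi p h.le_p hp
  have h2 := hb.ptr_le le_rfl hi
  have h3 := D.offA_le_m (i := i + 1) hi
  refine ⟨h1.1, h1.2.2.1.trans_le (D.offB_le_m h1.1), by omega, h.le, h.le_p.trans (Nat.le_succ _),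
    h.le_p', fun _ => hp, h.p'_le, fun _ j hj hj' => ?_, h.rank⟩
  by_cases hjp : bB j = bB p
  · rw [hjp, Function.update_self]; exact h1.2
  · rw [Function.update_of_ne hjp]
    exact h.pos hi j hj (by
      have : j ≠ p := fun h => hjp (by rw [h])
      omega)

/-- The bucket of agent `i` has been loaded completely into `T`, hence `T` is correct for all
neighbours of `i`. Other entries may be left over from earlier agents, but they are not read. -/
theorem RankInv.stepR (hb : D.BucketInv D.m ptr bR bB) (h : D.RankInv ptr bB i p p' T rk)
    (hi : i < D.nA) (hp : ¬ p < ptr i) (hp' : p' < D.offA (i + 1)) :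
    T (D.tgtA p') < D.m ∧ p' < D.m ∧
    D.RankInv ptr bB i p (p' + 1) T (Function.update rk p' (T (D.tgtA p'))) := by
  have hlt := D.tgtA_lt i hi p' h.le_p' hp'
  obtain ⟨r, h1, h2, h3⟩ := D.mutualA i hi p' h.le_p' hp'
  obtain ⟨j, h4, h5, h6⟩ := hb.cover _ hlt r (h2.trans_le (D.offB_le_m hlt)) h1 h2
  rw [h3] at h4 h5
  have h7 := h.pos hi j h4 (by omega)
  rw [h6] at h7
  have h8 := D.offA_le_m (i := i + 1) hi
  refine ⟨h7.2.1.trans_le (D.offB_le_m hlt), by omega, h.le, h.le_p, h.le_p'.trans (Nat.le_succ _),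
    h.p_le, fun _ => hp', h.pos, fun a ha x hx hx' hxp => ?_⟩
  by_cases hxe : x = p'
  · subst hxe
    rw [Function.update_self]
    have hai : a = i := by
      have h9 := h.le_p'
      rcases lt_trichotomy a i with h10 | h10 | h10
      · have := D.offA_mono (i := a + 1) (j := i) h10 hi.le; omega
      · exact h10
      · have := D.offA_mono (i := i + 1) (j := a) h10 ha.le; omega
    rw [hai]; exact h7
  · rw [Function.update_of_ne hxe]
    exact h.rank a ha x hx hx' (by omega)

/-- Both pointers move to the start of the next interval. The inequality `p ≤ p'` ensures that the
jump of the first one does not increase the loop measure. -/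
theorem RankInv.next (hb : D.BucketInv D.m ptr bR bB) (h : D.RankInv ptr bB i p p' T rk)
    (hi : i < D.nA) (hp : ¬ p < ptr i) (hp' : ¬ p' < D.offA (i + 1)) :
    p ≤ p' ∧ p' ≤ D.m ∧ D.RankInv ptr bB (i + 1) p' p' T rk := by
  have h1 := h.p'_le hi
  have h2 := D.offA_le_m (i := i + 1) hi
  have h3 := h.p_le hi
  have h4 := hb.ptr_le le_rfl hi
  have h5 : p' = D.offA (i + 1) := by omega
  refine ⟨by omega, by omega, hi, h5.ge, h5.ge, fun h6 => ?_, fun h6 => ?_, fun h6 j hj hj' => ?_,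
    h.rank⟩
  · rw [h5, hb.ptr_eq _ h6]; omega
  · rw [h5]; exact D.offA_le _ h6
  · omega

theorem RankInv.isRank (h : D.RankInv ptr bB D.nA p p' T rk) : D.IsRank rk := fun a ha x hx hx' => by
  refine h.rank a ha x hx hx' ?_
  have := h.le_p'
  have := D.offA_le_m (i := a + 1) ha
  have := D.offA_last
  omega

/-! ### States that hold an instance -/

variable (D) in
/-- The size of a layout. -/
def size : ℕ := D.nA + D.nB + D.m + 1

variable (D) in
/-- The state holds the instance. -/
structure Input (s : State) : Prop where
  reg0 : s.reg 0 = D.nA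
  reg1 : s.reg 1 = D.nB
  arr0 : s.arr 0 = D.offA
  arr1 : s.arr 1 = D.tgtA
  arr2 : s.arr 2 = D.offB
  arr3 : s.arr 3 = D.tgtB
  arr4 : s.arr 4 = D.low

/-- For a concrete program the default arguments check by computation that it does not write the
registers and arrays of the input. -/
theorem Input.frame {p : Prog} {s s' : State} (h : D.Input s) (hf : Frame p s s')
    (h0 : p.writesReg 0 = false := by rfl) (h1 : p.writesReg 1 = false := by rfl)
    (h2 : p.writesArr 0 = false := by rfl) (h3 : p.writesArr 1 = false := by rfl)
    (h4 : p.writesArr 2 = false := by rfl) (h5 : p.writesArr 3 = false := by rfl)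
    (h6 : p.writesArr 4 = false := by rfl) : D.Input s' :=
  ⟨(hf.reg 0 h0).trans h.reg0, (hf.reg 1 h1).trans h.reg1, (hf.arr 0 h2).trans h.arr0,
    (hf.arr 1 h3).trans h.arr1, (hf.arr 2 h4).trans h.arr2, (hf.arr 3 h5).trans h.arr3,
    (hf.arr 4 h6).trans h.arr4⟩

theorem Input.setReg {s : State} (h : D.Input s) {r v : ℕ} (hr : 1 < r) : D.Input (s.setReg r v) :=
  ⟨by simp [show 0 ≠ r by omega, h.reg0], by simp [show 1 ≠ r by omega, h.reg1], h.arr0, h.arr1,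
    h.arr2, h.arr3, h.arr4⟩

theorem Input.setArr {s : State} (h : D.Input s) {k i v : ℕ} (hk : 4 < k) :
    D.Input (s.setArr k i v) :=
  ⟨h.reg0, h.reg1, by simp [show 0 ≠ k by omega, h.arr0], by simp [show 1 ≠ k by omega, h.arr1],
    by simp [show 2 ≠ k by omega, h.arr2], by simp [show 3 ≠ k by omega, h.arr3],
    by simp [show 4 ≠ k by omega, h.arr4]⟩

end Layout

open Layout

/-! ### The bucket sort as a program -/

/-- Add one to a register. -/
abbrev incr (r : ℕ) : Prog := .set r (.add (.reg r) (.lit 1))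

/-- Copy the starting positions of the lists of the agents to the array `k`. -/
def copyOffsets (k : ℕ) : Prog :=
  .seq (.set 9 (.lit 0))
    (.loop (.lt (.reg 9) (.reg 0)) (.seq (.put k (.reg 9) (.get 0 (.reg 9))) (incr 9)))

theorem copyOffsets_runs {D : Layout} {W : ℕ} {s : State} {k : ℕ} (hk : 4 < k) (hs : D.Input s)
    (hW : D.size ≤ W) :
    Runs W (copyOffsets k) s (20 * D.size) fun s' => ∀ a < D.nA, s'.arr k a = D.offA a := by
  unfold size at *
  refine Runs.imp (.seq (T' := 13 * (D.nA + 1)) (Prog.wp_sound ?_)) ?_ fun s' h => h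
  · refine ⟨Nat.zero_le _, ?_⟩
    refine Runs.imp (Runs.loop
      (fun s' => s'.reg 9 ≤ D.nA ∧ ∀ a < s'.reg 9, s'.arr k a = D.offA a)
      (fun s' => D.nA - s'.reg 9) (by simp [Expr.eval]) (fun s' hf h hc => ?_) (Nat.sub_le _ _))
      ?_ fun s' h => ?_
    · have h0 : s'.reg 0 = D.nA := (hf.reg 0 rfl).trans hs.reg0
      have h1 : s'.arr 0 = D.offA := (hf.arr 0 (by
        simp [Prog.writesArr, show ¬ 0 = k by omega])).trans hs.arr0
      simp only [Test.holds, Expr.eval, h0] at hc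
      have := D.offA_le_m hc.le
      simp only [Prog.wp, Expr.eval, h1, State.setArr_reg, State.setReg_reg, State.setReg_arr,
        State.setArr_arr, if_true]
      refine ⟨by omega, by omega, by omega, ⟨by omega, fun a ha => ?_⟩, by omega⟩
      by_cases hai : a = s'.reg 9
      · subst hai; simp
      · rw [Function.update_of_ne hai]; exact h.2 a (by omega)
    · simp [Prog.bound, Expr.cost, Test.cost]
    · obtain ⟨hf, h, hc⟩ := h
      have h0 : s'.reg 0 = D.nA := (hf.reg 0 rfl).trans hs.reg0
      simp only [Test.holds, Expr.eval, h0] at hc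
      exact fun a ha => h.2 a (by omega)
  · simp [Prog.bound, Expr.cost]; omega

end LQMatching

namespace LQMatching
open Layout

/-- Distribute the positions of the array `3` to the agents. -/
def fillBuckets : Prog :=
  .seq (.set 9 (.lit 0)) (.seq (.set 11 (.lit 0))
    (.loop (.lt (.reg 9) (.reg 1))
      (.branch (.lt (.reg 11) (.get 2 (.add (.reg 9) (.lit 1))))
        (.seq (.set 12 (.get 3 (.reg 11)))
          (.seq (.put 8 (.get 7 (.reg 12)) (.reg 11))
            (.seq (.put 16 (.get 7 (.reg 12)) (.reg 9))
              (.seq (.put 7 (.reg 12) (.add (.get 7 (.reg 12)) (.lit 1))) (incr 11)))))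
        (incr 9))))

/-- Each iteration advances either the cell pointer or the resource pointer, so the nested traversal
of all lists is one loop of linear length. -/
theorem fillBuckets_runs {D : Layout} {W : ℕ} {s : State} (hs : D.Input s) (hW : D.size ≤ W)
    (hptr : ∀ a < D.nA, s.arr 7 a = D.offA a) :
    Runs W fillBuckets s (100 * D.size) fun s' =>
      D.BucketInv D.m (s'.arr 7) (s'.arr 8) (s'.arr 16) := by
  unfold size at *
  refine Runs.imp (.seq (T' := 2 + 60 * (D.nB + D.m + 1)) (Prog.wp_sound ?_)) ?_ fun s' h => h
  · refine ⟨Nat.zero_le _, .seq (Prog.wp_sound ⟨Nat.zero_le _, ?_⟩)⟩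
    refine Runs.imp (Runs.loop
      (fun s' => s'.reg 9 ≤ D.nB ∧ D.offB (s'.reg 9) ≤ s'.reg 11 ∧ s'.reg 11 ≤ D.m ∧
        (s'.reg 9 < D.nB → s'.reg 11 ≤ D.offB (s'.reg 9 + 1)) ∧
        D.BucketInv (s'.reg 11) (s'.arr 7) (s'.arr 8) (s'.arr 16))
      (fun s' => (D.nB - s'.reg 9) + (D.m - s'.reg 11)) ?_ (fun s' hf h hc => ?_)
      (N := D.nB + D.m) (by omega)) ?_ fun s' h => ?_
    · refine ⟨Nat.zero_le _, D.offB_zero.le, Nat.zero_le _, fun _ => Nat.zero_le _,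
        fun a ha => ?_, fun a ha j hj hj' => ?_, fun b hb r hr => absurd hr (Nat.not_lt_zero _)⟩
      · simpa [Expr.eval, occ] using hptr a ha
      · simp [Expr.eval, hptr a ha] at hj'; omega
    · have hs' : D.Input s' := ((hs.setReg (by simp)).setReg (by simp)).frame hf
      obtain ⟨h1, h2, h3, h4, h5⟩ := h
      simp only [Test.holds, Expr.eval, hs'.reg1] at hc
      simp only [Prog.wp, Test.holds, Expr.eval, State.setArr_reg, State.setReg_reg,
        State.setReg_arr, State.setArr_arr, Nat.reduceEqDiff, reduceIte, hs'.arr2, hs'.arr3]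
      refine ⟨fun h6 => ?_, fun h6 => ?_⟩
      · obtain ⟨h7, h8⟩ := h5.step hc h2 h6
        have h9 := D.tgtB_lt _ hc _ h2 h6
        have h10 := D.offB_le_m (i := s'.reg 9 + 1) hc
        exact ⟨by omega, by omega, by omega, by omega, by omega, by omega, by omega, by omega,
          ⟨by omega, by omega, by omega, fun _ => h6, h8⟩, by omega⟩
      · have := h4 hc
        refine ⟨by omega, ⟨hc, by omega, h3, fun h7 => ?_, h5⟩, by omega⟩
        have := D.offB_le _ h7
        omega
    · simp [Prog.bound, Expr.cost, Test.cost]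
    · obtain ⟨hf, ⟨h1, h2, h3, h4, h5⟩, hc⟩ := h
      have hr1 : s'.reg 1 = D.nB := (hf.reg 1 rfl).trans hs.reg1
      simp only [Test.holds, Expr.eval, hr1] at hc
      have h6 : s'.reg 9 = D.nB := by omega
      rw [h6, D.offB_last] at h2
      rwa [show s'.reg 11 = D.m by omega] at h5
  · simp [Prog.bound, Expr.cost]; omega

/-- Transfer the positions from the buckets to the array `6`, agent by agent. -/
def readBuckets : Prog :=
  .seq (.set 9 (.lit 0)) (.seq (.set 11 (.lit 0)) (.seq (.set 12 (.lit 0))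
    (.loop (.lt (.reg 9) (.reg 0))
      (.branch (.lt (.reg 11) (.get 7 (.reg 9)))
        (.seq (.put 10 (.get 16 (.reg 11)) (.get 8 (.reg 11))) (incr 11))
        (.branch (.lt (.reg 12) (.get 0 (.add (.reg 9) (.lit 1))))
          (.seq (.put 6 (.reg 12) (.get 10 (.get 1 (.reg 12)))) (incr 12))
          (.seq (.set 11 (.reg 12)) (incr 9)))))))

/-- Linear for the same reason, with three pointers: agent, bucket cell and list cell. -/
theorem readBuckets_runs {D : Layout} {W : ℕ} {s : State} (hs : D.Input s) (hW : D.size ≤ W)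
    (hb : D.BucketInv D.m (s.arr 7) (s.arr 8) (s.arr 16)) :
    Runs W readBuckets s (200 * D.size) fun s' => D.IsRank (s'.arr 6) := by
  unfold size at *
  refine Runs.imp (.seq (T' := 2 + (2 + 70 * (D.nA + D.m + D.m + 1))) (Prog.wp_sound ?_)) ?_
    fun s' h => h
  · refine ⟨Nat.zero_le _, .seq (Prog.wp_sound ⟨Nat.zero_le _, .seq (Prog.wp_sound
      ⟨Nat.zero_le _, ?_⟩)⟩)⟩
    refine Runs.imp (Runs.loop
      (fun s' => D.RankInv (s.arr 7) (s.arr 16) (s'.reg 9) (s'.reg 11) (s'.reg 12)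
        (s'.arr 10) (s'.arr 6))
      (fun s' => (D.nA - s'.reg 9) + (D.m - s'.reg 11) + (D.m - s'.reg 12)) RankInv.init
      (fun s' hf h hc => ?_) (N := D.nA + D.m + D.m) (by omega)) ?_ fun s' h => ?_
    · have hs' : D.Input s' :=
        (((hs.setReg (by simp)).setReg (by simp)).setReg (by simp)).frame hf
      have e7 : s'.arr 7 = s.arr 7 := hf.arr 7 rfl
      have e8 : s'.arr 8 = s.arr 8 := hf.arr 8 rfl
      have e16 : s'.arr 16 = s.arr 16 := hf.arr 16 rfl
      simp only [Test.holds, Expr.eval, hs'.reg0] at hc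
      simp only [Prog.wp, Test.holds, Expr.eval, State.setArr_reg, State.setReg_reg,
        State.setReg_arr, State.setArr_arr, Nat.reduceEqDiff, reduceIte, hs'.arr0, hs'.arr1, e7, e8,
        e16]
      refine ⟨fun h1 => ?_, fun h1 => ⟨fun h2 => ?_, fun h2 => ?_⟩⟩
      · obtain ⟨h3, h4, h5, h6⟩ := h.stepT hb hc h1
        exact ⟨by omega, by omega, by omega, h6, by omega⟩
      · obtain ⟨h3, h4, h5⟩ := h.stepR hb hc h1 h2
        exact ⟨by omega, by omega, by omega, h5, by omega⟩
      · obtain ⟨h3, h4, h5⟩ := h.next hb hc h1 h2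
        exact ⟨by omega, by omega, h5, by omega⟩
    · simp [Prog.bound, Expr.cost, Test.cost]
    · obtain ⟨hf, h, hc⟩ := h
      have hr0 : s'.reg 0 = D.nA := (hf.reg 0 rfl).trans hs.reg0
      simp only [Test.holds, Expr.eval, hr0] at hc
      rw [show s'.reg 9 = D.nA by have := h.le; omega] at h
      exact h.isRank
  · simp [Prog.bound, Expr.cost]; omega

/-! ### Listing the LQ resources -/

/-- List the LQ resources in the array `11` and count them in the register `4`. -/
def listLQ : Prog :=
  .seq (.set 9 (.lit 0)) (.seq (.set 4 (.lit 0))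
    (.loop (.lt (.reg 9) (.reg 1))
      (.seq (.branch (.lt (.lit 0) (.get 4 (.reg 9)))
        (.seq (.put 11 (.reg 4) (.reg 9)) (incr 4)) .skip) (incr 9))))

namespace Layout

/-- `L` lists the LQ resources among the first `i` resources. -/
structure ListsLQ (D : Layout) (i q : ℕ) (L : ℕ → ℕ) : Prop where
  lt : ∀ j < q, L j < i
  low : ∀ j < q, 0 < D.low (L j)
  inj : ∀ j < q, ∀ j' < q, L j = L j' → j = j'
  surj : ∀ b < i, 0 < D.low b → ∃ j < q, L j = b

theorem ListsLQ.le {D : Layout} {i q : ℕ} {L : ℕ → ℕ} (h : D.ListsLQ i q L) : q ≤ i := by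
  have := Finset.card_le_card_of_injOn (s := Finset.range q) (t := Finset.range i) L
    (fun j hj => by simpa using h.lt j (by simpa using hj))
    (fun j hj j' hj' => h.inj j (by simpa using hj) j' (by simpa using hj'))
  simpa using this

end Layout

theorem listLQ_runs {D : Layout} {W : ℕ} {s : State} (hs : D.Input s) (hW : D.size ≤ W) :
    Runs W listLQ s (100 * D.size) fun s' => D.ListsLQ D.nB (s'.reg 4) (s'.arr 11) := by
  unfold size at *
  refine Runs.imp (.seq (T' := 2 + 70 * (D.nB + 1)) (Prog.wp_sound ?_)) ?_
    fun s' h => h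
  · refine ⟨Nat.zero_le _, .seq (Prog.wp_sound ⟨Nat.zero_le _, ?_⟩)⟩
    refine Runs.imp (Runs.loop
      (fun s' => s'.reg 9 ≤ D.nB ∧ D.ListsLQ (s'.reg 9) (s'.reg 4) (s'.arr 11))
      (fun s' => D.nB - s'.reg 9) ?_
      (fun s' hf h hc => ?_) (N := D.nB) (by omega)) ?_ fun s' h => ?_
    · simp only [Expr.eval, State.setReg_reg, reduceIte, Nat.reduceEqDiff]
      exact ⟨Nat.zero_le _, fun j hj => absurd hj (Nat.not_lt_zero _),
        fun j hj => absurd hj (Nat.not_lt_zero _), fun j hj => absurd hj (Nat.not_lt_zero _),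
        fun j hj => absurd hj (Nat.not_lt_zero _)⟩
    · have hs' : D.Input s' := ((hs.setReg (by simp)).setReg (by simp)).frame hf
      obtain ⟨h0, h⟩ := h
      have hq := h.le
      simp only [Test.holds, Expr.eval, hs'.reg1] at hc
      simp only [Prog.wp, Test.holds, Expr.eval, State.setArr_reg, State.setReg_reg,
        State.setReg_arr, State.setArr_arr, Nat.reduceEqDiff, reduceIte, hs'.arr4]
      refine ⟨fun h1 => ⟨by omega, by omega, by omega, by omega, ⟨by omega, ?_⟩, by omega⟩,
        fun h1 => ⟨by omega, ⟨by omega, ?_⟩, by omega⟩⟩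
      · have e1 : ∀ j < s'.reg 4, Function.update (s'.arr 11) (s'.reg 4) (s'.reg 9) j =
            s'.arr 11 j := fun j hj => Function.update_of_ne hj.ne _ _
        have e2 : Function.update (s'.arr 11) (s'.reg 4) (s'.reg 9) (s'.reg 4) = s'.reg 9 :=
          Function.update_self ..
        refine ⟨fun j hj => ?_, fun j hj => ?_, fun j hj j' hj' hjj => ?_, fun b hb hl => ?_⟩
        · rcases Nat.lt_succ_iff_lt_or_eq.1 hj with hj | rfl
          · rw [e1 j hj]; have := h.lt j hj; omega
          · omega
        · rcases Nat.lt_succ_iff_lt_or_eq.1 hj with hj | rfl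
          · rw [e1 j hj]; exact h.low j hj
          · rwa [e2]
        · rcases Nat.lt_succ_iff_lt_or_eq.1 hj with hj | rfl <;>
          rcases Nat.lt_succ_iff_lt_or_eq.1 hj' with hj' | rfl
          · rw [e1 j hj, e1 j' hj'] at hjj; exact h.inj j hj j' hj' hjj
          · rw [e1 j hj, e2] at hjj; have := h.lt j hj; omega
          · rw [e1 j' hj', e2] at hjj; have := h.lt j' hj'; omega
          · rfl
        · rcases Nat.lt_succ_iff_lt_or_eq.1 hb with hb | rfl
          · obtain ⟨j, hj, h2⟩ := h.surj b hb hl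
            exact ⟨j, by omega, by rw [e1 j hj]; exact h2⟩
          · exact ⟨_, Nat.lt_succ_self _, e2⟩
      · refine ⟨fun j hj => (h.lt j hj).trans (Nat.lt_succ_self _), h.low, h.inj, fun b hb hl => ?_⟩
        rcases Nat.lt_succ_iff_lt_or_eq.1 hb with hb | rfl
        · exact h.surj b hb hl
        · exact absurd hl h1
    · simp [Prog.bound, Expr.cost, Test.cost]
    · obtain ⟨hf, ⟨h1, h2⟩, hc⟩ := h
      have hr1 : s'.reg 1 = D.nB := (hf.reg 1 rfl).trans hs.reg1
      simp only [Test.holds, Expr.eval, hr1] at hc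
      rwa [show s'.reg 9 = D.nB by omega] at h2
  · simp [Prog.bound, Expr.cost]; omega

end LQMatching

namespace LQMatching
open Layout

/-! ### Deferred acceptance as a program -/

/-- Reset the data of the resources, except for the assignment of the LQ resources. -/
def resetCuts : Prog :=
  .seq (.set 9 (.lit 0))
    (.loop (.lt (.reg 9) (.reg 1))
      (.seq (.branch (.lt (.lit 0) (.get 4 (.reg 9))) .skip
          (.put 14 (.reg 9) (.get 2 (.add (.reg 9) (.lit 1)))))
        (.seq (.put 15 (.reg 9) (.lit 0)) (incr 9))))

theorem resetCuts_runs {D : Layout} {W : ℕ} {s : State} (hs : D.Input s) (hW : D.size ≤ W) :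
    Runs W resetCuts s (50 * D.size) fun s' =>
      (∀ b, 0 < D.low b → s'.arr 14 b = s.arr 14 b) ∧
      (∀ b < D.nB, D.low b = 0 → s'.arr 14 b = D.offB (b + 1)) ∧ ∀ b < D.nB, s'.arr 15 b = 0 := by
  unfold size at *
  refine Runs.imp (.seq (T' := 40 * (D.nB + 1)) (Prog.wp_sound ?_)) ?_ fun s' h => h
  · refine ⟨Nat.zero_le _, ?_⟩
    refine Runs.imp (Runs.loop
      (fun s' => s'.reg 9 ≤ D.nB ∧ (∀ b, 0 < D.low b → s'.arr 14 b = s.arr 14 b) ∧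
        (∀ b < s'.reg 9, D.low b = 0 → s'.arr 14 b = D.offB (b + 1)) ∧
        ∀ b < s'.reg 9, s'.arr 15 b = 0)
      (fun s' => D.nB - s'.reg 9) (by simp [Expr.eval]) (fun s' hf h hc => ?_) (Nat.sub_le _ _))
      ?_ fun s' h => ?_
    · have hs' : D.Input s' := (hs.setReg (by simp)).frame hf
      simp only [Test.holds, Expr.eval, hs'.reg1] at hc
      have := D.offB_le_m (i := s'.reg 9 + 1) hc
      obtain ⟨h1, h2, h3, h4⟩ := h
      have h15 : ∀ b < s'.reg 9 + 1, Function.update (s'.arr 15) (s'.reg 9) 0 b = 0 := by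
        intro b hb
        by_cases hbi : b = s'.reg 9
        · subst hbi; simp
        · rw [Function.update_of_ne hbi]; exact h4 b (by omega)
      simp only [Prog.wp, Test.holds, Expr.eval, State.setArr_reg, State.setReg_reg,
        State.setReg_arr, State.setArr_arr, Nat.reduceEqDiff, reduceIte, hs'.arr2, hs'.arr4]
      refine ⟨fun h0 => ⟨by omega, by omega, by omega, ⟨by omega, h2, fun b hb hl => ?_, h15⟩,
        by omega⟩, fun h0 => ⟨by omega, by omega, by omega, by omega, by omega,
        ⟨by omega, fun b hl => ?_, fun b hb hl => ?_, h15⟩, by omega⟩⟩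
      · exact h3 b (by have : b ≠ s'.reg 9 := (by rintro rfl; omega); omega) hl
      · rw [Function.update_of_ne (by rintro rfl; omega)]; exact h2 b hl
      · by_cases hbi : b = s'.reg 9
        · subst hbi; simp
        · rw [Function.update_of_ne hbi]; exact h3 b (by omega) hl
    · simp [Prog.bound, Expr.cost, Test.cost]
    · obtain ⟨hf, ⟨h1, h2, h3, h4⟩, hc⟩ := h
      have h0 : s'.reg 1 = D.nB := (hf.reg 1 rfl).trans hs.reg1
      simp only [Test.holds, Expr.eval, h0] at hc
      exact ⟨h2, fun b hb => h3 b (by omega), fun b hb => h4 b (by omega)⟩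
  · simp [Prog.bound, Expr.cost]; omega

/-- The position of the current proposal of the agent in register `9`. -/
abbrev walkPos : Expr := .get 13 (.reg 9)

/-- The assigned agents run through their lists down to the assigned resources. -/
def walk (e : ℕ) : Prog :=
  .seq (.set 9 (.lit 0))
    (.loop (.lt (.reg 9) (.reg 0))
      (.branch (.or (.eq (.get 12 (.reg 9)) (.lit 0))
          (.eq (.add (.get 1 walkPos) (.lit 1)) (.get 12 (.reg 9))))
        (incr 9)
        (.seq
          (.branch (.and (.eq (.lit e) (.lit 1)) (.lt (.get 6 walkPos) (.get 14 (.get 1 walkPos))))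
            (.branch (.lt (.lit 0) (.get 4 (.get 1 walkPos))) (.set 7 (.lit 1))
              (.put 14 (.get 1 walkPos) (.get 6 walkPos)))
            .skip)
          (.put 13 (.reg 9) (.add walkPos (.lit 1))))))

/-- Nothing is held yet, so a non-LQ resource can be closed without displacing anybody. Each
iteration finishes an agent or moves an assigned agent one position down. -/
theorem walk_runs {D : Layout} {W e : ℕ} {s : State} {σ : ℕ → ℕ} (hs : D.Input s)
    (hW : D.size ≤ W) (hr : D.IsRank (s.arr 6)) (hσ : D.Assigned σ (s.arr 12))
    (hD : D.DAInv (s.arr 6) e σ (s.arr 12) (fun _ => False) (s.arr 13) (s.arr 14) (s.arr 15) (s.reg 7))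
    (hh : ∀ b < D.nB, s.arr 15 b = 0) :
    Runs W (walk e) s (100 * D.size) fun s' =>
      D.DAInv (s.arr 6) e σ (s.arr 12) (fun x => x < D.nA ∧ s.arr 12 x ≠ 0) (s'.arr 13) (s'.arr 14)
        (s'.arr 15) (s'.reg 7) := by
  unfold size at *
  refine Runs.imp (.seq (T' := 80 * (D.nA + D.m + 1)) (Prog.wp_sound ?_)) ?_ fun s' h => h
  · refine ⟨Nat.zero_le _, ?_⟩
    refine Runs.imp (Runs.loop
      (fun s' => s'.reg 9 ≤ D.nA ∧ D.DAInv (s.arr 6) e σ (s.arr 12)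
        (fun x => x < s'.reg 9 ∧ s.arr 12 x ≠ 0) (s'.arr 13) (s'.arr 14) (s'.arr 15) (s'.reg 7))
      (fun s' => (D.nA - s'.reg 9) + D.slack (s'.arr 13)) ?_ (fun s' hf h hc => ?_)
      (N := D.nA + D.m) ?_) ?_ fun s' h => ?_
    · refine ⟨Nat.zero_le _, hD.congr_settled fun x => ?_⟩
      simp [Expr.eval]
    · have hs' : D.Input s' := (hs.setReg (by simp)).frame hf
      have e6 : s'.arr 6 = s.arr 6 := hf.arr 6 rfl
      have e12 : s'.arr 12 = s.arr 12 := hf.arr 12 rfl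
      have e15 : s'.arr 15 = s.arr 15 := hf.arr 15 rfl
      obtain ⟨h1, h⟩ := h
      simp only [Test.holds, Expr.eval, hs'.reg0] at hc
      have hns : ¬ (s'.reg 9 < s'.reg 9 ∧ s.arr 12 (s'.reg 9) ≠ 0) := by omega
      simp only [Prog.wp, Test.holds, Expr.eval, State.setArr_reg, State.setReg_reg,
        State.setReg_arr, State.setArr_arr, Nat.reduceEqDiff, reduceIte, hs'.arr1, hs'.arr4, e6, e12,
        e15]
      refine ⟨fun h2 => ⟨by omega, ⟨by omega, ?_⟩, by omega⟩, fun h2 => ?_⟩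
      -- Free agents are skipped here without becoming settled.
      · by_cases hu : s.arr 12 (s'.reg 9) = 0
        · refine (e15 ▸ h).congr_settled fun x => ?_
          constructor
          · rintro ⟨h3, h4⟩
            have : x ≠ s'.reg 9 := by rintro rfl; exact h4 hu
            exact ⟨by omega, h4⟩
          · rintro ⟨h3, h4⟩
            exact ⟨by omega, h4⟩
        · refine (e15 ▸ h).settle (a := s'.reg 9) (fun _ => h2.resolve_left hu)
            (fun h0 => absurd h0 hu) fun x => ?_
          constructor
          · rintro ⟨h3, h4⟩
            by_cases hx : x = s'.reg 9
            · exact .inl hx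
            · exact .inr ⟨by omega, h4⟩
          · rintro (rfl | ⟨h3, h4⟩)
            · exact ⟨by omega, hu⟩
            · exact ⟨by omega, h4⟩
      · have hu : s.arr 12 (s'.reg 9) ≠ 0 := fun h0 => h2 (.inl h0)
        have hne : D.tgtA (s'.arr 13 (s'.reg 9)) + 1 ≠ s.arr 12 (s'.reg 9) := fun h0 => h2 (.inr h0)
        have hlt : s'.arr 13 (s'.reg 9) < D.offA (s'.reg 9 + 1) := by
          obtain ⟨⟨p, hp, hp', _⟩, _⟩ := h.assigned _ hc hu
          omega
        have hm := D.offA_le_m (i := s'.reg 9 + 1) hc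
        have hsl := D.slack_update hc hlt
        have hb := D.tgtA_lt _ hc _ (h.ge _ hc) hlt
        have hrk := (hr _ hc _ (h.ge _ hc) hlt).2.1
        have hbm := D.offB_le_m (i := D.tgtA (s'.arr 13 (s'.reg 9)) + 1) hb
        have hh' := hh _ hb
        rw [← e15] at hh'
        rw [← e15]
        refine ⟨fun h3 => ⟨fun h4 => ⟨by omega, by omega, by omega, ⟨by omega, ?_⟩, by omega⟩,
          fun h4 => ⟨by omega, by omega, by omega, by omega, ⟨by omega, ?_⟩, by omega⟩⟩,
          fun h3 => ⟨by omega, by omega, ⟨by omega, ?_⟩, by omega⟩⟩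
        · exact h.refute hr hσ hc hns hlt (fun _ => hne) (.inr h3.1) h4 h3.2
        -- After closing, the cut equals the rank of the walker, so the walker may pass.
        · refine (h.close hc hu hlt hne h3.1 (by omega) hh' h3.2).walk_pass hr hσ hc hns hu hne
            fun _ => ?_
          rw [Function.update_self]
        · refine h.walk_pass hr hσ hc hns hu hne fun he => ?_
          by_contra h4
          exact h3 ⟨he, by omega⟩
    · have := D.slack_le hD.ge
      simp only [Expr.eval, State.setReg_reg, State.setReg_arr, reduceIte]
      omega
    · simp [Prog.bound, Expr.cost, Test.cost]
    · obtain ⟨hf, ⟨h1, h2⟩, hc⟩ := h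
      have h0 : s'.reg 0 = D.nA := (hf.reg 0 rfl).trans hs.reg0
      simp only [Test.holds, Expr.eval, h0] at hc
      rwa [show s'.reg 9 = D.nA by omega] at h2
  · simp [Prog.bound, Expr.cost]; omega

/-- Deferred acceptance: the agent in register `10` proposes, until nobody is left. -/
def propose : Prog :=
  .seq (.set 9 (.lit 0)) (.seq (.set 10 (.lit 0))
    (.loop (.or (.lt (.reg 9) (.reg 0)) (.lt (.lit 0) (.reg 10)))
      (.branch (.eq (.reg 10) (.lit 0))
        (.seq (.branch (.eq (.get 12 (.reg 9)) (.lit 0)) (.set 10 (.add (.reg 9) (.lit 1))) .skip)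
          (incr 9))
        (.seq (.set 12 (.sub (.reg 10) (.lit 1)))
          (.seq (.set 11 (.get 13 (.reg 12)))
            (.branch (.lt (.reg 11) (.get 0 (.add (.reg 12) (.lit 1))))
              (.branch (.lt (.get 6 (.reg 11)) (.get 14 (.get 1 (.reg 11))))
                (.branch (.lt (.lit 0) (.get 4 (.get 1 (.reg 11))))
                  (.seq (.set 7 (.lit 1)) (.put 13 (.reg 12) (.add (.reg 11) (.lit 1))))
                  (.seq
                    (.branch (.eq (.get 15 (.get 1 (.reg 11))) (.lit 0))
                      (.set 10 (.lit 0))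
                      (.seq (.set 13 (.get 3 (.get 14 (.get 1 (.reg 11)))))
                        (.seq (.put 13 (.reg 13) (.add (.get 13 (.reg 13)) (.lit 1)))
                          (.set 10 (.add (.reg 13) (.lit 1))))))
                    (.seq (.put 14 (.get 1 (.reg 11)) (.get 6 (.reg 11)))
                      (.put 15 (.get 1 (.reg 11)) (.lit 1)))))
                (.put 13 (.reg 12) (.add (.reg 11) (.lit 1))))
              (.set 10 (.lit 0))))))))

/-- Register `10` holds the successor of the proposing agent, or `0` if there is none. Settled are
the assigned agents and all agents introduced so far, except the proposer. -/
theorem propose_runs {D : Layout} {W e : ℕ} {s : State} {σ : ℕ → ℕ} (hs : D.Input s)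
    (hW : D.size ≤ W) (hr : D.IsRank (s.arr 6)) (hσ : D.Assigned σ (s.arr 12))
    (hD : D.DAInv (s.arr 6) e σ (s.arr 12) (fun x => x < D.nA ∧ s.arr 12 x ≠ 0) (s.arr 13)
      (s.arr 14) (s.arr 15) (s.reg 7)) :
    Runs W propose s (400 * D.size) fun s' => ∃ settled : ℕ → Prop, (∀ a < D.nA, settled a) ∧
      D.DAInv (s.arr 6) e σ (s.arr 12) settled (s'.arr 13) (s'.arr 14) (s'.arr 15) (s'.reg 7) := by
  unfold size at *
  refine Runs.imp (.seq (T' := 2 + 130 * (2 * D.nA + D.m + 1)) (Prog.wp_sound ?_)) ?_ fun s' h => h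
  · refine ⟨Nat.zero_le _, .seq (Prog.wp_sound ⟨Nat.zero_le _, ?_⟩)⟩
    refine Runs.imp (Runs.loop
      (fun s' => s'.reg 9 ≤ D.nA ∧
        (s'.reg 10 ≠ 0 → s'.reg 10 ≤ s'.reg 9 ∧ s.arr 12 (s'.reg 10 - 1) = 0) ∧
        D.DAInv (s.arr 6) e σ (s.arr 12)
          (fun x => x < D.nA ∧ (s.arr 12 x ≠ 0 ∨ (x < s'.reg 9 ∧ x + 1 ≠ s'.reg 10)))
          (s'.arr 13) (s'.arr 14) (s'.arr 15) (s'.reg 7))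
      -- Introducing a new agent gains two units and may spend one on making it the proposer; every
      -- other iteration either ends a chain of proposals or moves an agent down its list.
      (fun s' => 2 * (D.nA - s'.reg 9) + min 1 (s'.reg 10) + D.slack (s'.arr 13)) ?_
      (fun s' hf h hc => ?_) (N := 2 * D.nA + D.m) ?_) ?_ fun s' h => ?_
    · refine ⟨Nat.zero_le _, ?_, hD.congr_settled fun x => ?_⟩
      · simp [Expr.eval]
      · simp [Expr.eval]
    · have hs' : D.Input s' := ((hs.setReg (by simp)).setReg (by simp)).frame hf
      have e6 : s'.arr 6 = s.arr 6 := hf.arr 6 rfl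
      have e12 : s'.arr 12 = s.arr 12 := hf.arr 12 rfl
      obtain ⟨h1, h2, h⟩ := h
      simp only [Test.holds, Expr.eval, hs'.reg0] at hc
      simp only [Prog.wp, Test.holds, Expr.eval, State.setArr_reg, State.setReg_reg,
        State.setReg_arr, State.setArr_arr, Nat.reduceEqDiff, reduceIte, hs'.arr0, hs'.arr1, hs'.arr3,
        hs'.arr4, e6, e12]
      refine ⟨fun h3 => ⟨fun h4 => ⟨by omega, by omega, ⟨by omega, fun _ => ⟨by omega, h4⟩, ?_⟩,
        by omega⟩, fun h4 => ⟨by omega, ⟨by omega, fun h0 => absurd h3 h0, ?_⟩, by omega⟩⟩,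
        fun h3 => ?_⟩
      · refine h.congr_settled fun x => and_congr_right fun _ => or_congr_right ?_
        omega
      · refine h.congr_settled fun x => and_congr_right fun _ => ?_
        by_cases hx : x = s'.reg 9
        · subst hx; simp [h4]
        · exact or_congr_right (by omega)
      · obtain ⟨h4, h5⟩ := h2 h3
        obtain ⟨a, ha⟩ : ∃ a, s'.reg 10 = a + 1 := ⟨s'.reg 10 - 1, by omega⟩
        rw [ha] at h h2 h4 h5 ⊢
        simp only [Nat.add_sub_cancel] at *
        have haA : a < D.nA := by omega
        have hns : ¬ (a < D.nA ∧ (s.arr 12 a ≠ 0 ∨ a < s'.reg 9 ∧ a + 1 ≠ a + 1)) := by simp [h5]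
        have hu : s.arr 12 a ≠ 0 → D.tgtA (s'.arr 13 a) + 1 ≠ s.arr 12 a := fun h0 => absurd h5 h0
        have hle := h.le a haA
        have hm := D.offA_le_m (i := a + 1) haA
        refine ⟨by omega, by omega, fun hlt => ?_, fun hlt => ⟨by omega, ⟨h1, by simp, ?_⟩, by omega⟩⟩
        · have hsl := D.slack_update haA hlt
          have hb := D.tgtA_lt _ haA _ (h.ge _ haA) hlt
          have hrk := (hr _ haA _ (h.ge _ haA) hlt).2.1
          have hbm := D.offB_le_m (i := D.tgtA (s'.arr 13 a) + 1) hb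
          refine ⟨fun hcut => ⟨fun hl => ⟨by omega, by omega, by omega, ⟨h1, fun _ => ⟨h4, h5⟩, ?_⟩,
            by omega⟩, fun hl => ⟨fun hh => ⟨by omega, by omega, by omega, by omega, by omega,
            ⟨h1, by simp, ?_⟩, by omega⟩, fun hh => ?_⟩⟩, fun hcut => ⟨by omega, by omega,
            ⟨h1, fun _ => ⟨h4, h5⟩, ?_⟩, by omega⟩⟩
          · exact h.refute hr hσ haA hns hlt hu (.inl h5) hl hcut
          · refine h.accept hr haA hns h5 hlt (by omega) hcut fun x => ?_
            simp only [hh]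
            by_cases hx : x = a
            · subst hx; simp [haA, h5]; omega
            · simp [hx]
          · obtain ⟨_, c, ⟨hc1, hc2, hc3⟩, ⟨_, hc4⟩, hc5, hc6⟩ := h.holder _ hb hh
            have hc7 : D.tgtB (s'.arr 14 (D.tgtA (s'.arr 13 a))) = c := by
              rw [← hc6]; exact (hr _ hc1 _ (h.ge _ hc1) hc2).2.2
            have hci := hc4.resolve_left (fun h0 => h0 hc5)
            have hslc := D.slack_update hc1 hc2
            have hmc := D.offA_le_m (i := c + 1) hc1
            have hca : c ≠ a := by omega
            rw [hc7]
            -- The displaced agent `c` becomes the proposer. Its proposal is rejected at once, since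
            -- the new cut lies above its rank; this move makes the measure decrease although the
            -- register stays nonzero.
            have hacc := h.accept hr haA hns h5 hlt (by omega) hcut
              (settled' := fun x => x < D.nA ∧
                (s.arr 12 x ≠ 0 ∨ (x < s'.reg 9 ∧ x + 1 ≠ c + 1))) fun x => by
                rw [hc7]
                by_cases hx : x = a
                · subst hx; simp [haA]; omega
                · by_cases hxc : x = c
                  · subst hxc; simp [hc5, hx, hh]
                  · simp [hx, hxc]
            have hrej := hacc.reject hr hσ hc1 (by simp [hc5]) hc5 hc2 (by
              rw [hc3, Function.update_self, hc6]; omega)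
            have hne : Function.update (s'.arr 13) c (s'.arr 13 c + 1) a = s'.arr 13 a :=
              Function.update_of_ne (Ne.symm hca) _ _
            exact ⟨by omega, by omega, by omega, by omega, by omega, by omega, by omega, by omega,
              ⟨h1, fun _ => ⟨by omega, by simpa using hc5⟩, hrej⟩, by omega⟩
          · exact h.reject hr hσ haA hns h5 hlt (by omega)
        · refine h.settle (a := a) (fun h0 => absurd h5 h0) (fun _ => by omega) fun x => ?_
          by_cases hx : x = a
          · subst hx; simp [haA]; omega
          · simp [hx]
    · have := D.slack_le hD.ge
      simp only [Expr.eval, State.setReg_reg, State.setReg_arr, reduceIte]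
      simp
      omega
    · simp [Prog.bound, Expr.cost, Test.cost]
    · obtain ⟨hf, ⟨h1, h2, h3⟩, hc⟩ := h
      have h0 : s'.reg 0 = D.nA := (hf.reg 0 rfl).trans hs.reg0
      simp only [Test.holds, Expr.eval, h0] at hc
      refine ⟨_, fun a ha => ⟨ha, ?_⟩, h3⟩
      by_cases hu : s.arr 12 a = 0
      · exact .inr (by omega)
      · exact .inl hu
  · simp [Prog.bound, Expr.cost]; omega

end LQMatching

namespace LQMatching
open Layout

/-! ### Size and output of the current matching -/

/-- Count the matched agents. -/
def countMatched : Prog :=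
  .seq (.set 9 (.lit 0)) (.seq (.set 8 (.lit 0))
    (.loop (.lt (.reg 9) (.reg 0))
      (.seq (.branch (.lt (.get 13 (.reg 9)) (.get 0 (.add (.reg 9) (.lit 1)))) (incr 8) .skip)
        (incr 9))))

theorem countMatched_runs {D : Layout} {W : ℕ} {s : State} (hs : D.Input s) (hW : D.size ≤ W) :
    Runs W countMatched s (50 * D.size) fun s' => s'.reg 8 = D.count (s.arr 13) := by
  unfold size at *
  refine Runs.imp (.seq (T' := 2 + 40 * (D.nA + 1)) (Prog.wp_sound ?_)) ?_ fun s' h => h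
  · refine ⟨Nat.zero_le _, .seq (Prog.wp_sound ⟨Nat.zero_le _, ?_⟩)⟩
    refine Runs.imp (Runs.loop
      (fun s' => s'.reg 9 ≤ D.nA ∧ s'.reg 8 ≤ s'.reg 9 ∧ s'.reg 8 =
        ((Finset.range (s'.reg 9)).filter fun a => s.arr 13 a < D.offA (a + 1)).card)
      (fun s' => D.nA - s'.reg 9) (by simp [Expr.eval]) (fun s' hf h hc => ?_) (Nat.sub_le _ _))
      ?_ fun s' h => ?_
    · have hs' : D.Input s' := ((hs.setReg (by simp)).setReg (by simp)).frame hf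
      have e13 : s'.arr 13 = s.arr 13 := hf.arr 13 rfl
      simp only [Test.holds, Expr.eval, hs'.reg0] at hc
      obtain ⟨h1, h2, h3⟩ := h
      simp only [Prog.wp, Test.holds, Expr.eval, State.setReg_reg, Nat.reduceEqDiff, reduceIte, hs'.arr0, e13]
      rw [Finset.range_add_one, Finset.filter_insert]
      refine ⟨fun h4 => ⟨by omega, by omega, ⟨by omega, by omega, ?_⟩, by omega⟩,
        fun h4 => ⟨by omega, ⟨by omega, by omega, ?_⟩, by omega⟩⟩
      · rw [if_pos h4, Finset.card_insert_of_notMem (by simp), h3]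
      · rw [if_neg h4, h3]
    · simp [Prog.bound, Expr.cost, Test.cost]
    · obtain ⟨hf, ⟨h1, h2, h3⟩, hc⟩ := h
      have h0 : s'.reg 0 = D.nA := (hf.reg 0 rfl).trans hs.reg0
      simp only [Test.holds, Expr.eval, h0] at hc
      rwa [show s'.reg 9 = D.nA by omega] at h3
  · simp [Prog.bound, Expr.cost]; omega

/-- Write the current matching to the output array. -/
def writeOutput : Prog :=
  .seq (.set 9 (.lit 0))
    (.loop (.lt (.reg 9) (.reg 0))
      (.seq (.branch (.lt (.get 13 (.reg 9)) (.get 0 (.add (.reg 9) (.lit 1))))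
        (.put 5 (.reg 9) (.add (.get 1 (.get 13 (.reg 9))) (.lit 1)))
        (.put 5 (.reg 9) (.lit 0))) (incr 9)))

namespace Layout

/-- The output array `out` holds the matching `ν`. -/
def IsOutput (D : Layout) (ν out : ℕ → ℕ) : Prop :=
  ∀ a < D.nA, out a = if ν a < D.offA (a + 1) then D.tgtA (ν a) + 1 else 0

end Layout

theorem writeOutput_runs {D : Layout} {W : ℕ} {s : State} (hs : D.Input s) (hW : D.size ≤ W)
    (hge : ∀ a < D.nA, D.offA a ≤ s.arr 13 a) :
    Runs W writeOutput s (60 * D.size) fun s' => D.IsOutput (s.arr 13) (s'.arr 5) := by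
  unfold size at *
  refine Runs.imp (.seq (T' := 50 * (D.nA + 1)) (Prog.wp_sound ?_)) ?_ fun s' h => h
  · refine ⟨Nat.zero_le _, ?_⟩
    refine Runs.imp (Runs.loop
      (fun s' => s'.reg 9 ≤ D.nA ∧ ∀ a < s'.reg 9, s'.arr 5 a =
        if s.arr 13 a < D.offA (a + 1) then D.tgtA (s.arr 13 a) + 1 else 0)
      (fun s' => D.nA - s'.reg 9) (by simp [Expr.eval]) (fun s' hf h hc => ?_) (Nat.sub_le _ _))
      ?_ fun s' h => ?_
    · have hs' : D.Input s' := (hs.setReg (by simp)).frame hf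
      have e13 : s'.arr 13 = s.arr 13 := hf.arr 13 rfl
      simp only [Test.holds, Expr.eval, hs'.reg0] at hc
      obtain ⟨h1, h2⟩ := h
      simp only [Prog.wp, Test.holds, Expr.eval, State.setArr_reg, State.setReg_reg,
        State.setReg_arr, State.setArr_arr, reduceIte, hs'.arr0, hs'.arr1, e13]
      refine ⟨fun h4 => ?_, fun h4 => ⟨by omega, by omega, by omega, ⟨by omega, fun a ha => ?_⟩,
        by omega⟩⟩
      · have := D.tgtA_lt _ hc _ (hge _ hc) h4
        refine ⟨by omega, by omega, by omega, ⟨by omega, fun a ha => ?_⟩, by omega⟩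
        by_cases hai : a = s'.reg 9
        · subst hai; simp [h4]
        · rw [Function.update_of_ne hai]; exact h2 a (by omega)
      · by_cases hai : a = s'.reg 9
        · subst hai; simp [h4]
        · rw [Function.update_of_ne hai]; exact h2 a (by omega)
    · simp [Prog.bound, Expr.cost, Test.cost]
    · obtain ⟨hf, ⟨h1, h2⟩, hc⟩ := h
      have h0 : s'.reg 0 = D.nA := (hf.reg 0 rfl).trans hs.reg0
      simp only [Test.holds, Expr.eval, h0] at hc
      rw [show s'.reg 9 = D.nA by omega] at h2
      exact h2
  · simp [Prog.bound, Expr.cost]; omega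

/-! ### Extending an assignment of the LQ resources -/

/-- Keep the current matching if it is admissible and the best so far. -/
def record : Prog :=
  .branch (.and (.eq (.reg 7) (.lit 0)) (.or (.eq (.reg 2) (.lit 0)) (.lt (.reg 3) (.reg 8))))
    (.seq (.set 2 (.lit 1)) (.seq (.set 3 (.reg 8)) writeOutput)) .skip

/-- Compute a largest admissible extension of the current assignment, and record it. -/
def extend (e : ℕ) : Prog :=
  .seq (copyOffsets 13) (.seq resetCuts (.seq (.set 7 (.lit 0)) (.seq (walk e) (.seq propose
    (.seq countMatched record)))))

namespace Layout

/-- The recorded matching is a best matching among those with the property `S`. -/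
structure Best (D : Layout) (rk : ℕ → ℕ) (e : ℕ) (S : (ℕ → ℕ) → Prop) (s : State) : Prop where
  found : s.reg 2 ≤ 1
  sound : s.reg 2 ≠ 0 → ∃ ν, D.Adm rk e ν ∧ D.count ν = s.reg 3 ∧ D.IsOutput ν (s.arr 5)
  best : ∀ ν, D.Adm rk e ν → S ν → s.reg 2 ≠ 0 ∧ D.count ν ≤ s.reg 3

end Layout

/-- `E` is the class of matchings that has just been searched: it is empty if the flag is set, and
otherwise the current matching is at least as large as all its members. If nothing is written
although the flag is clear, the old record is at least as large as the current matching and hence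
dominates `E`. -/
theorem record_runs {D : Layout} {W e : ℕ} {rk : ℕ → ℕ} {s : State} {S E : (ℕ → ℕ) → Prop}
    (hs : D.Input s) (hW : D.size ≤ W) (hge : ∀ a < D.nA, D.offA a ≤ s.arr 13 a)
    (hc : s.reg 8 = D.count (s.arr 13))
    (h0 : s.reg 7 = 0 → D.Adm rk e (s.arr 13) ∧ ∀ ν, E ν → D.count ν ≤ D.count (s.arr 13))
    (h1 : s.reg 7 ≠ 0 → ∀ ν, ¬ E ν) (hb : D.Best rk e S s) :
    Runs W record s (30 + 60 * D.size) fun s' => D.Best rk e (fun ν => S ν ∨ E ν) s' := by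
  have hcW : s.reg 8 ≤ W := by
    rw [hc]
    refine (Finset.card_le_card (Finset.filter_subset _ _)).trans ?_
    rw [Finset.card_range]
    unfold size at hW
    omega
  refine Runs.imp (.branch (T := 4 + 60 * D.size) (T' := 1) (fun h => ?_) fun h =>
    Prog.wp_sound (p := .skip) ?_) ?_ fun s' h => h
  · simp only [Test.holds, Expr.eval] at h
    obtain ⟨h2, h3⟩ := h
    obtain ⟨h4, h5⟩ := h0 h2
    refine Runs.imp (.seq (Prog.wp_sound (p := .set 2 (.lit 1)) ⟨?_, .seq (Prog.wp_sound
      (p := .set 3 (.reg 8)) ⟨?_, (writeOutput_runs ((hs.setReg (by simp)).setReg (by simp))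
        hW ?_).frame⟩)⟩)) (T := 2 + (2 + 60 * D.size)) (by omega) fun s' ⟨hf, ho⟩ => ?_
    · simp only [Expr.eval]; unfold size at hW; omega
    · simpa [Expr.eval] using hcW
    · exact hge
    · have e2 : s'.reg 2 = 1 := (hf.reg 2 rfl).trans (by simp [Expr.eval])
      have e3 : s'.reg 3 = D.count (s.arr 13) := (hf.reg 3 rfl).trans (by simpa [Expr.eval] using hc)
      refine ⟨e2.le, fun _ => ⟨s.arr 13, h4, e3.symm, ho⟩, fun ν hν hS => ⟨by omega, ?_⟩⟩
      rw [e3]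
      rcases hS with hS | hE
      · have := hb.best ν hν hS
        omega
      · exact h5 ν hE
  · simp only [Test.holds, Expr.eval] at h
    refine ⟨hb.found, hb.sound, fun ν hν hS => ?_⟩
    rcases hS with hS | hE
    · exact hb.best ν hν hS
    · have h2 : s.reg 7 = 0 := by
        by_contra h2
        exact h1 h2 ν hE
      have := (h0 h2).2 ν hE
      have h3 := not_or.1 (fun h3 => h ⟨h2, h3⟩)
      exact ⟨h3.1, by omega⟩
  · simp [Test.cost, Expr.cost]; omega

/-- The clause `bound` serves twice: after a failure it excludes extensions, after a success it
makes the result a largest one. Array `14` holds both the cuts and the search positions, which is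
harmless because the cuts of LQ resources stay at their assigned positions. -/
theorem extend_runs {D : Layout} {W e : ℕ} {s : State} {S : (ℕ → ℕ) → Prop} (hs : D.Input s)
    (hW : D.size ≤ W) (hr : D.IsRank (s.arr 6)) (hσ : D.Assigned (s.arr 14) (s.arr 12))
    (hb : D.Best (s.arr 6) e S s) :
    Runs W (extend e) s (800 * D.size) fun s' =>
      (∀ b < D.nB, 0 < D.low b → s'.arr 14 b = s.arr 14 b) ∧
      D.Best (s.arr 6) e (fun ν => S ν ∨ D.Ext (s.arr 6) e (s.arr 14) ν) s' := by
  refine Runs.imp (.seq ((copyOffsets_runs (by norm_num) hs hW).frame.imp le_rfl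
    fun s1 ⟨hf1, h1⟩ => .seq ((resetCuts_runs (hs.frame hf1) hW).frame.imp le_rfl
    fun s2 ⟨hf2, h2⟩ => .seq (Prog.wp_sound (p := .set 7 (.lit 0)) ⟨Nat.zero_le _, .seq (T := 100 * D.size)
      (T' := 400 * D.size + (50 * D.size + (30 + 60 * D.size))) ?_⟩)))) ?_ fun s' h => h
  · have e2 : ∀ r, r ≠ 9 → s2.reg r = s.reg r := fun r hr =>
      (hf2.reg r (by simpa [resetCuts, Prog.writesReg] using hr)).trans
        (hf1.reg r (by simpa [copyOffsets, Prog.writesReg] using hr))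
    have e3 : ∀ k, k ≠ 13 → k ≠ 14 → k ≠ 15 → s2.arr k = s.arr k := fun k hk hk' hk'' =>
      (hf2.arr k (by simp [resetCuts, Prog.writesArr, hk', hk''])).trans
        (hf1.arr k (by simpa [copyOffsets, Prog.writesArr] using hk))
    have e13 : s2.arr 13 = s1.arr 13 := hf2.arr 13 rfl
    have e14 : s1.arr 14 = s.arr 14 := hf1.arr 14 rfl
    rw [e14] at h2
    have hs3 : D.Input (s2.setReg 7 (Expr.eval s2 (.lit 0))) :=
      ((hs.frame hf1).frame hf2).setReg (by simp)
    set s3 := s2.setReg 7 (Expr.eval s2 (.lit 0)) with hs3'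
    have a6 : s3.arr 6 = s.arr 6 := e3 6 (by simp) (by simp) (by simp)
    have a12 : s3.arr 12 = s.arr 12 := e3 12 (by simp) (by simp) (by simp)
    have a5 : s3.arr 5 = s.arr 5 := e3 5 (by simp) (by simp) (by simp)
    have r2 : s3.reg 2 = s.reg 2 := by simp [hs3', e2]
    have r3 : s3.reg 3 = s.reg 3 := by simp [hs3', e2]
    have hinit := DAInv.init (e := e) (nxt := s3.arr 13) (cut := s3.arr 14) (held := s3.arr 15) hr hσ
      (by simpa [hs3', e13] using h1) (fun b _ => h2.1 b) h2.2.1 h2.2.2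
    refine (walk_runs (σ := s.arr 14) hs3 hW (a6 ▸ hr) (a12 ▸ hσ) (by rw [a6, a12]; exact hinit)
      h2.2.2).frame.imp le_rfl fun s4 ⟨hf4, h4⟩ => .seq ?_
    have b6 : s4.arr 6 = s.arr 6 := (hf4.arr 6 rfl).trans a6
    have b12 : s4.arr 12 = s.arr 12 := (hf4.arr 12 rfl).trans a12
    refine (propose_runs (e := e) (σ := s.arr 14) (hs3.frame hf4) hW (b6 ▸ hr) (b12 ▸ hσ)
      (by rw [a6, a12] at h4; rw [b6, b12]; exact h4)).frame.imp le_rfl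
      fun s5 ⟨hf5, settled, hset, h5⟩ => .seq ?_
    refine (countMatched_runs ((hs3.frame hf4).frame hf5) hW).frame.imp le_rfl
      fun s6 ⟨hf6, h6⟩ => ?_
    rw [b6, b12] at h5
    have c : ∀ k, k ≠ 13 → k ≠ 14 → k ≠ 15 → s6.arr k = s3.arr k := fun k h13 h14 h15 =>
      (hf6.arr k rfl).trans <| (hf5.arr k (by simp [propose, Prog.writesArr, h13, h14, h15])).trans
        (hf4.arr k (by simp [walk, Prog.writesArr, h13, h14]))
    have c13 : s6.arr 13 = s5.arr 13 := hf6.arr 13 rfl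
    have c14 : s6.arr 14 = s5.arr 14 := hf6.arr 14 rfl
    have c7 : s6.reg 7 = s5.reg 7 := hf6.reg 7 rfl
    have c2 : s6.reg 2 = s.reg 2 :=
      (hf6.reg 2 rfl).trans <| (hf5.reg 2 rfl).trans <| (hf4.reg 2 rfl).trans r2
    have c3 : s6.reg 3 = s.reg 3 :=
      (hf6.reg 3 rfl).trans <| (hf5.reg 3 rfl).trans <| (hf4.reg 3 rfl).trans r3
    have c5 : s6.arr 5 = s.arr 5 := (c 5 (by simp) (by simp) (by simp)).trans a5
    refine (record_runs (rk := s.arr 6) (e := e) (S := S) (E := D.Ext (s.arr 6) e (s.arr 14))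
      (((hs3.frame hf4).frame hf5).frame hf6) hW (by rw [c13]; exact h5.ge) (by rw [c13]; exact h6)
      (fun h0 => ?_) (fun h0 ν hν => h0 (c7.trans (h5.bound ν hν).1))
      ⟨c2 ▸ hb.found, by rw [c2, c3, c5]; exact hb.sound, by rw [c2, c3]; exact hb.best⟩).frame.imp
      le_rfl fun s7 ⟨hf7, h7⟩ => ⟨fun b hb' hl => ?_, h7⟩
    · rw [c7] at h0
      rw [h0] at h5
      rw [c13]
      exact ⟨(h5.ext hr hσ hset).toAdm, fun ν hν => count_le_of_le (h5.bound ν hν).2⟩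
    · rw [hf7.arr 14 rfl, c14]
      exact h5.cut_lq b hb' hl
  · simp [Prog.bound, Expr.cost]
    have : 1 ≤ D.size := by unfold size; omega
    omega

end LQMatching

namespace LQMatching
open Layout

/-! ### Backtracking over the assignments of the LQ resources -/

namespace Layout

variable (D : Layout)

/-- In the search, agents are assigned to the first `k` LQ resources of the list `L`, at the positions
given by `cut`; for `k < q` the resource `L k` is at its current candidate. -/
structure Search (L : ℕ → ℕ) (q k : ℕ) (cut used : ℕ → ℕ) : Prop where
  le : k ≤ q
  chosen : ∀ j < k, D.offB (L j) ≤ cut (L j) ∧ cut (L j) < D.offB (L j + 1) ∧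
    used (D.tgtB (cut (L j))) = L j + 1
  used : ∀ a < D.nA, used a ≠ 0 → ∃ j < k, D.tgtB (cut (L j)) = a ∧ used a = L j + 1
  current : k < q → D.offB (L k) ≤ cut (L k) ∧ cut (L k) ≤ D.offB (L k + 1)

/-- The matching `ν` agrees with the search below level `j`, and is at least `d` positions ahead of it
at level `j`. -/
def AheadAt (rk L : ℕ → ℕ) (q : ℕ) (ν cut : ℕ → ℕ) (j d : ℕ) : Prop :=
  (∀ i < j, ∃ a, D.Mat ν a (L i) ∧ rk (ν a) = cut (L i)) ∧
    (j < q → ∃ a, D.Mat ν a (L j) ∧ cut (L j) + d ≤ rk (ν a))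

/-- The matching `ν` will be met later by the search at level `k`, after level `k` is exhausted. -/
def AheadBelow (rk L : ℕ → ℕ) (q : ℕ) (ν cut : ℕ → ℕ) (k : ℕ) : Prop :=
  ∃ j < k, D.AheadAt rk L q ν cut j 1

/-- The matching `ν` has not yet been met by the search at level `k`. -/
def Ahead (rk L : ℕ → ℕ) (q : ℕ) (ν cut : ℕ → ℕ) (k : ℕ) : Prop :=
  D.AheadBelow rk L q ν cut k ∨ D.AheadAt rk L q ν cut k 0

variable {D}
variable {rk L cut cut' used used' ν : ℕ → ℕ} {e q k : ℕ}

theorem AheadAt.congr {j d : ℕ} (h : D.AheadAt rk L q ν cut j d)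
    (hc : ∀ i, i ≤ j → i < q → cut' (L i) = cut (L i)) (hj : j ≤ q) :
    D.AheadAt rk L q ν cut' j d := by
  refine ⟨fun i hi => ?_, fun hq => ?_⟩
  · rw [hc i hi.le (by omega)]; exact h.1 i hi
  · rw [hc j le_rfl hq]; exact h.2 hq

theorem Search.descend (hL : D.ListsLQ D.nB q L) (h : D.Search L q k cut used) (hk : k < q)
    (hlt : cut (L k) < D.offB (L k + 1)) (hu : used (D.tgtB (cut (L k))) = 0)
    (hc : ∀ j ≤ k, cut' (L j) = cut (L j)) (hc' : k + 1 < q → cut' (L (k + 1)) = D.offB (L (k + 1))) :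
    D.Search L q (k + 1) cut' (Function.update used (D.tgtB (cut (L k))) (L k + 1)) := by
  refine ⟨hk, fun j hj => ?_, fun a ha hua => ?_, fun hk' => ?_⟩
  · rw [hc j (by omega)]
    by_cases hjk : j = k
    · subst hjk
      exact ⟨(h.current hk).1, hlt, Function.update_self ..⟩
    · obtain ⟨h1, h2, h3⟩ := h.chosen j (by omega)
      refine ⟨h1, h2, ?_⟩
      rw [Function.update_of_ne fun h4 => ?_, h3]
      rw [h4, hu] at h3
      omega
  · by_cases hak : a = D.tgtB (cut (L k))
    · subst hak
      exact ⟨k, by omega, by rw [hc k le_rfl], Function.update_self ..⟩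
    · rw [Function.update_of_ne hak] at hua ⊢
      obtain ⟨j, hj, h1, h2⟩ := h.used a ha hua
      exact ⟨j, by omega, by rw [hc j (by omega)]; exact h1, h2⟩
  · rw [hc' hk']
    exact ⟨le_rfl, D.offB_le _ (hL.lt _ hk')⟩

/-- If `ν` has the current candidate at level `k`, it is met inside the subtree, whose next level
starts at the top of a list; feasibility provides a partner there. If its partner at level `k` comes
later, it is met after the subtree. -/
theorem Ahead.descend (hr : D.IsRank rk) (hL : D.ListsLQ D.nB q L) (hν : D.Adm rk e ν)
    (h : D.Ahead rk L q ν cut k) (hk : k < q)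
    (hc : ∀ j ≤ k, cut' (L j) = cut (L j)) (hc' : k + 1 < q → cut' (L (k + 1)) = D.offB (L (k + 1))) :
    D.Ahead rk L q ν cut' (k + 1) := by
  rcases h with ⟨j, hj, h⟩ | h
  · exact .inl ⟨j, by omega, h.congr (fun i hi _ => hc i (by omega)) (by omega)⟩
  · have h' : D.AheadAt rk L q ν cut' k 0 := h.congr (fun i hi _ => hc i (by omega)) (by omega)
    obtain ⟨a, h1, h2⟩ := h'.2 hk
    by_cases heq : rk (ν a) = cut' (L k)
    · refine .inr ⟨fun i hi => ?_, fun hk' => ?_⟩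
      · by_cases hik : i = k
        · subst hik; exact ⟨a, h1, heq⟩
        · exact h'.1 i (by omega)
      · obtain ⟨a', ha'⟩ := hν.feas _ (hL.lt _ hk') (hL.low _ hk')
        exact ⟨a', ha', by rw [hc' hk']; exact (hr.mat hν.ge ha').1⟩
    · exact .inl ⟨k, by omega, h'.1, fun _ => ⟨a, h1, by omega⟩⟩

theorem Search.skip (hL : D.ListsLQ D.nB q L) (h : D.Search L q k cut used) (hk : k < q)
    (hlt : cut (L k) < D.offB (L k + 1)) :
    D.Search L q k (Function.update cut (L k) (cut (L k) + 1)) used := by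
  have hc : ∀ j < k, Function.update cut (L k) (cut (L k) + 1) (L j) = cut (L j) := fun j hj =>
    Function.update_of_ne (fun h => by have := hL.inj j (by omega) k hk h; omega) _ _
  refine ⟨h.le, fun j hj => ?_, fun a ha hua => ?_, fun _ => ?_⟩
  · rw [hc j hj]; exact h.chosen j hj
  · obtain ⟨j, hj, h1⟩ := h.used a ha hua
    exact ⟨j, hj, by rw [hc j hj]; exact h1⟩
  · rw [Function.update_self]
    have := (h.current hk).1
    omega

/-- A used candidate is matched by `ν` to the LQ resource of an earlier level, hence not to that of
level `k`, and nothing is lost by skipping it. -/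
theorem Ahead.skip (hr : D.IsRank rk) (hL : D.ListsLQ D.nB q L) (hν : D.Adm rk e ν)
    (hs : D.Search L q k cut used) (h : D.Ahead rk L q ν cut k) (hk : k < q)
    (hu : used (D.tgtB (cut (L k))) ≠ 0) :
    D.Ahead rk L q ν (Function.update cut (L k) (cut (L k) + 1)) k := by
  have hc : ∀ j < k, Function.update cut (L k) (cut (L k) + 1) (L j) = cut (L j) := fun j hj =>
    Function.update_of_ne (fun h => by have := hL.inj j (by omega) k hk h; omega) _ _
  rcases h with ⟨j, hj, h⟩ | h
  · exact .inl ⟨j, hj, h.congr (fun i hi _ => hc i (by omega)) (by omega)⟩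
  · obtain ⟨a, h1, h2⟩ := h.2 hk
    refine .inr ⟨fun i hi => by rw [hc i hi]; exact h.1 i hi, fun _ => ⟨a, h1, ?_⟩⟩
    rw [Function.update_self]
    have hne : rk (ν a) ≠ cut (L k) := fun heq => by
      have h3 := (hr.mat hν.ge h1).2.2
      rw [heq] at h3
      rw [h3] at hu
      obtain ⟨j, hj, h4, _⟩ := hs.used a h1.1 hu
      obtain ⟨a', h5, h6⟩ := h.1 j hj
      have h7 := (hr.mat hν.ge h5).2.2
      rw [h6, h4] at h7
      subst h7
      have := hL.inj j (by omega) k hk (h5.2.2.symm.trans h1.2.2)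
      omega
    omega

theorem Search.up (hL : D.ListsLQ D.nB q L) (h : D.Search L q (k + 1) cut used) :
    D.Search L q k (Function.update cut (L k) (cut (L k) + 1))
      (Function.update used (D.tgtB (cut (L k))) 0) := by
  have hk := h.le
  have hc : ∀ j < k, Function.update cut (L k) (cut (L k) + 1) (L j) = cut (L j) := fun j hj =>
    Function.update_of_ne (fun h => by have := hL.inj j (by omega) k hk h; omega) _ _
  obtain ⟨h1, h2, h3⟩ := h.chosen k (by omega)
  refine ⟨by omega, fun j hj => ?_, fun a ha hua => ?_, fun _ => ?_⟩
  · rw [hc j hj]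
    obtain ⟨h4, h5, h6⟩ := h.chosen j (by omega)
    refine ⟨h4, h5, ?_⟩
    rw [Function.update_of_ne fun h7 => ?_, h6]
    rw [h7, h3] at h6
    have := hL.inj j (by omega) k hk (by omega)
    omega
  · have hne : a ≠ D.tgtB (cut (L k)) := fun h4 => hua (by rw [h4, Function.update_self])
    rw [Function.update_of_ne hne] at hua ⊢
    obtain ⟨j, hj, h4, h5⟩ := h.used a ha hua
    have hjk : j ≠ k := fun h6 => hne (by rw [← h4, h6])
    exact ⟨j, by omega, by rw [hc j (by omega)]; exact h4, h5⟩
  · rw [Function.update_self]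
    omega

/-- If `ν` first departs from the search at level `k`, it is at least one position ahead there,
which is what the increment consumes. -/
theorem AheadBelow.up (hL : D.ListsLQ D.nB q L) (h : D.AheadBelow rk L q ν cut (k + 1)) (hk : k < q) :
    D.Ahead rk L q ν (Function.update cut (L k) (cut (L k) + 1)) k := by
  have hc : ∀ j < k, Function.update cut (L k) (cut (L k) + 1) (L j) = cut (L j) := fun j hj =>
    Function.update_of_ne (fun h => by have := hL.inj j (by omega) k hk h; omega) _ _
  obtain ⟨j, hj, h⟩ := h
  by_cases hjk : j = k
  · subst hjk
    obtain ⟨a, h1, h2⟩ := h.2 hk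
    exact .inr ⟨fun i hi => by rw [hc i hi]; exact h.1 i hi,
      fun _ => ⟨a, h1, by rw [Function.update_self]; exact h2⟩⟩
  · exact .inl ⟨j, by omega, h.congr (fun i hi _ => hc i (by omega)) (by omega)⟩

theorem AheadAt.false_of_end (hr : D.IsRank rk) (hν : D.Adm rk e ν) (hk : k < q)
    (hend : D.offB (L k + 1) ≤ cut (L k)) : ¬ D.AheadAt rk L q ν cut k 0 := fun h => by
  obtain ⟨a, h1, h2⟩ := h.2 hk
  have := (hr.mat hν.ge h1).2.1
  omega

theorem Search.assigned (hL : D.ListsLQ D.nB q L) (h : D.Search L q q cut used) :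
    D.Assigned cut used := by
  refine ⟨fun b hb hl => ?_, fun a ha hu => ?_⟩
  · obtain ⟨j, hj, rfl⟩ := hL.surj b hb hl
    exact h.chosen j hj
  · obtain ⟨j, hj, h1, h2⟩ := h.used a ha hu
    exact ⟨L j, hL.lt j hj, h2, hL.low j hj, h1⟩

/-- At a leaf every LQ resource belongs to a level below `q`, so agreement on those levels is
agreement with the whole assignment. -/
theorem AheadAt.ext (hL : D.ListsLQ D.nB q L) (hν : D.Adm rk e ν) (h : D.AheadAt rk L q ν cut q 0) :
    D.Ext rk e cut ν := by
  refine ⟨hν, fun a b hm hl => ?_⟩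
  obtain ⟨j, hj, rfl⟩ := hL.surj b (hm.lt_nB hν.ge) hl
  obtain ⟨a', h1, h2⟩ := h.1 j hj
  rw [hν.inj _ _ _ hm h1, h2]

theorem Search.congr (h : D.Search L q k cut used) (hc : ∀ j < q, cut' (L j) = cut (L j)) :
    D.Search L q k cut' used := by
  have hk := h.le
  refine ⟨h.le, fun j hj => ?_, fun a ha hu => ?_, fun hk => ?_⟩
  · rw [hc j (by omega)]; exact h.chosen j hj
  · obtain ⟨j, hj, h1⟩ := h.used a ha hu
    exact ⟨j, hj, by rw [hc j (by omega)]; exact h1⟩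
  · rw [hc k hk]; exact h.current hk

theorem Best.imp {S S' : (ℕ → ℕ) → Prop} {s s' : State} (h : D.Best rk e S s)
    (hS : ∀ ν, D.Adm rk e ν → S' ν → S ν) (h2 : s'.reg 2 = s.reg 2) (h3 : s'.reg 3 = s.reg 3)
    (h5 : s'.arr 5 = s.arr 5) : D.Best rk e S' s' :=
  ⟨by rw [h2]; exact h.found, by rw [h2, h3, h5]; exact h.sound,
    by rw [h2, h3]; exact fun ν hν hS' => h.best ν hν (hS ν hν hS')⟩

/-! ### Counting the children of a node -/

/-- The number of unassigned agents in the list of `b`, from position `x` on. -/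
def free (D : Layout) (used : ℕ → ℕ) (b x : ℕ) : ℕ :=
  ((Finset.Ico x (D.offB (b + 1))).filter fun y => used (D.tgtB y) = 0).card

theorem free_eq_add {b x : ℕ} (hx : x < D.offB (b + 1)) :
    D.free used b x = D.free used b (x + 1) + if used (D.tgtB x) = 0 then 1 else 0 := by
  unfold free
  rw [← Finset.insert_Ico_add_one_left_eq_Ico hx, Finset.filter_insert]
  split_ifs with h
  · rw [Finset.card_insert_of_notMem (by simp)]
  · rfl

theorem free_congr {b x : ℕ} (hb : b < D.nB) (hx : D.offB b ≤ x) (h : ∀ a < D.nA, used' a = used a) :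
    D.free used' b x = D.free used b x := by
  unfold free
  congr 1
  refine Finset.filter_congr fun y hy => ?_
  obtain ⟨h1, h2⟩ := Finset.mem_Ico.1 hy
  rw [h _ (D.tgtB_lt b hb y (hx.trans h1) h2)]

/-- The free candidates at level `k` and the `k` agents already assigned form disjoint sets of
agents acceptable to LQ resources. This is the source of the factorial bound. -/
theorem Search.free_add_le (hL : D.ListsLQ D.nB q L) (h : D.Search L q k cut used) (hk : k < q)
    {Abar : Finset ℕ}
    (hA : ∀ b < D.nB, 0 < D.low b → ∀ y, D.offB b ≤ y → y < D.offB (b + 1) → D.tgtB y ∈ Abar) :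
    D.free used (L k) (D.offB (L k)) + k ≤ Abar.card := by
  classical
  set S := (Finset.Ico (D.offB (L k)) (D.offB (L k + 1))).filter fun y => used (D.tgtB y) = 0
  have h1 : (S.image D.tgtB).card = D.free used (L k) (D.offB (L k)) := by
    refine Finset.card_image_of_injOn fun y hy y' hy' hyy => ?_
    have hy1 := Finset.mem_Ico.1 (Finset.mem_filter.1 hy).1
    have hy2 := Finset.mem_Ico.1 (Finset.mem_filter.1 hy').1
    exact D.tgtB_inj _ (hL.lt k hk) _ _ hy1.1 hy1.2 hy2.1 hy2.2 hyy
  have h2 : ((Finset.range k).image fun j => D.tgtB (cut (L j))).card = k := by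
    rw [Finset.card_image_of_injOn, Finset.card_range]
    intro j hj j' hj' hjj
    simp only [Finset.coe_range, Set.mem_Iio] at hj hj'
    have h3 := (h.chosen j hj).2.2
    have h4 := (h.chosen j' hj').2.2
    simp only at hjj
    rw [hjj] at h3
    exact hL.inj j (by omega) j' (by omega) (by omega)
  rw [← h1]
  conv_lhs => rw [← h2]
  rw [← Finset.card_union_of_disjoint]
  · refine Finset.card_le_card fun a ha => ?_
    rcases Finset.mem_union.1 ha with ha | ha
    · obtain ⟨y, hy, rfl⟩ := Finset.mem_image.1 ha
      have hy1 := Finset.mem_Ico.1 (Finset.mem_filter.1 hy).1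
      exact hA _ (hL.lt k hk) (hL.low k hk) y hy1.1 hy1.2
    · obtain ⟨j, hj, rfl⟩ := Finset.mem_image.1 ha
      have hj := Finset.mem_range.1 hj
      obtain ⟨h3, h4, _⟩ := h.chosen j hj
      exact hA _ (hL.lt j (by omega)) (hL.low j (by omega)) _ h3 h4
  · rw [Finset.disjoint_left]
    intro a ha ha'
    obtain ⟨y, hy, rfl⟩ := Finset.mem_image.1 ha
    obtain ⟨j, hj, hj'⟩ := Finset.mem_image.1 ha'
    have h3 := (h.chosen j (Finset.mem_range.1 hj)).2.2
    rw [hj', (Finset.mem_filter.1 hy).2] at h3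
    omega

theorem free_le {b x : ℕ} : D.free used b x ≤ D.offB (b + 1) - x := by
  refine (Finset.card_le_card (Finset.filter_subset _ _)).trans ?_
  rw [Nat.card_Ico]

end Layout
end LQMatching

namespace LQMatching
open Layout

/-! ### The search as a program -/

/-- The LQ resource at the current level of the search. -/
abbrev curRes : Expr := .get 11 (.reg 5)

/-- The agent at the current position in the list of the current LQ resource. -/
abbrev curAgent : Expr := .get 3 (.get 14 curRes)

/-- Return to the previous level of the search. -/
def retreat : Prog :=
  .branch (.eq (.reg 5) (.lit 0)) (.set 6 (.lit 1))
    (.seq (.set 5 (.sub (.reg 5) (.lit 1)))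
      (.seq (.put 12 curAgent (.lit 0)) (.put 14 curRes (.add (.get 14 curRes) (.lit 1)))))

/-- Process the current candidate for the current LQ resource. -/
def advance : Prog :=
  .branch (.lt (.get 14 curRes) (.get 2 (.add curRes (.lit 1))))
    (.branch (.eq (.get 12 curAgent) (.lit 0))
      (.seq (.put 12 curAgent (.add curRes (.lit 1)))
        (.seq (incr 5)
          (.branch (.lt (.reg 5) (.reg 4)) (.put 14 curRes (.get 2 curRes)) .skip)))
      (.put 14 curRes (.add (.get 14 curRes) (.lit 1))))
    retreat

/-- One step of the search. -/
def searchStep (e : ℕ) : Prog :=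
  .branch (.lt (.reg 5) (.reg 4)) advance (.seq (extend e) retreat)

/-- The search is not finished. -/
abbrev searching : Test := .eq (.reg 6) (.lit 0)

/-- Search through all assignments of agents to the LQ resources. -/
def search (e : ℕ) : Prog :=
  .seq (.set 5 (.lit 0)) (.seq (.set 6 (.lit 0))
    (.seq (.branch (.lt (.reg 5) (.reg 4)) (.put 14 curRes (.get 2 curRes)) .skip)
      (.loop searching (searchStep e))))

namespace Layout

variable (D : Layout)

/-- The state of the program during the search, at level `k`. -/
structure SearchData (rk L : ℕ → ℕ) (q k : ℕ) (s : State) : Prop where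
  input : D.Input s
  rank : s.arr 6 = rk
  list : s.arr 11 = L
  reg4 : s.reg 4 = q
  reg5 : s.reg 5 = k
  reg6 : s.reg 6 = 0
  search : D.Search L q k (s.arr 14) (s.arr 12)

/-- The state `s'` results from exhausting level `k` of the search, started in `s`. -/
def Exhausted (rk L : ℕ → ℕ) (e q : ℕ) : ℕ → State → State → Prop
  | 0, _, s' => s'.reg 6 = 1 ∧ D.Best rk e (fun _ => True) s'
  | k + 1, s, s' => D.SearchData rk L q k s' ∧
      D.Best rk e (fun ν => ¬ D.Ahead rk L q ν (s'.arr 14) k) s' ∧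
      (∀ j < k, s'.arr 14 (L j) = s.arr 14 (L j)) ∧ s'.arr 14 (L k) = s.arr 14 (L k) + 1 ∧
      ∀ a < D.nA, s'.arr 12 a = if a = D.tgtB (s.arr 14 (L k)) then 0 else s.arr 12 a

variable {D}
variable {rk L : ℕ → ℕ} {W e q k : ℕ} {s s' s'' : State}

theorem Exhausted.of_eq (h : D.Exhausted rk L e q k s' s'')
    (hc : ∀ j < k, s'.arr 14 (L j) = s.arr 14 (L j)) (hu : ∀ a < D.nA, s'.arr 12 a = s.arr 12 a) :
    D.Exhausted rk L e q k s s'' := by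
  cases k with
  | zero => exact h
  | succ k =>
    obtain ⟨h1, h2, h3, h4, h5⟩ := h
    refine ⟨h1, h2, fun j hj => by rw [h3 j hj, hc j (by omega)], by rw [h4, hc k (by omega)],
      fun a ha => by rw [h5 a ha, hu a ha, hc k (by omega)]⟩

/-- Returning to a level frees its agent and advances its candidate. At level `0` nothing can be
ahead below, so the record is best among all matchings. -/
theorem retreat_wp (hL : D.ListsLQ D.nB q L) (hW : D.size ≤ W) (h : D.SearchData rk L q k s)
    (hb : D.Best rk e (fun ν => ¬ D.AheadBelow rk L q ν (s.arr 14) k) s) :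
    retreat.wp W s (D.Exhausted rk L e q k s) := by
  unfold size at hW
  have hk := h.search.le
  simp only [retreat, Prog.wp, Test.holds, Expr.eval, State.setArr_reg, State.setReg_reg,
    State.setReg_arr, State.setArr_arr, Nat.reduceEqDiff, reduceIte, h.reg5, h.list, h.input.arr3]
  refine ⟨fun h0 => ⟨by omega, ?_⟩, fun h0 => ?_⟩
  · subst h0
    refine ⟨by simp, hb.imp (fun ν _ _ => ?_) (by simp) (by simp) (by simp)⟩
    rintro ⟨j, hj, _⟩
    omega
  · obtain ⟨k, rfl⟩ : ∃ k', k = k' + 1 := ⟨k - 1, by omega⟩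
    simp only [Nat.add_sub_cancel]
    have hb' := hL.lt k hk
    obtain ⟨h1, h2, h3⟩ := h.search.chosen k (by omega)
    have h4 := D.tgtB_lt _ hb' _ h1 h2
    have h5 := D.offB_le_m (i := L k + 1) hb'
    have hs := h.search.up hL
    have hqB := hL.le
    refine ⟨by omega, by omega, by omega, by omega, by omega, ⟨((h.input.setReg (by simp)).setArr
      (by simp)).setArr (by simp), ?_, ?_, ?_, ?_, ?_, ?_⟩, hb.imp (fun ν _ h6 h7 => h6 ?_) ?_ ?_ ?_,
      fun j hj => ?_, ?_, fun a ha => ?_⟩ <;>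
      simp only [State.setArr_reg, State.setReg_reg, State.setReg_arr, State.setArr_arr,
        Nat.reduceEqDiff, reduceIte, h.rank, h.list, h.reg4, h.reg6]
    · exact hs
    · exact h7.up hL hk
    · exact Function.update_of_ne (fun h8 => by have := hL.inj j (by omega) k hk h8; omega) _ _
    · exact Function.update_self ..
    · rw [Function.update_apply]

theorem advance_wp_end (hL : D.ListsLQ D.nB q L) (hW : D.size ≤ W) (hr : D.IsRank rk)
    (h : D.SearchData rk L q k s) (hb : D.Best rk e (fun ν => ¬ D.Ahead rk L q ν (s.arr 14) k) s)
    (hk : k < q) (hend : ¬ s.arr 14 (L k) < D.offB (L k + 1)) :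
    advance.wp W s (D.Exhausted rk L e q k s) := by
  have h0 : D.Best rk e (fun ν => ¬ D.AheadBelow rk L q ν (s.arr 14) k) s :=
    hb.imp (fun ν hν h1 h2 => h1 (h2.resolve_right (AheadAt.false_of_end hr hν hk (by omega))))
      rfl rfl rfl
  refine ⟨fun h1 => absurd ?_ hend, fun _ => retreat_wp hL hW h h0⟩
  simpa only [Test.holds, Expr.eval, h.reg5, h.list, h.input.arr2] using h1

theorem advance_wp_skip (hL : D.ListsLQ D.nB q L) (hW : D.size ≤ W) (hr : D.IsRank rk)
    (h : D.SearchData rk L q k s) (hb : D.Best rk e (fun ν => ¬ D.Ahead rk L q ν (s.arr 14) k) s)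
    (hk : k < q) (hlt : s.arr 14 (L k) < D.offB (L k + 1))
    (hu : s.arr 12 (D.tgtB (s.arr 14 (L k))) ≠ 0) :
    advance.wp W s fun s' => D.SearchData rk L q k s' ∧
      D.Best rk e (fun ν => ¬ D.Ahead rk L q ν (s'.arr 14) k) s' ∧
      s'.arr 14 = Function.update (s.arr 14) (L k) (s.arr 14 (L k) + 1) ∧
      s'.arr 12 = s.arr 12 := by
  unfold size at hW
  have hb' := hL.lt k hk
  have h5 := D.offB_le_m (i := L k + 1) hb'
  simp only [advance, Prog.wp, Test.holds, Expr.eval, State.setArr_reg,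
    State.setArr_arr, Nat.reduceEqDiff, reduceIte, h.reg5, h.list, h.input.arr2, h.input.arr3]
  refine ⟨fun _ => ⟨fun h1 => absurd h1 hu, fun _ => ⟨by omega, by omega, ⟨h.input.setArr (by simp),
    ?_, ?_, ?_, ?_, ?_, ?_⟩, hb.imp (fun ν hν h6 h7 => h6 ?_) rfl rfl ?_, trivial, trivial⟩⟩,
    fun h1 => absurd hlt h1⟩ <;>
    try simp only [State.setArr_reg, State.setArr_arr, Nat.reduceEqDiff, reduceIte, h.rank, h.list,
      h.reg4, h.reg5, h.reg6]
  · exact h.search.skip hL hk hlt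
  · exact h7.skip hr hL hν h.search hk hu

theorem advance_wp_descend (hL : D.ListsLQ D.nB q L) (hW : D.size ≤ W) (hr : D.IsRank rk)
    (h : D.SearchData rk L q k s) (hb : D.Best rk e (fun ν => ¬ D.Ahead rk L q ν (s.arr 14) k) s)
    (hk : k < q) (hlt : s.arr 14 (L k) < D.offB (L k + 1))
    (hu : s.arr 12 (D.tgtB (s.arr 14 (L k))) = 0) :
    advance.wp W s fun s' => D.SearchData rk L q (k + 1) s' ∧
      D.Best rk e (fun ν => ¬ D.Ahead rk L q ν (s'.arr 14) (k + 1)) s' ∧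
      (∀ j ≤ k, s'.arr 14 (L j) = s.arr 14 (L j)) ∧
      (k + 1 < q → s'.arr 14 (L (k + 1)) = D.offB (L (k + 1))) ∧
      s'.arr 12 = Function.update (s.arr 12) (D.tgtB (s.arr 14 (L k))) (L k + 1) := by
  have hqB := hL.le
  unfold size at hW
  have hb' := hL.lt k hk
  have h5 := D.offB_le_m (i := L k + 1) hb'
  have h6 := D.tgtB_lt _ hb' _ (h.search.current hk).1 hlt
  simp only [advance, Prog.wp, Test.holds, Expr.eval, State.setArr_reg, State.setReg_reg,
    State.setReg_arr, State.setArr_arr, Nat.reduceEqDiff, reduceIte, h.reg4, h.reg5, h.list,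
    h.input.arr2, h.input.arr3]
  refine ⟨fun _ => ⟨fun _ => ⟨by omega, by omega, by omega, fun h1 => ?_, fun h1 => ?_⟩,
    fun h1 => absurd hu h1⟩, fun h1 => absurd hlt h1⟩
  · have h7 := hL.lt _ h1
    have h8 := D.offB_le_m (i := L (k + 1)) h7.le
    have hc : ∀ j ≤ k, Function.update (s.arr 14) (L (k + 1)) (D.offB (L (k + 1))) (L j) =
        s.arr 14 (L j) := fun j hj =>
      Function.update_of_ne (fun h => by have := hL.inj j (by omega) _ h1 h; omega) _ _
    have hc' : k + 1 < q → Function.update (s.arr 14) (L (k + 1)) (D.offB (L (k + 1))) (L (k + 1)) =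
        D.offB (L (k + 1)) := fun _ => Function.update_self ..
    refine ⟨by omega, by omega, ⟨((h.input.setArr (by simp)).setReg (by simp)).setArr (by simp),
      ?_, ?_, ?_, ?_, ?_, ?_⟩, hb.imp (fun ν hν h9 h10 => h9 ?_) rfl rfl ?_, hc, hc', trivial⟩ <;>
      try simp only [State.setArr_reg, State.setReg_reg, State.setReg_arr, State.setArr_arr,
        Nat.reduceEqDiff, reduceIte, h.rank, h.list, h.reg4, h.reg5, h.reg6]
    · exact h.search.descend hL hk hlt hu hc hc'
    · exact Ahead.descend hr hL hν h10 hk hc hc'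
  · have hc : ∀ j ≤ k, s.arr 14 (L j) = s.arr 14 (L j) := fun _ _ => rfl
    have hc' : k + 1 < q → s.arr 14 (L (k + 1)) = D.offB (L (k + 1)) := fun h => absurd h h1
    refine ⟨⟨(h.input.setArr (by simp)).setReg (by simp),
      ?_, ?_, ?_, ?_, ?_, ?_⟩, hb.imp (fun ν hν h9 h10 => h9 ?_) rfl rfl ?_, fun _ _ => trivial, hc', trivial⟩ <;>
      try simp only [State.setArr_reg, State.setReg_reg, State.setReg_arr, State.setArr_arr,
        Nat.reduceEqDiff, reduceIte, h.rank, h.list, h.reg4, h.reg5, h.reg6]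
    · exact h.search.descend hL hk hlt hu hc hc'
    · exact Ahead.descend hr hL hν h10 hk hc hc'

/-- The last level of the search. -/
theorem extend_retreat_runs (hL : D.ListsLQ D.nB q L) (hW : D.size ≤ W) (hr : D.IsRank rk)
    (h : D.SearchData rk L q q s) (hb : D.Best rk e (fun ν => ¬ D.Ahead rk L q ν (s.arr 14) q) s) :
    Runs W (.seq (extend e) retreat) s (900 * D.size) (D.Exhausted rk L e q q s) := by
  obtain rfl := h.rank
  refine Runs.imp (.seq ((extend_runs (e := e) h.input hW hr (h.search.assigned hL) hb).frame.imp
    le_rfl fun s1 ⟨hf, h1, h2⟩ => Prog.wp_sound ?_)) ?_ fun s' h => h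
  · have hc : ∀ j < q, s1.arr 14 (L j) = s.arr 14 (L j) := fun j hj =>
      h1 _ (hL.lt j hj) (hL.low j hj)
    have hu : s1.arr 12 = s.arr 12 := hf.arr 12 rfl
    have hd : D.SearchData (s.arr 6) L q q s1 := ⟨h.input.frame hf, hf.arr 6 rfl,
      (hf.arr 11 rfl).trans h.list, (hf.reg 4 rfl).trans h.reg4, (hf.reg 5 rfl).trans h.reg5,
      (hf.reg 6 rfl).trans h.reg6, by rw [hu]; exact h.search.congr hc⟩
    have hr := retreat_wp (e := e) hL hW hd (h2.imp (fun ν hν h3 => ?_) rfl rfl rfl)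
    · refine Prog.wp_imp hr fun s' hs' => hs'.of_eq hc fun a _ => by rw [hu]
    · by_cases h4 : D.Ahead (s.arr 6) L q ν (s.arr 14) q
      · rcases h4 with ⟨j, hj, h4⟩ | h4
        · exact absurd ⟨j, hj, h4.congr (fun i _ hi => hc i hi) hj.le⟩ h3
        · exact .inr (h4.ext hL hν)
      · exact .inl h4
  · simp [Prog.bound, retreat, Expr.cost, Test.cost]
    have : 1 ≤ D.size := by unfold size; omega
    omega

/-! ### The cost of the search tree -/

/-- Exhausting a level of the search takes at most `F k` steps if `F` satisfies the recurrence for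
the number of steps. -/
theorem exists_iterates (hL : D.ListsLQ D.nB q L) (hW : D.size ≤ W) (hr : D.IsRank rk)
    {Abar : Finset ℕ} {l : ℕ} {F : ℕ → ℕ}
    (hA : ∀ b < D.nB, 0 < D.low b → ∀ y, D.offB b ≤ y → y < D.offB (b + 1) → D.tgtB y ∈ Abar)
    (hl : ∀ b < D.nB, 0 < D.low b → D.offB (b + 1) - D.offB b ≤ l)
    (hFq : 1000 * D.size ≤ F q)
    (hF : ∀ k < q, ∀ f, f ≤ l → f + k ≤ Abar.card → 200 * (l + 1) + f * F (k + 1) ≤ F k) :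
    ∀ d k s, k + d = q → D.SearchData rk L q k s →
      D.Best rk e (fun ν => ¬ D.Ahead rk L q ν (s.arr 14) k) s →
      (k < q → s.arr 14 (L k) = D.offB (L k)) →
      ∃ t s', Iterates W searching (searchStep e) s t s' ∧ t ≤ F k ∧ D.Exhausted rk L e q k s s' := by
  intro d
  induction d with
  | zero =>
    intro k s hk h hb _
    obtain rfl : k = q := by omega
    obtain ⟨t, s', he, ht, hx⟩ := extend_retreat_runs hL hW hr h hb
    refine ⟨_, s', .step (by simp [Test.holds, Expr.eval, h.reg6])
      (.branch_false (by simp [Test.holds, Expr.eval, h.reg4, h.reg5]) he) (.refl s'), ?_, hx⟩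
    have : 1 ≤ D.size := by unfold size; omega
    simp [Test.cost, Expr.cost]
    omega
  | succ d ih =>
    intro k s hk h hb hstart
    have hkq : k < q := by omega
    have step : ∀ {s : State} {Q : State → Prop}, D.SearchData rk L q k s → advance.wp W s Q →
        ∃ t s', Iterates W searching (searchStep e) s t s' ∧ t ≤ 200 ∧ Q s' := by
      intro s Q h hQ
      obtain ⟨t, s', he, ht, hq⟩ := Prog.wp_sound hQ
      refine ⟨_, s', .step (by simp [Test.holds, Expr.eval, h.reg6])
        (.branch_true (by simpa [Test.holds, Expr.eval, h.reg4, h.reg5] using hkq) he) (.refl s'), ?_, hq⟩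
      have : advance.bound ≤ 150 := by decide
      simp [Test.cost, Expr.cost]
      omega
    -- Inner induction on the number of remaining candidates: each of them, and the end of the list,
    -- costs one iteration, and each free one a subtree besides.
    have main : ∀ n s, D.offB (L k + 1) - s.arr 14 (L k) = n → D.SearchData rk L q k s →
        D.Best rk e (fun ν => ¬ D.Ahead rk L q ν (s.arr 14) k) s →
        ∃ t s', Iterates W searching (searchStep e) s t s' ∧
          t ≤ 200 * (n + 1) + D.free (s.arr 12) (L k) (s.arr 14 (L k)) * F (k + 1) ∧
          D.Exhausted rk L e q k s s' := by
      intro n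
      induction n with
      | zero =>
        intro s hn h hb
        obtain ⟨t, s', hi, ht, hx⟩ := step h (advance_wp_end hL hW hr h hb hkq (by omega))
        exact ⟨t, s', hi, by omega, hx⟩
      | succ n ihn =>
        intro s hn h hb
        have hlt : s.arr 14 (L k) < D.offB (L k + 1) := by omega
        have hLk := hL.lt k hkq
        have hcur := (h.search.current hkq).1
        rw [free_eq_add hlt]
        by_cases hu : s.arr 12 (D.tgtB (s.arr 14 (L k))) = 0
        · obtain ⟨t, s1, hi, ht, h1, h2, h3, h4, h5⟩ :=
            step h (advance_wp_descend hL hW hr h hb hkq hlt hu)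
          obtain ⟨t', s2, hi', ht', h6, h7, h8, h9, h10⟩ := ih (k + 1) s1 (by omega) h1 h2 h4
          rw [h3 k le_rfl] at h9 h10
          -- The subtree leaves the assignment as it was: the mark set by the descent is reset to
          -- `0`, its former value.
          have hused : ∀ a < D.nA, s2.arr 12 a = s.arr 12 a := fun a ha => by
            rw [h10 a ha, h5, Function.update_apply]
            split_ifs with h11
            · rw [h11, hu]
            · rfl
          have hcut : ∀ j < k, s2.arr 14 (L j) = s.arr 14 (L j) := fun j hj => by
            rw [h8 j hj, h3 j hj.le]
          obtain ⟨t'', s3, hi'', ht'', hx⟩ := ihn s2 (by omega) h6 h7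
          refine ⟨_, s3, (hi.trans hi').trans hi'', ?_, hx.of_eq hcut hused⟩
          rw [h9, free_congr hLk (by omega) hused] at ht''
          rw [if_pos hu, add_mul, one_mul]
          omega
        · obtain ⟨t, s1, hi, ht, h1, h2, h3, h4⟩ :=
            step h (advance_wp_skip hL hW hr h hb hkq hlt hu)
          have h5 : s1.arr 14 (L k) = s.arr 14 (L k) + 1 := by rw [h3, Function.update_self]
          have hcut : ∀ j < k, s1.arr 14 (L j) = s.arr 14 (L j) := fun j hj => by
            rw [h3, Function.update_of_ne fun h => by have := hL.inj j (by omega) k hkq h; omega]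
          obtain ⟨t', s2, hi', ht', hx⟩ := ihn s1 (by omega) h1 h2
          refine ⟨_, s2, hi.trans hi', ?_, hx.of_eq hcut fun a _ => by rw [h4]⟩
          rw [h5, h4] at ht'
          rw [if_neg hu, add_zero]
          omega
    obtain ⟨t, s', hi, ht, hx⟩ := main _ s rfl h hb
    refine ⟨t, s', hi, ht.trans ?_, hx⟩
    rw [hstart hkq]
    have h1 := hl _ (hL.lt k hkq) (hL.low k hkq)
    have h2 := h.search.free_add_le hL hkq hA
    have h3 := D.free_le (used := s.arr 12) (b := L k) (x := D.offB (L k))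
    have := hF k hkq _ (h3.trans h1) h2
    omega

/-- At the start every admissible matching is ahead at level `0`, so the invariant on the record is
vacuous; at the end it covers all of them. -/
theorem search_runs (hs : D.Input s) (hL : D.ListsLQ D.nB (s.reg 4) (s.arr 11)) (hW : D.size ≤ W)
    (hr : D.IsRank (s.arr 6)) (h2 : s.reg 2 = 0) (hu : ∀ a < D.nA, s.arr 12 a = 0)
    {Abar : Finset ℕ} {l : ℕ} {F : ℕ → ℕ}
    (hA : ∀ b < D.nB, 0 < D.low b → ∀ y, D.offB b ≤ y → y < D.offB (b + 1) → D.tgtB y ∈ Abar)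
    (hl : ∀ b < D.nB, 0 < D.low b → D.offB (b + 1) - D.offB b ≤ l)
    (hFq : 1000 * D.size ≤ F (s.reg 4))
    (hF : ∀ k < s.reg 4, ∀ f, f ≤ l → f + k ≤ Abar.card →
      200 * (l + 1) + f * F (k + 1) ≤ F k) :
    Runs W (search e) s (40 + F 0) (D.Best (s.arr 6) e fun _ => True) := by
  refine Runs.imp (.seq (Prog.wp_sound (p := .set 5 (.lit 0)) ⟨Nat.zero_le _, .seq
    (Prog.wp_sound (p := .set 6 (.lit 0)) ⟨Nat.zero_le _, .seq (T' := F 0 + 4) (Runs.imp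
    (Prog.wp_sound (Q := fun s' => D.SearchData (s.arr 6) (s.arr 11) (s.reg 4) 0 s' ∧
      s'.reg 2 = 0 ∧ (0 < s.reg 4 → s'.arr 14 (s.arr 11 0) = D.offB (s.arr 11 0))) ?_) le_rfl
      fun s1 ⟨h3, h4, h5⟩ => ?_)⟩)⟩)) ?_ fun s' h => h
  · have hin : D.Input ((s.setReg 5 (Expr.eval s (.lit 0))).setReg 6
        (Expr.eval (s.setReg 5 (Expr.eval s (.lit 0))) (.lit 0))) :=
      (hs.setReg (by simp)).setReg (by simp)
    have hqB := hL.le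
    unfold size at hW
    simp only [Prog.wp, Test.holds, Expr.eval, State.setReg_reg, State.setReg_arr,
      Nat.reduceEqDiff, reduceIte, hs.arr2]
    refine ⟨fun h => ?_, fun h => ?_⟩
    · have hL0 := hL.lt 0 h
      have := D.offB_le_m hL0.le
      refine ⟨by omega, by omega, ⟨hin.setArr (by simp), ?_, ?_, ?_, ?_, ?_, ⟨Nat.zero_le _,
        fun j hj => absurd hj (Nat.not_lt_zero _), fun a ha hua => ?_, fun _ => ?_⟩⟩, ?_, fun _ => ?_⟩
      all_goals simp [h2]
      · exact absurd (hu a ha) (by simpa using hua)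
      · exact D.offB_le _ hL0
    · refine ⟨⟨hin, ?_, ?_, ?_, ?_, ?_, ⟨Nat.zero_le _,
        fun j hj => absurd hj (Nat.not_lt_zero _), fun a ha hua => ?_, fun h' => absurd h' h⟩⟩, ?_,
        fun h' => absurd h' h⟩
      all_goals simp [h2]
      exact absurd (hu a ha) (by simpa using hua)
  · have hb : D.Best (s.arr 6) e
        (fun ν => ¬ D.Ahead (s.arr 6) (s.arr 11) (s.reg 4) ν (s1.arr 14) 0) s1 := by
      refine ⟨by omega, fun h => absurd h4 h, fun ν hν h => absurd (.inr ⟨fun i hi =>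
        absurd hi (Nat.not_lt_zero _), fun h0 => ?_⟩) h⟩
      obtain ⟨a, ha⟩ := hν.feas _ (hL.lt 0 h0) (hL.low 0 h0)
      refine ⟨a, ha, ?_⟩
      rw [h5 h0]
      exact (hr.mat hν.ge ha).1
    obtain ⟨t, s', hi, ht, hx⟩ := exists_iterates (e := e) hL hW hr hA hl hFq hF (s.reg 4) 0 s1
      (by omega) h3 hb h5
    refine ⟨_, s', hi.exec (by simp [Test.holds, Expr.eval, hx.1]), ?_, hx.2⟩
    simp [Test.cost, Expr.cost]
    omega
  · simp [Prog.bound, Expr.cost, Test.cost]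
    omega

end Layout
end LQMatching

namespace LQMatching
open Layout

/-! ### The running time -/

/-- The program for `MAXEFM` (`e = 1`) and `MAXRSM` (`e ≠ 1`). -/
def solve (e : ℕ) : Prog :=
  .seq (copyOffsets 7) (.seq fillBuckets (.seq readBuckets (.seq listLQ (search e))))

namespace Inst

variable (G : Inst)

theorem layout_size : G.layout.size = G.size := rfl

theorem input_encode : G.layout.Input G.encode := ⟨rfl, rfl, rfl, rfl, rfl, rfl, rfl⟩

theorem q_eq {q : ℕ} {L : ℕ → ℕ} (h : G.layout.ListsLQ G.nB q L) : q = G.q := by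
  have hlow : ∀ b : Fin G.nB, G.layout.low b = G.lower b := G.low_eq
  rw [Inst.q, ← Finset.card_range q]
  refine Finset.card_bij (fun j hj => ⟨L j, h.lt j (Finset.mem_range.1 hj)⟩) (fun j hj => ?_)
    (fun j hj j' hj' hjj => ?_) fun b hb => ?_
  · have := h.low j (Finset.mem_range.1 hj)
    simpa [lqResources, ← hlow] using this
  · exact h.inj j (Finset.mem_range.1 hj) j' (Finset.mem_range.1 hj') (by simpa using hjj)
  · have hb' : 0 < G.layout.low b := by
      rw [hlow]
      simpa [lqResources] using hb
    obtain ⟨j, hj, h1⟩ := h.surj b b.2 hb'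
    exact ⟨j, Finset.mem_range.2 hj, Fin.ext h1⟩

theorem length_le_ellLQ {b : ℕ} (hb : b < G.nB) (hl : 0 < G.layout.low b) :
    G.layout.offB (b + 1) - G.layout.offB b ≤ G.ellLQ := by
  have h1 : G.layout.offB (b + 1) = G.layout.offB b + (G.prefB ⟨b, hb⟩).length :=
    G.offB_succ ⟨b, hb⟩
  have h2 : 0 < G.lower ⟨b, hb⟩ := hl.trans_eq (G.low_eq ⟨b, hb⟩)
  have h3 : (G.prefB ⟨b, hb⟩).length ≤ G.ellLQ :=
    Finset.le_sup (f := fun b => (G.prefB b).length) (by simpa [lqResources] using h2)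
  omega

theorem tgtB_mem_lqAgents {b y : ℕ} (hb : b < G.nB) (hl : 0 < G.layout.low b)
    (hy : G.layout.offB b ≤ y) (hy' : y < G.layout.offB (b + 1)) :
    G.layout.tgtB y ∈ G.lqAgents.map Fin.valEmbedding := by
  obtain ⟨j, hj, _, h1⟩ := G.exists_tgtB ⟨b, hb⟩ hy hy'
  have h2 : 0 < G.lower ⟨b, hb⟩ := hl.trans_eq (G.low_eq ⟨b, hb⟩)
  refine Finset.mem_map.2 ⟨(G.prefB ⟨b, hb⟩)[j], ?_, h1.symm⟩
  simp only [lqAgents, Finset.mem_filter, Finset.mem_univ, true_and]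
  exact ⟨⟨b, hb⟩, h2, List.getElem_mem hj⟩

theorem ellLQ_le : G.ellLQ ≤ G.nA :=
  Finset.sup_le fun b _ => by simpa using (G.nodupB b).length_le_card

theorem q_le : G.q ≤ G.nB := G.lqResources.card_le_univ.trans_eq (Fintype.card_fin _)

end Inst

/-- The function `F` occurs only in the analysis. Leaving it open lets a single program satisfy both
time bounds. -/
theorem solve_solvesWithin (e : ℕ) (G : Inst) (F : ℕ → ℕ) (hFq : 1000 * G.size ≤ F G.q)
    (hF : ∀ k < G.q, ∀ f, f ≤ G.ellLQ → f + k ≤ G.abar →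
      200 * (G.ellLQ + 1) + f * F (k + 1) ≤ F k) :
    SolvesWithin (problem e) (solve e) G G.size (500 * G.size + F 0) := by
  have hW : G.layout.size ≤ G.size := G.layout_size.le
  have hs := G.input_encode
  suffices h : Runs G.size (solve e) G.encode (500 * G.size + F 0) (IsAnswer (problem e) G) by
    obtain ⟨t, s, he, ht, hq⟩ := h
    exact ⟨t, s, he, ht, hq⟩
  refine Runs.imp (.seq ((copyOffsets_runs (k := 7) (by norm_num) hs hW).frame.imp le_rfl
    fun s1 ⟨f1, h1⟩ => .seq ((fillBuckets_runs (hs.frame f1) hW h1).frame.imp le_rfl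
    fun s2 ⟨f2, h2⟩ => .seq ((readBuckets_runs ((hs.frame f1).frame f2) hW h2).frame.imp le_rfl
    fun s3 ⟨f3, h3⟩ => .seq (T' := 40 + F 0) ((listLQ_runs (((hs.frame f1).frame f2).frame f3) hW).frame.imp le_rfl
    fun s4 ⟨f4, h4⟩ => ?_))))) ?_ fun s' h => h
  · have hr : G.layout.IsRank (s4.arr 6) := by rw [f4.arr 6 rfl]; exact h3
    have hq := G.q_eq h4
    refine (search_runs (e := e) (F := F) (Abar := G.lqAgents.map Fin.valEmbedding)
      ((((hs.frame f1).frame f2).frame f3).frame f4) h4 hW hr ?_ (fun a ha => ?_)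
      (fun b hb hl y hy hy' => G.tgtB_mem_lqAgents hb hl hy hy')
      (fun b hb hl => G.length_le_ellLQ hb hl) (by rw [hq]; exact hFq)
      (by rw [hq, Finset.card_map]; exact hF)).imp le_rfl fun s hb => ?_
    · rw [f4.reg 2 rfl, f3.reg 2 rfl, f2.reg 2 rfl, f1.reg 2 rfl]
      rfl
    · rw [f4.arr 12 rfl, f3.arr 12 rfl, f2.arr 12 rfl, f1.arr 12 rfl]
      rfl
    · refine G.isAnswer_of_adm hr ?_
      by_cases h0 : s.reg 2 = 0
      · exact .inr ⟨h0, fun ν hν => (hb.best ν hν trivial).1 h0⟩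
      · obtain ⟨ν, hν, hc, ho⟩ := hb.sound h0
        have := hb.found
        exact .inl ⟨by omega, ν, hν, fun ν' hν' => hc ▸ (hb.best ν' hν' trivial).2, ho⟩
  · rw [G.layout_size]
    have : 1 ≤ G.size := by unfold Inst.size; omega
    omega

theorem SolvesWithin.mono {P : Problem} {p : Prog} {G : Inst} {W W' t t' : ℕ}
    (h : SolvesWithin P p G W t) (hW : W ≤ W') (ht : t ≤ t') : SolvesWithin P p G W' t' := by
  obtain ⟨t₀, s, he, h1, h2⟩ := h
  exact ⟨t₀, s, he.mono hW, h1.trans ht, h2⟩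

/-- For `l ≥ 2` the geometric sum is below `l ^ q`. For `l ≤ 1` it is at most `max 1 q`, which is
absorbed by `S`. -/
theorem geom_sum_bound (l q S : ℕ) (hl : l + 1 ≤ S) (hq : q ≤ S) :
    (l + 1) * ∑ i ∈ Finset.range q, l ^ i ≤ 2 * S * max 1 (l ^ q) := by
  rcases Nat.lt_or_ge l 2 with h | h
  · have h1 : ∑ i ∈ Finset.range q, l ^ i ≤ if l = 0 then 1 else q := by
      interval_cases l
      · cases q with
        | zero => simp
        | succ q => simp [Finset.sum_range_succ']
      · simp
    have h2 : (1 : ℕ) ≤ max 1 (l ^ q) := le_max_left _ _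
    have h3 : 2 * S * 1 ≤ 2 * S * max 1 (l ^ q) := Nat.mul_le_mul_left _ h2
    interval_cases l
    · simp only [if_true] at h1; omega
    · simp only [one_ne_zero, if_false] at h1; omega
  · have h1 : ∑ i ∈ Finset.range q, l ^ i < l ^ q := Nat.geomSum_lt h (by simp)
    calc (l + 1) * ∑ i ∈ Finset.range q, l ^ i ≤ S * l ^ q := Nat.mul_le_mul hl h1.le
      _ ≤ 2 * S * max 1 (l ^ q) := Nat.mul_le_mul (by omega) (le_max_right _ _)

theorem solve_solvesWithin_ell (e : ℕ) (G : Inst) :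
    SolvesWithin (problem e) (solve e) G G.size (2000 * G.size * max 1 (G.ellLQ ^ G.q)) := by
  have hl : G.ellLQ + 1 ≤ G.size := by
    have := G.ellLQ_le
    unfold Inst.size Inst.n
    omega
  have hq : G.q ≤ G.size := by
    have := G.q_le
    unfold Inst.size Inst.n
    omega
  have hg := geom_sum_bound _ _ _ hl hq
  set l := G.ellLQ
  -- The first summand pays for the leaves below level `k`, the second for scanning the lists at the
  -- inner nodes. The maximum with one covers `ellLQ = 0`.
  refine (solve_solvesWithin e G (fun k => 1000 * G.size * max 1 (l ^ (G.q - k)) +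
    200 * ((l + 1) * ∑ i ∈ Finset.range (G.q - k), l ^ i)) ?_ ?_).mono le_rfl ?_
  · simp
  · intro k hk f hf _
    obtain ⟨d, hd⟩ : ∃ d, G.q - k = d + 1 := ⟨G.q - k - 1, by omega⟩
    have hd' : G.q - (k + 1) = d := by omega
    simp only [hd, hd']
    have h1 : f * max 1 (l ^ d) ≤ max 1 (l ^ (d + 1)) := by
      rcases Nat.eq_zero_or_pos l with h0 | h0
      · have : f = 0 := by omega
        simp [this]
      · rw [max_eq_right (Nat.one_le_pow _ _ h0)]
        refine le_trans ?_ (le_max_right _ _)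
        rw [pow_succ, mul_comm]
        exact Nat.mul_le_mul_left _ hf
    have h2 : ∑ i ∈ Finset.range (d + 1), l ^ i = l * ∑ i ∈ Finset.range d, l ^ i + 1 := by
      rw [Finset.sum_range_succ', Finset.mul_sum]
      simp [pow_succ, mul_comm]
    rw [h2]
    have h3 : f * ∑ i ∈ Finset.range d, l ^ i ≤ l * ∑ i ∈ Finset.range d, l ^ i :=
      Nat.mul_le_mul_right _ hf
    calc _ = 1000 * G.size * (f * max 1 (l ^ d)) +
          200 * ((l + 1) * (f * ∑ i ∈ Finset.range d, l ^ i + 1)) := by ring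
      _ ≤ _ := by gcongr
  · simp only [Nat.sub_zero]
    have h1 : G.size * 1 ≤ G.size * max 1 (l ^ G.q) := Nat.mul_le_mul_left _ (le_max_left _ _)
    have h2 : ∀ x, x * G.size * max 1 (l ^ G.q) = x * (G.size * max 1 (l ^ G.q)) :=
      fun x => mul_assoc _ _ _
    rw [h2] at hg ⊢
    rw [h2]
    omega

/-- An upper bound for the solution of `g (j + 1) = (j + 1) * g j + 1`, `g 0 = 1`. -/
def descents (j : ℕ) : ℕ := if j = 0 then 1 else 6 * j.factorial - 3

theorem descents_succ {f j : ℕ} (hf : f ≤ j + 1) : 1 + f * descents j ≤ descents (j + 1) := by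
  unfold descents
  rcases Nat.eq_zero_or_pos j with rfl | h
  · simp; omega
  · have h1 := Nat.factorial_pos j
    rw [if_neg (by omega), if_neg (by omega), Nat.factorial_succ]
    refine (Nat.add_le_add_left (Nat.mul_le_mul_right _ hf) 1).trans ?_
    obtain ⟨x, hx⟩ : ∃ x, j.factorial = x + 1 := ⟨j.factorial - 1, by omega⟩
    rw [hx]
    have : 6 * (x + 1) - 3 = 6 * x + 3 := by omega
    rw [this]
    have : (j + 1) * (6 * x + 3) + (j + 1) * 3 = 6 * ((j + 1) * (x + 1)) := by ring
    omega

theorem solve_solvesWithin_abar (e : ℕ) (G : Inst) :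
    SolvesWithin (problem e) (solve e) G G.size (7000 * G.size * G.abar.factorial) := by
  have hl : G.ellLQ + 1 ≤ G.size := by
    have := G.ellLQ_le
    unfold Inst.size Inst.n
    omega
  have hpos : ∀ j, 1 ≤ descents j := fun j => by
    unfold descents
    have := Nat.factorial_pos j
    split_ifs <;> omega
  -- Each node is charged `1000 * G.size`, enough for a leaf as well as for scanning a list; the
  -- recurrence then counts nodes.
  refine (solve_solvesWithin e G (fun k => 1000 * G.size * descents (G.abar - k)) ?_ ?_).mono le_rfl ?_
  · exact Nat.le_mul_of_pos_right _ (hpos _)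
  · intro k hk f hf hfk
    -- With all agents acceptable to LQ resources used up, the node has no children.
    rcases Nat.eq_zero_or_pos (G.abar - k) with h0 | h0
    · have : f = 0 := by omega
      subst this
      have := Nat.le_mul_of_pos_right (1000 * G.size) (hpos (G.abar - k))
      omega
    · obtain ⟨j, hj⟩ : ∃ j, G.abar - k = j + 1 := ⟨G.abar - k - 1, by omega⟩
      have hj' : G.abar - (k + 1) = j := by omega
      simp only [hj, hj']
      have h1 := Nat.mul_le_mul_left (1000 * G.size) (descents_succ (f := f) (j := j) (by omega))
      have h2 : 1000 * G.size * (1 + f * descents j) =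
        1000 * G.size + f * (1000 * G.size * descents j) := by ring
      omega
  · simp only [Nat.sub_zero]
    have h1 : descents G.abar ≤ 6 * G.abar.factorial := by
      unfold descents
      have := Nat.factorial_pos G.abar
      split_ifs <;> omega
    have h2 : G.size * 1 ≤ G.size * G.abar.factorial :=
      Nat.mul_le_mul_left _ (Nat.factorial_pos _)
    have h3 := Nat.mul_le_mul_left (1000 * G.size) h1
    have h4 : 1000 * G.size * (6 * G.abar.factorial) = 6000 * (G.size * G.abar.factorial) := by ring
    have h5 : 7000 * G.size * G.abar.factorial = 7000 * (G.size * G.abar.factorial) := mul_assoc _ _ _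
    omega

/-- Each agent and each resource has an edge, so `nA`, `nB` and `1` are all at most `m`. -/
theorem Inst.NoIsolated.size_le {G : Inst} (h : G.NoIsolated) (hm : 0 < G.m) : G.size ≤ 4 * G.m := by
  have h1 : G.nA ≤ G.m := by
    rw [G.m_eq_sumA]
    calc G.nA = ∑ _a : Fin G.nA, 1 := by simp
      _ ≤ _ := Finset.sum_le_sum fun a _ => List.length_pos_iff.2 (h.1 a)
  have h2 : G.nB ≤ G.m := by
    rw [G.m_eq_sumB]
    calc G.nB = ∑ _b : Fin G.nB, 1 := by simp
      _ ≤ _ := Finset.sum_le_sum fun b _ => List.length_pos_iff.2 (h.2 b)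
  unfold size n
  omega

theorem Inst.NoIsolated.pow_pos {G : Inst} (h : G.NoIsolated) : 1 ≤ G.ellLQ ^ G.q := by
  rcases Nat.eq_zero_or_pos G.q with h0 | h0
  · simp [h0]
  · obtain ⟨b, hb⟩ := Finset.card_pos.1 h0
    refine Nat.one_le_pow _ _ ?_
    exact (List.length_pos_iff.2 (h.2 b)).trans_le
      (Finset.le_sup (f := fun b => (G.prefB b).length) hb)

theorem hasClaimedRunningTimes_problem (e : ℕ) : HasClaimedRunningTimes (problem e) := by
  -- The constant is `4 * 7000`: the larger of the two constants times the factor from `size ≤ 4 *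
  -- m`.
  refine ⟨solve e, 28000, fun G => ?_⟩
  have hW : G.size ≤ 28000 * G.size := by omega
  have h1 := solve_solvesWithin_ell e G
  have h2 := solve_solvesWithin_abar e G
  refine ⟨h1.mono hW (by gcongr; norm_num), h2.mono hW (by gcongr; norm_num), fun hn hm =>
    ⟨h1.mono hW ?_, h2.mono hW ?_⟩⟩
  · rw [max_eq_right hn.pow_pos, ← mul_assoc]
    have := hn.size_le hm
    exact Nat.mul_le_mul_right _ (by omega)
  · rw [← mul_assoc]
    have := hn.size_le hm
    exact Nat.mul_le_mul_right _ (by omega)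

/-! ### Computable bounds for fixed-parameter tractability -/

theorem isFPT_problem_ell (e : ℕ) : IsFPT (problem e) fun G => (G.q, G.ellLQ) := by
  have hp : Primrec fun x : ℕ × ℕ => 2000 * max 1 (x.2 ^ x.1) := by
    have hpow : Primrec fun x : ℕ × ℕ => x.2 ^ x.1 := by
      -- The power is obtained by primitive recursion on the exponent.
      refine (Primrec.nat_rec' (f := fun x : ℕ × ℕ => x.1) (g := fun _ => 1)
        (h := fun x y => y.2 * x.2) Primrec.fst (Primrec.const 1) ?_).of_eq fun x => ?_
      · exact Primrec.nat_mul.comp (Primrec.snd.comp Primrec.snd) (Primrec.snd.comp Primrec.fst)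
      · rcases x with ⟨n, l⟩
        induction n with
        | zero => rfl
        | succ n ih => simp only [pow_succ] at ih ⊢; rw [← ih]
    exact Primrec.nat_mul.comp (Primrec.const _) (Primrec.nat_max.comp (Primrec.const 1) hpow)
  refine ⟨solve e, _, 1, hp.to_comp, fun G => (solve_solvesWithin_ell e G).mono ?_ ?_⟩
  · have : 1 ≤ max 1 (G.ellLQ ^ G.q) := le_max_left _ _
    simp only [pow_one]
    exact Nat.le_mul_of_pos_left _ (by omega)
  · simp only [pow_one]
    exact (by ring : _ = _).le

theorem isFPT_problem_abar (e : ℕ) : IsFPT (problem e) fun G => G.abar := by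
  have hp : Primrec fun n : ℕ => 7000 * n.factorial := by
    have hf : Primrec Nat.factorial := by
      refine (Primrec.nat_rec₁ (f := fun n y => (n + 1) * y) 1 ?_).of_eq fun n => ?_
      · exact Primrec.nat_mul.comp (Primrec.succ.comp Primrec.fst) Primrec.snd
      · induction n with
        | zero => rfl
        | succ n ih => rw [Nat.factorial_succ, ← ih]
    exact Primrec.nat_mul.comp (Primrec.const _) hf
  refine ⟨solve e, _, 1, hp.to_comp, fun G => (solve_solvesWithin_abar e G).mono ?_ ?_⟩
  · have := Nat.factorial_pos G.abar
    simp only [pow_one]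
    exact Nat.le_mul_of_pos_left _ (by omega)
  · simp only [pow_one]
    exact (by ring : _ = _).le

end LQMatching

theorem theorem3 :
    (LQMatching.IsFPT LQMatching.MAXEFM (fun G => (G.q, G.ellLQ)) ∧
      LQMatching.IsFPT LQMatching.MAXEFM (fun G => G.abar) ∧
      LQMatching.HasClaimedRunningTimes LQMatching.MAXEFM) ∧
    (LQMatching.IsFPT LQMatching.MAXRSM (fun G => (G.q, G.ellLQ)) ∧
      LQMatching.IsFPT LQMatching.MAXRSM (fun G => G.abar) ∧
      LQMatching.HasClaimedRunningTimes LQMatching.MAXRSM) := by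
  rw [← LQMatching.problem_one, ← LQMatching.problem_zero]
  exact ⟨⟨LQMatching.isFPT_problem_ell 1, LQMatching.isFPT_problem_abar 1,
    LQMatching.hasClaimedRunningTimes_problem 1⟩, LQMatching.isFPT_problem_ell 0,
    LQMatching.isFPT_problem_abar 0, LQMatching.hasClaimedRunningTimes_problem 0⟩
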